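/- Let $\Omega\subset\mathbb{R}^3$ be a bounded open set with smooth ($C^\infty$) boundary $S=\partial\Omega$ (near each point of $S$, $\Omega$ is the sublevel set $\{\rho<0\}$ of a smooth function $\rho$ without critical points), let $\mathbf n$ be the outward unit normal on $S$ and $dS$ the surface measure, and let $f:S\to\mathbb{R}$ be smooth. For $\mathbf y\in S$ consider the modified adjoint double layer potential $$v(\mathbf y)=\int_S\frac{\big(f(\mathbf x)\mathbf n(\mathbf y)+f(\mathbf y)\mathbf n(\mathbf x)\big)\cdot(\mathbf y-\mathbf x)}{4\pi|\mathbf x-\mathbf y|^3}\,dS(\mathbf x)+\tfrac12 f(\mathbf y)$$ and, for $\delta>0$, its regularization $$v_\delta(\mathbf y)=\int_S\frac{\big(f(\mathbf x)\mathbf n(\mathbf y)+f(\mathbf y)\mathbf n(\mathbf x)\big)\cdot(\mathbf y-\mathbf x)\;s_5(|\mathbf x-\mathbf y|/\delta)}{4\pi|\mathbf x-\mathbf y|^3}\,dS(\mathbf x)+\tfrac12 f(\mathbf y)$$ with the shape factor $$s_5(r)=\operatorname{erf}(r)-\frac{2}{\sqrt\pi}\Big(r-\frac{2r^3}{3}\Big)e^{-r^2},\qquad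 \operatorname{erf}(r)=\frac{2}{\sqrt\pi}\int_0^r e^{-t^2}\,dt .$$ Then both integrals converge absolutely for all $\mathbf y\in S$ and $\delta>0$, and the regularization error is $O(\delta^5)$ uniformly on $S$: there is a constant $C$, depending only on $\Omega$ and $f$, such that $$|v_\delta(\mathbf y)-v(\mathbf y)|\le C\,\delta^5\qquad\text{for all }\delta>0,\ \mathbf y\in S .$$ Moreover, with $s_5$ the fourth-order terms of the expanded integrand contribute nothing to the error: if $P:\mathbb{R}^2\to\mathbb{R}$ is continuous and homogeneous of degree four, i.e. $P(t\xi)=t^4P(\xi)$ for all $t>0$ (in particular, if $P$ is a homogeneous polynomial of degree four), then for every $\delta>0$ the integral $$\frac1{4\pi}\int_{\mathbb{R}^2}\frac{s_5(|\xi|/\delta)-1}{|\xi|^3}\,P(\xi)\,d\xi$$ converges absolutely and equals $0$. -/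

import Mathlib

open scoped ContDiff
open MeasureTheory

noncomputable section

namespace AdjointDoubleLayer

/-- Three-dimensional Euclidean space. -/
abbrev E3 : Type := EuclideanSpace ℝ (Fin 3)

/-- The error function `erf x = (2 / √π) ∫₀ˣ exp (-t²) dt`. -/
def erf (x : ℝ) : ℝ :=
  2 / Real.sqrt Real.pi * ∫ t in (0 : ℝ)..x, Real.exp (-t ^ 2)

/-- The fifth order shape factor
`s₅ r = erf r - (2 / √π) (r - 2 r³ / 3) exp (-r²)`. -/
def shapeFive (r : ℝ) : ℝ :=
  erf r - 2 / Real.sqrt Real.pi * (r - 2 * r ^ 3 / 3) * Real.exp (-r ^ 2)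

/-- `ρ` is a smooth defining function of `Ω` on the open set `U`: it has no critical
point in `U`, and inside `U` the set `Ω` is the sublevel set `{ρ < 0}`. -/
structure IsDefiningFunctionOn (Ω U : Set E3) (ρ : E3 → ℝ) : Prop where
  isOpen : IsOpen U
  smooth : ContDiffOn ℝ ∞ ρ U
  gradient_ne_zero : ∀ x ∈ U, gradient ρ x ≠ 0
  inter_eq : Ω ∩ U = {x ∈ U | ρ x < 0}

/-- `Ω` has a smooth boundary and lies locally on one side of it: near each of its boundary
points `Ω` has a smooth defining function. -/
def HasSmoothBoundary (Ω : Set E3) : Prop :=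
  ∀ y ∈ frontier Ω, ∃ U : Set E3, ∃ ρ : E3 → ℝ, y ∈ U ∧ IsDefiningFunctionOn Ω U ρ

/-- `ν` is the outward unit normal of `Ω` at the boundary point `y`: the normalized gradient
at `y` of a local defining function. -/
def IsOutwardUnitNormal (Ω : Set E3) (y ν : E3) : Prop :=
  ∃ U : Set E3, ∃ ρ : E3 → ℝ, y ∈ U ∧ IsDefiningFunctionOn Ω U ρ ∧
    ν = ‖gradient ρ y‖⁻¹ • gradient ρ y

/-- The outward unit normal of `Ω` at `y`. For a boundary point `y` of a set with smooth
boundary it exists and is unique (see `outwardNormal_spec` and `IsOutwardUnitNormal.unique`). -/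
def outwardNormal (Ω : Set E3) (y : E3) : E3 :=
  Classical.epsilon (IsOutwardUnitNormal Ω y)

theorem outwardNormal_spec {Ω : Set E3} (hΩ : HasSmoothBoundary Ω) {y : E3}
    (hy : y ∈ frontier Ω) : IsOutwardUnitNormal Ω y (outwardNormal Ω y) := by
  obtain ⟨U, ρ, hyU, h⟩ := hΩ y hy
  exact Classical.epsilon_spec (p := IsOutwardUnitNormal Ω y) ⟨_, U, ρ, hyU, h, rfl⟩

/-- Moving from a boundary point in a direction of strict decrease (increase) of a defining
function leads into (out of) `Ω`. -/
theorem IsDefiningFunctionOn.eventually {Ω U : Set E3} {ρ : E3 → ℝ}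
    (h : IsDefiningFunctionOn Ω U ρ) {y : E3} (hyU : y ∈ U) (hy : y ∈ frontier Ω) (v : E3) :
    (inner ℝ (gradient ρ y) v < 0 →
      ∀ᶠ t : ℝ in nhdsWithin 0 (Set.Ioi 0), y + t • v ∈ Ω) ∧
    (0 < inner ℝ (gradient ρ y) v →
      ∀ᶠ t : ℝ in nhdsWithin 0 (Set.Ioi 0), y + t • v ∉ Ω) := by
  have hmem : ∀ x ∈ U, (x ∈ Ω ↔ ρ x < 0) := fun x hx => by
    have := Set.ext_iff.1 h.inter_eq x
    simp only [Set.mem_inter_iff, Set.mem_ofPred_eq] at this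
    tauto
  have hUn : U ∈ nhds y := h.isOpen.mem_nhds hyU
  have hdiff : DifferentiableAt ℝ ρ y :=
    (h.smooth.contDiffAt hUn).differentiableAt (by simp)
  have hcont : ContinuousAt ρ y := hdiff.continuousAt
  have hzero : ρ y = 0 := by
    rcases lt_trichotomy (ρ y) 0 with hlt | heq | hgt
    · exfalso
      refine hy.2 (mem_interior_iff_mem_nhds.2 ?_)
      filter_upwards [hcont.eventually (gt_mem_nhds hlt), hUn] with x hx hxU
      exact (hmem x hxU).2 hx
    · exact heq
    · exfalso
      have hev : ∀ᶠ x in nhds y, x ∉ Ω := by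
        filter_upwards [hcont.eventually (lt_mem_nhds hgt), hUn] with x hx hxU hxΩ
        exact absurd ((hmem x hxU).1 hxΩ) (not_lt.2 (le_of_lt hx))
      exact (mem_closure_iff_frequently.1 hy.1) hev
  have hline : HasDerivAt (fun t : ℝ => y + t • v) v 0 := by
    simpa using ((hasDerivAt_id (0 : ℝ)).smul_const v).const_add y
  have hg : HasDerivAt (fun t : ℝ => ρ (y + t • v)) (inner ℝ (gradient ρ y) v) 0 := by
    have h1 : HasFDerivAt ρ (InnerProductSpace.toDual ℝ E3 (gradient ρ y)) (y + (0 : ℝ) • v) := by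
      simpa using hdiff.hasGradientAt.hasFDerivAt
    exact h1.comp_hasDerivAt (0 : ℝ) hline
  have hin : ∀ᶠ t : ℝ in nhdsWithin 0 (Set.Ioi 0), y + t • v ∈ U := by
    refine nhdsWithin_le_nhds (hline.continuousAt.eventually ?_)
    simpa using h.isOpen.mem_nhds hyU
  have hslope := (hasDerivAt_iff_tendsto_slope.1 hg).mono_left
    (nhdsWithin_mono (0 : ℝ) (fun t (ht : 0 < t) => ht.ne'))
  constructor
  · intro hv
    filter_upwards [hin, hslope.eventually (gt_mem_nhds hv), self_mem_nhdsWithin]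
      with t htU ht ht0
    refine (hmem _ htU).2 ?_
    have ht0' : (0 : ℝ) < t := ht0
    simp only [slope_def_field, zero_smul, add_zero, hzero, sub_zero] at ht
    by_contra hcon
    exact absurd ht (not_lt.2 (div_nonneg (not_lt.1 hcon) ht0'.le))
  · intro hv
    filter_upwards [hin, hslope.eventually (lt_mem_nhds hv), self_mem_nhdsWithin]
      with t htU ht ht0 hΩ
    have ht0' : (0 : ℝ) < t := ht0
    have hneg := (hmem _ htU).1 hΩ
    simp only [slope_def_field, zero_smul, add_zero, hzero, sub_zero] at ht
    exact absurd ht (not_lt.2 (div_neg_of_neg_of_pos hneg ht0').le)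

/-- The outward unit normal at a boundary point is unique. -/
theorem IsOutwardUnitNormal.unique {Ω : Set E3} {y ν ν' : E3} (hy : y ∈ frontier Ω)
    (h : IsOutwardUnitNormal Ω y ν) (h' : IsOutwardUnitNormal Ω y ν') : ν = ν' := by
  obtain ⟨U, ρ, hyU, hρ, rfl⟩ := h
  obtain ⟨U', ρ', hyU', hρ', rfl⟩ := h'
  have ha := hρ.gradient_ne_zero y hyU
  have hb := hρ'.gradient_ne_zero y hyU'
  have A := hρ.eventually hyU hy
  have B := hρ'.eventually hyU' hy
  set a := gradient ρ y
  set b := gradient ρ' y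
  have hna : 0 < ‖a‖ := norm_pos_iff.2 ha
  have hnb : 0 < ‖b‖ := norm_pos_iff.2 hb
  set u := ‖a‖⁻¹ • a
  set w := ‖b‖⁻¹ • b
  have hu : ‖u‖ = 1 := by simp [u, norm_smul, hna.ne']
  have hw : ‖w‖ = 1 := by simp [w, norm_smul, hnb.ne']
  have hau : a = ‖a‖ • u := by simp [u, smul_smul, hna.ne']
  have hbw : b = ‖b‖ • w := by simp [w, smul_smul, hnb.ne']
  by_contra hne
  have hlt : inner ℝ u w < 1 := (inner_lt_one_iff_real_of_norm_eq_one hu hw).2 hne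
  have h1 : inner ℝ a (w - u) < 0 := by
    rw [hau, real_inner_smul_left, inner_sub_right, real_inner_self_eq_norm_sq, hu]
    nlinarith
  have h2 : 0 < inner ℝ b (w - u) := by
    rw [hbw, real_inner_smul_left, inner_sub_right, real_inner_self_eq_norm_sq, hw,
      real_inner_comm]
    nlinarith
  obtain ⟨t, ht1, ht2⟩ := ((A (w - u)).1 h1 |>.and ((B (w - u)).2 h2)).exists
  exact ht2 ht1

/-- Surface measure on the boundary `S` of `Ω`: two-dimensional Hausdorff measure on `S`,
normalized so that it agrees with area. -/
def surfaceMeasure (Ω : Set E3) : Measure E3 :=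
  (Measure.euclideanHausdorffMeasure 2 : Measure E3).restrict (frontier Ω)

/-- Integrand of the modified adjoint double layer potential,
`(f(x) n(y) + f(y) n(x)) · (y - x) / (4 π |x - y|³)`. -/
def integrand (Ω : Set E3) (f : E3 → ℝ) (y x : E3) : ℝ :=
  inner ℝ (f x • outwardNormal Ω y + f y • outwardNormal Ω x) (y - x) /
    (4 * Real.pi * ‖x - y‖ ^ 3)

/-- The modified adjoint double layer potential `v(y)`. -/
def potential (Ω : Set E3) (f : E3 → ℝ) (y : E3) : ℝ :=
  (∫ x, integrand Ω f y x ∂(surfaceMeasure Ω)) + 1 / 2 * f y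

/-- Integrand of the modified adjoint double layer potential regularized with the shape
factor `s` and the regularization parameter `δ`. -/
def regIntegrand (s : ℝ → ℝ) (δ : ℝ) (Ω : Set E3) (f : E3 → ℝ) (y x : E3) : ℝ :=
  inner ℝ (f x • outwardNormal Ω y + f y • outwardNormal Ω x) (y - x) * s (‖x - y‖ / δ) /
    (4 * Real.pi * ‖x - y‖ ^ 3)

/-- The regularized modified adjoint double layer potential `v_δ(y)`. -/
def regPotential (s : ℝ → ℝ) (δ : ℝ) (Ω : Set E3) (f : E3 → ℝ) (y : E3) : ℝ :=
  (∫ x, regIntegrand s δ Ω f y x ∂(surfaceMeasure Ω)) + 1 / 2 * f y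

/-- Contribution `(4 π)⁻¹ ∫ φ(|ξ|/δ) |ξ|⁻³ w(ξ) dξ` of a term `w` of the expanded integrand, in
planar coordinates `ξ` with `|ξ| = |x - y|`, to the regularization error of the shape factor
`s`, where `φ = s - 1`: this is the integrand, the constant factor included. -/
def errorIntegrand (s : ℝ → ℝ) (δ : ℝ) (w : EuclideanSpace ℝ (Fin 2) → ℝ)
    (ξ : EuclideanSpace ℝ (Fin 2)) : ℝ :=
  (4 * Real.pi)⁻¹ * ((s (‖ξ‖ / δ) - 1) / ‖ξ‖ ^ 3 * w ξ)

end AdjointDoubleLayer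

end

open scoped ContDiff
open MeasureTheory

noncomputable section

namespace AdjointDoubleLayer

/-! ### The shape factor: Gaussian decay and vanishing second moment of the defect. -/

open Set Filter Topology

/-! The regularization error is the surface integral of the unregularized integrand times `defect
(‖x - y‖ / δ)`, and the defect is Gaussian small. At a fixed distance from `y` it is therefore
`O(δ⁵)`, and the surface has finite measure, so only a neighbourhood of `y` matters. Compactness of
the boundary makes the local constants uniform (`exists_local_bound`, `exists_uniform_bound`).

Near `y` the boundary is a graph `G` over the tangent plane (`exists_parametrization`), and the area
formula `pullback_eq` turns the surface integral into a planar one. The numerator of the kernel is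
cubic in the distance (`exists_numerator_bound`): the mean of two normals is orthogonal to the chord
up to third order (`exists_trapezoid_bound`), and the difference of the two values of `f` adds one
power to the quadratic normal component of the chord. Hence the integrand is bounded, which already
gives absolute convergence.

The defect depends on the chord length `ρ`, not on the parameter `r` along a ray, so the kernel is
expanded in powers of `ρ`. With `D = ρ ρ'`, the kernel times the polar Jacobian equals `D (a + b ρ +
c ρ²) + O(r⁴)` (`exists_radial_expansion`). The substitution `u = ρ r` (`integral_substitution`)
turns the three terms into the first, second and third moments of the defect, with factors `δ²`,
`δ³`, `δ⁴`, up to `O(δ⁵)`. The second moment vanishes (`integral_sq_mul_defect`); this is the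
property for which `s₅` is designed. The coefficients `a` and `c` change sign when the ray is
reversed, so opposite rays cancel the other two terms (`exists_ray_bound`). The remainder `O(r⁴)`
integrates against the defect to `O(δ⁵)`.

The statement on homogeneous `P` rests on the same moment: in polar coordinates the integrand is a
function of the direction times `r²` times the rescaled defect. -/

/-- The defect `s₅ - 1` of the fifth order shape factor. -/
def defect (r : ℝ) : ℝ := shapeFive r - 1

theorem hasDerivAt_erf (r : ℝ) :
    HasDerivAt erf (2 / Real.sqrt Real.pi * Real.exp (-r ^ 2)) r := by
  have hc : Continuous fun t : ℝ => Real.exp (-t ^ 2) := by fun_prop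
  exact (intervalIntegral.integral_hasDerivAt_right (hc.intervalIntegrable _ _)
    (hc.stronglyMeasurableAtFilter _ _) hc.continuousAt).const_mul _

theorem hasDerivAt_defect (r : ℝ) :
    HasDerivAt defect
      (2 / Real.sqrt Real.pi * (4 * r ^ 2 - 4 / 3 * r ^ 4) * Real.exp (-r ^ 2)) r := by
  have h1 : HasDerivAt (fun r : ℝ => 2 / Real.sqrt Real.pi * (r - 2 * r ^ 3 / 3))
      (2 / Real.sqrt Real.pi * (1 - 2 * (3 * r ^ 2) / 3)) r := by
    have := ((hasDerivAt_id r).sub (((hasDerivAt_pow 3 r).const_mul 2).div_const 3)).const_mul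
      (2 / Real.sqrt Real.pi)
    simpa using this
  have h2 : HasDerivAt (fun r : ℝ => Real.exp (-r ^ 2)) (Real.exp (-r ^ 2) * (-(2 * r))) r := by
    have := ((hasDerivAt_pow 2 r).neg).exp
    simpa using this
  have := ((hasDerivAt_erf r).sub (h1.mul h2)).sub_const 1
  refine this.congr_deriv ?_
  ring

theorem continuous_defect : Continuous defect :=
  continuous_iff_continuousAt.2 fun r => (hasDerivAt_defect r).continuousAt

theorem integrable_exp_neg_sq : Integrable fun t : ℝ => Real.exp (-t ^ 2) := by
  simpa using integrable_exp_neg_mul_sq (b := 1) one_pos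

theorem one_sub_erf_eq (r : ℝ) :
    1 - erf r = 2 / Real.sqrt Real.pi * ∫ t in Ioi r, Real.exp (-t ^ 2) := by
  have h0 : ∫ t in Ioi (0 : ℝ), Real.exp (-t ^ 2) = Real.sqrt Real.pi / 2 := by
    simpa using integral_gaussian_Ioi 1
  have h1 := intervalIntegral.integral_Ioi_sub_Ioi' (μ := volume) (a := (0 : ℝ)) (b := r)
    (f := fun t : ℝ => Real.exp (-t ^ 2)) integrable_exp_neg_sq.integrableOn
    integrable_exp_neg_sq.integrableOn
  have hpi : 0 < Real.sqrt Real.pi := Real.sqrt_pos.2 Real.pi_pos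
  rw [erf, ← h1, h0]
  field_simp
  ring

/-- Used to absorb polynomial factors at the price of a quarter of the Gaussian exponent. -/
theorem pow_le_mul_exp_sq (k : ℕ) : ∃ C : ℝ, 0 ≤ C ∧ ∀ r : ℝ, 0 ≤ r →
    r ^ k ≤ C * Real.exp (r ^ 2 / 4) := by
  -- The `k`-th Taylor term of `exp (r² / 4)` controls `r ^ (2 k)`, and `r ^ k ≤ 1 + r ^ (2 k)`
  -- covers odd powers as well.
  refine ⟨1 + 4 ^ k * k.factorial, by positivity, fun r hr => ?_⟩
  have h1 := Real.pow_div_factorial_le_exp (r ^ 2 / 4) (by positivity) k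
  rw [div_le_iff₀ (by positivity), div_pow, div_le_iff₀ (by positivity)] at h1
  have h2 : 1 ≤ Real.exp (r ^ 2 / 4) := Real.one_le_exp (by positivity)
  have h3 : r ^ k ≤ 1 + (r ^ 2) ^ k := by
    rw [← pow_mul, mul_comm 2 k, pow_mul]
    nlinarith [sq_nonneg (r ^ k - 1 / 2)]
  nlinarith

/-- The defect decays like a Gaussian. -/
theorem exists_abs_defect_le :
    ∃ C : ℝ, 0 ≤ C ∧ ∀ r : ℝ, 0 ≤ r → |defect r| ≤ C * Real.exp (-(r ^ 2 / 2)) := by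
  obtain ⟨C1, hC1, h1⟩ := pow_le_mul_exp_sq 1
  obtain ⟨C3, hC3, h3⟩ := pow_le_mul_exp_sq 3
  have hint : Integrable fun t : ℝ => Real.exp (-(t ^ 2 / 2)) := by
    have := integrable_exp_neg_mul_sq (b := 1 / 2) (by norm_num)
    refine this.congr (.of_forall fun t => ?_)
    simp only
    congr 1
    ring
  set I := ∫ t, Real.exp (-(t ^ 2 / 2))
  have hI : 0 ≤ I := integral_nonneg fun t => (Real.exp_pos _).le
  set c := 2 / Real.sqrt Real.pi
  have hc : 0 ≤ c := by positivity
  refine ⟨c * I + c * (C1 + C3), by positivity, fun r hr => ?_⟩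
  have hE : 0 < Real.exp (-(r ^ 2 / 2)) := Real.exp_pos _
  -- Half of the exponent is evaluated at the endpoint `r`, the other half keeps the tail
  -- integrable.
  have htail : ∫ t in Ioi r, Real.exp (-t ^ 2) ≤ Real.exp (-(r ^ 2 / 2)) * I := by
    calc ∫ t in Ioi r, Real.exp (-t ^ 2)
        ≤ ∫ t in Ioi r, Real.exp (-(r ^ 2 / 2)) * Real.exp (-(t ^ 2 / 2)) := by
          refine setIntegral_mono_on integrable_exp_neg_sq.integrableOn
            (hint.const_mul _).integrableOn measurableSet_Ioi fun t ht => ?_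
          rw [← Real.exp_add, Real.exp_le_exp]
          have : r ^ 2 ≤ t ^ 2 := pow_le_pow_left₀ hr (le_of_lt ht) 2
          linarith
      _ = Real.exp (-(r ^ 2 / 2)) * ∫ t in Ioi r, Real.exp (-(t ^ 2 / 2)) :=
          integral_const_mul _ _
      _ ≤ Real.exp (-(r ^ 2 / 2)) * I :=
          mul_le_mul_of_nonneg_left
            (setIntegral_le_integral hint (.of_forall fun t => (Real.exp_pos _).le)) hE.le
  have htail0 : 0 ≤ ∫ t in Ioi r, Real.exp (-t ^ 2) :=
    integral_nonneg fun t => (Real.exp_pos _).le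
  have hpoly : |r - 2 * r ^ 3 / 3| ≤ (C1 + C3) * Real.exp (r ^ 2 / 4) := by
    have := h1 r hr
    have := h3 r hr
    have : 0 ≤ r ^ 3 := by positivity
    rw [abs_le]
    constructor <;> nlinarith
  have hsplit : Real.exp (r ^ 2 / 4) * Real.exp (-r ^ 2) ≤ Real.exp (-(r ^ 2 / 2)) := by
    rw [← Real.exp_add, Real.exp_le_exp]
    nlinarith [sq_nonneg r]
  have hsecond : |c * (r - 2 * r ^ 3 / 3) * Real.exp (-r ^ 2)|
      ≤ c * (C1 + C3) * Real.exp (-(r ^ 2 / 2)) := by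
    rw [abs_mul, abs_mul, abs_of_nonneg hc, abs_of_pos (Real.exp_pos (-r ^ 2))]
    calc c * |r - 2 * r ^ 3 / 3| * Real.exp (-r ^ 2)
        ≤ c * ((C1 + C3) * Real.exp (r ^ 2 / 4)) * Real.exp (-r ^ 2) := by gcongr
      _ = c * (C1 + C3) * (Real.exp (r ^ 2 / 4) * Real.exp (-r ^ 2)) := by ring
      _ ≤ _ := by gcongr
  have hdef : defect r = -(c * ∫ t in Ioi r, Real.exp (-t ^ 2))
      - c * (r - 2 * r ^ 3 / 3) * Real.exp (-r ^ 2) := by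
    rw [← one_sub_erf_eq, defect, shapeFive]
    ring
  have hfirst : |-(c * ∫ t in Ioi r, Real.exp (-t ^ 2))| ≤ c * I * Real.exp (-(r ^ 2 / 2)) := by
    rw [abs_neg, abs_of_nonneg (by positivity)]
    calc _ ≤ c * (Real.exp (-(r ^ 2 / 2)) * I) := by gcongr
      _ = _ := by ring
  rw [hdef]
  calc _ ≤ _ := abs_sub _ _
    _ ≤ _ := add_le_add hfirst hsecond
    _ = _ := by ring

theorem exists_pow_mul_abs_defect_le (k : ℕ) :
    ∃ C : ℝ, 0 ≤ C ∧ ∀ r : ℝ, 0 ≤ r → r ^ k * |defect r| ≤ C * Real.exp (-(r ^ 2 / 4)) := by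
  obtain ⟨C, hC, h⟩ := exists_abs_defect_le
  obtain ⟨D, hD, h'⟩ := pow_le_mul_exp_sq k
  refine ⟨D * C, by positivity, fun r hr => ?_⟩
  calc r ^ k * |defect r| ≤ (D * Real.exp (r ^ 2 / 4)) * (C * Real.exp (-(r ^ 2 / 2))) :=
        mul_le_mul (h' r hr) (h r hr) (abs_nonneg _) (by positivity)
    _ = D * C * (Real.exp (r ^ 2 / 4) * Real.exp (-(r ^ 2 / 2))) := by ring
    _ = _ := by rw [← Real.exp_add]; ring_nf

theorem integrable_exp_neg_sq_div_four : Integrable fun t : ℝ => Real.exp (-(t ^ 2 / 4)) := by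
  have := integrable_exp_neg_mul_sq (b := 1 / 4) (by norm_num)
  refine this.congr (.of_forall fun t => ?_)
  simp only
  congr 1
  ring

theorem integrableOn_pow_mul_defect (k : ℕ) :
    IntegrableOn (fun r : ℝ => r ^ k * defect r) (Ioi 0) := by
  obtain ⟨C, hC, h⟩ := exists_pow_mul_abs_defect_le k
  refine Integrable.mono' (integrable_exp_neg_sq_div_four.const_mul C).integrableOn
    ((continuous_pow k).mul continuous_defect).aestronglyMeasurable ?_
  filter_upwards [self_mem_ae_restrict measurableSet_Ioi] with r hr
  have hr : 0 < r := hr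
  rw [Real.norm_eq_abs, abs_mul, abs_of_pos (pow_pos hr k)]
  exact h r hr.le

/-- The second moment of the defect vanishes. -/
theorem integral_sq_mul_defect : ∫ r in Ioi (0 : ℝ), r ^ 2 * defect r = 0 := by
  set c := 2 / Real.sqrt Real.pi
  -- Integration by parts: `r³ / 3` times the derivative of the defect is again exact, with
  -- primitive `(2 / 9) c r⁶ exp (-r²)`. The coefficient `2 / 3` in `s₅` is what makes it so. The
  -- primitive vanishes at `0` and at infinity.
  have hderiv : ∀ r : ℝ, HasDerivAt
      (fun r => r ^ 3 / 3 * defect r - 2 / 9 * c * (r ^ 6 * Real.exp (-r ^ 2)))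
      (r ^ 2 * defect r) r := by
    intro r
    have h2 : HasDerivAt (fun r : ℝ => Real.exp (-r ^ 2)) (Real.exp (-r ^ 2) * (-(2 * r))) r := by
      have := ((hasDerivAt_pow 2 r).neg).exp
      simpa using this
    have := (((hasDerivAt_pow 3 r).div_const 3).mul (hasDerivAt_defect r)).sub
      (((hasDerivAt_pow 6 r).mul h2).const_mul (2 / 9 * c))
    refine this.congr_deriv ?_
    simp only [c]
    push_cast
    ring
  have hlim1 : Tendsto (fun r : ℝ => Real.exp (-(r ^ 2 / 4))) atTop (𝓝 0) := by
    refine Real.tendsto_exp_neg_atTop_nhds_zero.comp ?_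
    exact (tendsto_pow_atTop (by norm_num)).atTop_div_const (by norm_num)
  have ht1 : Tendsto (fun r : ℝ => r ^ 3 * defect r) atTop (𝓝 0) := by
    obtain ⟨C, hC, h⟩ := exists_pow_mul_abs_defect_le 3
    have := hlim1.const_mul C
    rw [mul_zero] at this
    refine squeeze_zero_norm' ?_ this
    filter_upwards [eventually_ge_atTop 0] with r hr
    rw [Real.norm_eq_abs, abs_mul, abs_of_nonneg (pow_nonneg hr 3)]
    exact h r hr
  have ht2 : Tendsto (fun r : ℝ => r ^ 6 * Real.exp (-r ^ 2)) atTop (𝓝 0) := by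
    obtain ⟨C, hC, h⟩ := pow_le_mul_exp_sq 6
    have := hlim1.const_mul C
    rw [mul_zero] at this
    refine squeeze_zero_norm' ?_ this
    filter_upwards [eventually_ge_atTop 0] with r hr
    rw [Real.norm_eq_abs, abs_of_nonneg (by positivity)]
    calc r ^ 6 * Real.exp (-r ^ 2) ≤ C * Real.exp (r ^ 2 / 4) * Real.exp (-r ^ 2) := by
          gcongr
          exact h r hr
      _ = C * (Real.exp (r ^ 2 / 4) * Real.exp (-r ^ 2)) := by ring
      _ ≤ C * Real.exp (-(r ^ 2 / 4)) := by
          rw [← Real.exp_add]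
          gcongr
          nlinarith [sq_nonneg r]
  have htend : Tendsto (fun r => r ^ 3 / 3 * defect r - 2 / 9 * c * (r ^ 6 * Real.exp (-r ^ 2)))
      atTop (𝓝 0) := by
    have := (ht1.const_mul (1 / 3)).sub (ht2.const_mul (2 / 9 * c))
    simp only [mul_zero, sub_zero] at this
    refine this.congr fun r => ?_
    ring
  have := integral_Ioi_of_hasDerivAt_of_tendsto' (a := (0 : ℝ)) (fun r _ => hderiv r)
    (integrableOn_pow_mul_defect 2) htend
  rw [this]
  simp

/-! ### Algebra of expansions at `r = 0`, uniform over a family of indices. -/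

open Set Filter Topology Asymptotics

section Expansion

variable {I : Type}

/-- The filter of pairs `(i, r)` with `r → 0`, `r ≠ 0`, uniformly in the index `i`. -/
def nearZero (I : Type) : Filter (I × ℝ) := (⊤ : Filter I) ×ˢ 𝓝[≠] (0 : ℝ)

theorem eventually_nearZero {p : I × ℝ → Prop} :
    (∀ᶠ q in nearZero I, p q) ↔ ∃ ε > 0, ∀ i r, r ≠ 0 → |r| < ε → p (i, r) := by
  have hb : (𝓝[≠] (0 : ℝ)).HasBasis (fun ε : ℝ => 0 < ε) fun ε => Metric.ball 0 ε ∩ {0}ᶜ :=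
    nhdsWithin_hasBasis Metric.nhds_basis_ball _
  rw [nearZero, (hasBasis_top.prod hb).eventually_iff]
  constructor
  · rintro ⟨⟨_, ε⟩, ⟨_, hε⟩, h⟩
    refine ⟨ε, hε, fun i r hr hrε => h ⟨mem_univ _, ?_, hr⟩⟩
    simpa using hrε
  · rintro ⟨ε, hε, h⟩
    refine ⟨⟨(), ε⟩, ⟨trivial, hε⟩, ?_⟩
    rintro ⟨i, r⟩ ⟨_, hr, hr0⟩
    exact h i r hr0 (by simpa using hr)

theorem isBigO_nearZero {F : Type*} [NormedAddCommGroup F] {g : I × ℝ → F} {n : ℕ} :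
    g =O[nearZero I] (fun q => q.2 ^ n) ↔
      ∃ C ε, 0 ≤ C ∧ 0 < ε ∧ ∀ i r, r ≠ 0 → |r| < ε → ‖g (i, r)‖ ≤ C * |r| ^ n := by
  constructor
  · intro h
    obtain ⟨C, hC, h⟩ := h.exists_nonneg
    obtain ⟨ε, hε, h⟩ := eventually_nearZero.1 h.bound
    exact ⟨C, ε, hC, hε, fun i r h0 hr => by simpa using h i r h0 hr⟩
  · rintro ⟨C, ε, _, hε, h⟩
    refine IsBigO.of_bound C (eventually_nearZero.2 ⟨ε, hε, fun i r h0 hr => ?_⟩)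
    simpa using h i r h0 hr

theorem isBigO_pow_of_le {m n : ℕ} (h : m ≤ n) :
    (fun q : I × ℝ => q.2 ^ n) =O[nearZero I] fun q => q.2 ^ m := by
  refine isBigO_nearZero.2 ⟨1, 1, zero_le_one, one_pos, fun i r _ hr => ?_⟩
  rw [one_mul, norm_pow, Real.norm_eq_abs]
  exact pow_le_pow_of_le_one (abs_nonneg r) hr.le h

/-- A family of constants, indexed by `I`, is bounded. -/
def BoundedFamily {F : Type*} [NormedAddCommGroup F] (a : I → F) : Prop :=
  ∃ C : ℝ, ∀ i, ‖a i‖ ≤ C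

theorem BoundedFamily.isBigO {F : Type*} [NormedAddCommGroup F] {a : I → F}
    (h : BoundedFamily a) : (fun q : I × ℝ => a q.1) =O[nearZero I] (fun q => q.2 ^ 0) := by
  obtain ⟨C, h⟩ := h
  refine IsBigO.of_bound C (.of_forall fun q => ?_)
  simpa using h q.1

theorem BoundedFamily.mul {a b : I → ℝ} (ha : BoundedFamily a) (hb : BoundedFamily b) :
    BoundedFamily fun i => a i * b i := by
  obtain ⟨A, ha⟩ := ha
  obtain ⟨B, hb⟩ := hb
  refine ⟨A * B, fun i => ?_⟩
  rw [norm_mul]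
  exact mul_le_mul (ha i) (hb i) (norm_nonneg _) ((norm_nonneg _).trans (ha i))

theorem BoundedFamily.add {a b : I → ℝ} (ha : BoundedFamily a) (hb : BoundedFamily b) :
    BoundedFamily fun i => a i + b i := by
  obtain ⟨A, ha⟩ := ha
  obtain ⟨B, hb⟩ := hb
  exact ⟨A + B, fun i => (norm_add_le _ _).trans (add_le_add (ha i) (hb i))⟩

theorem BoundedFamily.neg {a : I → ℝ} (ha : BoundedFamily a) :
    BoundedFamily fun i => - a i := by
  obtain ⟨A, ha⟩ := ha
  exact ⟨A, fun i => by simpa using ha i⟩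

theorem BoundedFamily.sub {a b : I → ℝ} (ha : BoundedFamily a) (hb : BoundedFamily b) :
    BoundedFamily fun i => a i - b i := by
  simpa [sub_eq_add_neg] using ha.add hb.neg

theorem BoundedFamily.inv {a : I → ℝ} {m : ℝ} (hm : 0 < m) (ha : ∀ i, m ≤ a i) :
    BoundedFamily fun i => (a i)⁻¹ := by
  refine ⟨m⁻¹, fun i => ?_⟩
  rw [norm_inv, Real.norm_eq_abs, abs_of_pos (hm.trans_le (ha i))]
  exact inv_anti₀ hm (ha i)

theorem BoundedFamily.sqrt {a : I → ℝ} (ha : BoundedFamily a) :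
    BoundedFamily fun i => Real.sqrt (a i) := by
  obtain ⟨A, ha⟩ := ha
  refine ⟨Real.sqrt A, fun i => ?_⟩
  rw [Real.norm_eq_abs, abs_of_nonneg (Real.sqrt_nonneg _)]
  exact Real.sqrt_le_sqrt ((le_abs_self _).trans (ha i))

/-- A family of functions of one variable has a uniform expansion of order `n` at `0`. -/
def HasExpansion {F : Type*} [NormedAddCommGroup F] [NormedSpace ℝ F] (n : ℕ)
    (g : I × ℝ → F) : Prop :=
  ∃ c : ℕ → I → F, (∀ k, BoundedFamily (c k)) ∧
    (fun q : I × ℝ => g q - ∑ k ∈ Finset.range n, q.2 ^ k • c k q.1)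
      =O[nearZero I] fun q => q.2 ^ n

/-- For fixed `i` the bound reads `‖a i‖ ≤ C |r|` for all small `r`, and `r` can be sent to `0`. -/
theorem eq_zero_of_isBigO {F : Type*} [NormedAddCommGroup F] {a : I → F}
    (h : (fun q : I × ℝ => a q.1) =O[nearZero I] fun q => q.2 ^ 1) (i : I) : a i = 0 := by
  obtain ⟨C, ε, hC, hε, h⟩ := isBigO_nearZero.1 h
  rw [← norm_le_zero_iff]
  refine le_of_forall_pos_le_add fun η hη => ?_
  set r := min (ε / 2) (η / (C + 1))
  have hr : 0 < r := by positivity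
  have h1 := h i r hr.ne' (by
    rw [abs_of_pos hr]
    exact (min_le_left _ _).trans_lt (by linarith))
  rw [pow_one, abs_of_pos hr] at h1
  have h2 : r ≤ η / (C + 1) := min_le_right _ _
  rw [le_div_iff₀ (by positivity)] at h2
  simp only at h1
  nlinarith

/-- Being `O(r)` forces the constant coefficient to vanish; the others shift down by one. Each
division costs one order of the expansion. -/
theorem HasExpansion.div {n : ℕ} {g : I × ℝ → ℝ} (hg : HasExpansion (n + 1) g)
    (h0 : g =O[nearZero I] fun q => q.2 ^ 1) : HasExpansion n fun q => g q / q.2 := by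
  obtain ⟨c, hc, h⟩ := hg
  have hc0 : ∀ i, c 0 i = 0 := by
    refine eq_zero_of_isBigO ?_
    have h1 : (fun q : I × ℝ => ∑ k ∈ Finset.range n, q.2 ^ (k + 1) • c (k + 1) q.1)
        =O[nearZero I] fun q => q.2 ^ 1 := by
      refine IsBigO.fun_sum fun k _ => ?_
      have := (isBigO_pow_of_le (I := I) (m := 1) (n := k + 1) (by omega)).mul
        (hc (k + 1)).isBigO
      simpa using this
    have h2 := h.trans (isBigO_pow_of_le (I := I) (show 1 ≤ n + 1 by omega))
    refine ((h0.sub h2).sub h1).congr_left fun q => ?_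
    rw [Finset.sum_range_succ']
    simp
  refine ⟨fun k => c (k + 1), fun k => hc _, ?_⟩
  have hr : (fun q : I × ℝ => (q.2)⁻¹) =O[nearZero I] fun q => (q.2)⁻¹ := isBigO_refl _ _
  refine (h.mul hr).congr' ?_ ?_
  · refine eventually_nearZero.2 ⟨1, one_pos, fun i r hr0 _ => ?_⟩
    simp only
    rw [Finset.sum_range_succ', hc0]
    simp only [smul_eq_mul, mul_zero, add_zero, ← div_eq_mul_inv, sub_div, Finset.sum_div]
    congr 1
    refine Finset.sum_congr rfl fun k _ => ?_
    field_simp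
    ring
  · refine eventually_nearZero.2 ⟨1, one_pos, fun i r hr0 _ => ?_⟩
    simp only
    field_simp
    ring

/-- Order three is the working order: a remainder `O(r³)`, multiplied by the factor `D = O(r)` of
the kernel, becomes the required `O(r⁴)`. -/
theorem hasExpansion_three {g : I × ℝ → ℝ} : HasExpansion 3 g ↔
    ∃ a b c : I → ℝ, BoundedFamily a ∧ BoundedFamily b ∧ BoundedFamily c ∧
      (fun q : I × ℝ => g q - (a q.1 + b q.1 * q.2 + c q.1 * q.2 ^ 2))
        =O[nearZero I] fun q => q.2 ^ 3 := by
  constructor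
  · rintro ⟨c, hc, h⟩
    refine ⟨c 0, c 1, c 2, hc 0, hc 1, hc 2, h.congr_left fun q => ?_⟩
    simp only [Finset.sum_range_succ, Finset.sum_range_zero, smul_eq_mul]
    ring
  · rintro ⟨a, b, c, ha, hb, hc, h⟩
    refine ⟨fun k => if k = 0 then a else if k = 1 then b else c, fun k => ?_,
      h.congr_left fun q => ?_⟩
    · dsimp only
      split_ifs <;> assumption
    · simp only [Finset.sum_range_succ, Finset.sum_range_zero, smul_eq_mul]
      simp
      ring

/-- Terms `a r^k` with `k ≥ 3` are negligible in expansions of order three. -/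
theorem BoundedFamily.mul_pow_isBigO {a : I → ℝ} (ha : BoundedFamily a) {k : ℕ} (hk : 3 ≤ k) :
    (fun q : I × ℝ => a q.1 * q.2 ^ k) =O[nearZero I] fun q => q.2 ^ 3 := by
  simpa using ha.isBigO.mul (isBigO_pow_of_le (I := I) hk)

theorem isBigO_quadratic {a b c : I → ℝ} (ha : BoundedFamily a) (hb : BoundedFamily b)
    (hc : BoundedFamily c) :
    (fun q : I × ℝ => a q.1 + b q.1 * q.2 + c q.1 * q.2 ^ 2) =O[nearZero I]
      fun q => q.2 ^ 0 := by
  have h1 := (hb.isBigO.mul (isBigO_pow_of_le (I := I) (Nat.zero_le 1)))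
  have h2 := (hc.isBigO.mul (isBigO_pow_of_le (I := I) (Nat.zero_le 2)))
  simp only [pow_zero, mul_one, pow_one] at h1 h2
  simpa using (ha.isBigO.add (by simpa using h1)).add (by simpa using h2)

theorem HasExpansion.isBigO_one {g : I × ℝ → ℝ} (hg : HasExpansion 3 g) :
    g =O[nearZero I] fun q => q.2 ^ 0 := by
  obtain ⟨a, b, c, ha, hb, hc, h⟩ := hasExpansion_three.1 hg
  refine ((h.trans (isBigO_pow_of_le (by omega))).add (isBigO_quadratic ha hb hc)).congr_left
    fun q => by ring

theorem HasExpansion.mul {g h : I × ℝ → ℝ} (hg : HasExpansion 3 g) (hh : HasExpansion 3 h) :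
    HasExpansion 3 fun q => g q * h q := by
  obtain ⟨a, b, c, ha, hb, hc, hR⟩ := hasExpansion_three.1 hg
  obtain ⟨a', b', c', ha', hb', hc', hR'⟩ := hasExpansion_three.1 hh
  refine hasExpansion_three.2 ⟨fun i => a i * a' i, fun i => a i * b' i + b i * a' i,
    fun i => a i * c' i + b i * b' i + c i * a' i, ha.mul ha', (ha.mul hb').add (hb.mul ha'),
    ((ha.mul hc').add (hb.mul hb')).add (hc.mul ha'), ?_⟩
  have h1 := hg.isBigO_one.mul hR'
  have h2 := hR.mul (isBigO_quadratic ha' hb' hc')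
  have h3 := ((hb.mul hc').add (hc.mul hb')).mul_pow_isBigO (k := 3) le_rfl
  have h4 := (hc.mul hc').mul_pow_isBigO (k := 4) (by omega)
  simp only [pow_zero, mul_one, one_mul] at h1 h2
  refine (((h1.add h2).add h3).add h4).congr_left fun q => ?_
  ring

/-- The leading coefficient of an expansion inherits lower bounds. -/
theorem le_leading_coeff {g : I × ℝ → ℝ} {a b c : I → ℝ} {m : ℝ}
    (hb : BoundedFamily b) (hc : BoundedFamily c)
    (hR : (fun q : I × ℝ => g q - (a q.1 + b q.1 * q.2 + c q.1 * q.2 ^ 2))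
        =O[nearZero I] fun q => q.2 ^ 3)
    (hm : ∀ᶠ q in nearZero I, m ≤ g q) (i : I) : m ≤ a i := by
  have h1 : (fun q : I × ℝ => g q - a q.1) =O[nearZero I] fun q => q.2 ^ 1 := by
    have h2 := hb.isBigO.mul (isBigO_pow_of_le (I := I) (le_refl 1))
    have h3 := hc.isBigO.mul (isBigO_pow_of_le (I := I) (show 1 ≤ 2 by omega))
    simp only [pow_zero, one_mul] at h2 h3
    refine (((hR.trans (isBigO_pow_of_le (show 1 ≤ 3 by omega))).add h2).add h3).congr_left
      fun q => by ring
  obtain ⟨C, ε, hC, hε, h1⟩ := isBigO_nearZero.1 h1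
  obtain ⟨ε', hε', h2⟩ := eventually_nearZero.1 hm
  refine le_of_forall_pos_le_add fun η hη => ?_
  set r := min (min (ε / 2) (ε' / 2)) (η / (C + 1))
  have hr : 0 < r := by positivity
  have hr1 : r ≤ ε / 2 := (min_le_left _ _).trans (min_le_left _ _)
  have hr2 : r ≤ ε' / 2 := (min_le_left _ _).trans (min_le_right _ _)
  have hr3 : r ≤ η / (C + 1) := min_le_right _ _
  rw [le_div_iff₀ (by positivity)] at hr3
  have h3 := h1 i r hr.ne' (by rw [abs_of_pos hr]; linarith)
  have h4 := h2 i r hr.ne' (by rw [abs_of_pos hr]; linarith)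
  rw [pow_one, abs_of_pos hr, Real.norm_eq_abs] at h3
  have := (abs_le.1 h3).2
  nlinarith

theorem isBigO_inv_one {g : I × ℝ → ℝ} {m : ℝ} (hm : 0 < m)
    (hg : ∀ᶠ q in nearZero I, m ≤ g q) :
    (fun q => (g q)⁻¹) =O[nearZero I] fun q => q.2 ^ 0 := by
  refine IsBigO.of_bound m⁻¹ (hg.mono fun q hq => ?_)
  rw [norm_inv, Real.norm_eq_abs, abs_of_pos (hm.trans_le hq)]
  simpa using inv_anti₀ hm hq

/-- The truncated formal reciprocal `p` satisfies `g p = 1 + O(r³)`; dividing by `g`, which is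
bounded below, gives the claim. The lower bound passes to the leading coefficient, so the new
coefficients stay bounded. -/
theorem HasExpansion.inv {g : I × ℝ → ℝ} {m : ℝ} (hg : HasExpansion 3 g) (hm : 0 < m)
    (hmg : ∀ᶠ q in nearZero I, m ≤ g q) : HasExpansion 3 fun q => (g q)⁻¹ := by
  obtain ⟨a, b, c, ha, hb, hc, hR⟩ := hasExpansion_three.1 hg
  have ham := le_leading_coeff hb hc hR hmg
  have ha0 : ∀ i, a i ≠ 0 := fun i => (hm.trans_le (ham i)).ne'
  have hd : BoundedFamily fun i => (a i)⁻¹ := .inv hm ham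
  set d := fun i => (a i)⁻¹
  have had : ∀ i, a i * d i = 1 := fun i => mul_inv_cancel₀ (ha0 i)
  set d1 := fun i => -(b i * (d i * d i))
  set d2 := fun i => b i * b i * (d i * d i * d i) - c i * (d i * d i)
  have hd1 : BoundedFamily d1 := (hb.mul (hd.mul hd)).neg
  have hd2 : BoundedFamily d2 := ((hb.mul hb).mul ((hd.mul hd).mul hd)).sub (hc.mul (hd.mul hd))
  refine hasExpansion_three.2 ⟨d, d1, d2, hd, hd1, hd2, ?_⟩
  have h1 := (isBigO_inv_one hm hmg).mul (hR.mul (isBigO_quadratic hd hd1 hd2))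
  have h2 := (isBigO_inv_one hm hmg).mul
    (((hb.mul hd2).add (hc.mul hd1)).mul_pow_isBigO (k := 3) le_rfl)
  have h3 := (isBigO_inv_one hm hmg).mul ((hc.mul hd2).mul_pow_isBigO (k := 4) (by omega))
  simp only [pow_zero, mul_one, one_mul] at h1 h2 h3
  refine ((h1.add h2).add h3).neg_left.congr' (hmg.mono fun q hq => ?_) .rfl
  have hg0 : g q ≠ 0 := (hm.trans_le hq).ne'
  have key : g q * (d q.1 + d1 q.1 * q.2 + d2 q.1 * q.2 ^ 2) - 1
      = (g q - (a q.1 + b q.1 * q.2 + c q.1 * q.2 ^ 2))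
          * (d q.1 + d1 q.1 * q.2 + d2 q.1 * q.2 ^ 2)
        + (b q.1 * d2 q.1 + c q.1 * d1 q.1) * q.2 ^ 3 + c q.1 * d2 q.1 * q.2 ^ 4 := by
    have := had q.1
    simp only [d1, d2]
    linear_combination (1 - b q.1 * d q.1 * q.2
      + (b q.1 * b q.1 * (d q.1 * d q.1) - c q.1 * d q.1) * q.2 ^ 2) * this
  have : (g q)⁻¹ - (d q.1 + d1 q.1 * q.2 + d2 q.1 * q.2 ^ 2)
      = -((g q)⁻¹ * (g q * (d q.1 + d1 q.1 * q.2 + d2 q.1 * q.2 ^ 2) - 1)) := by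
    field_simp
    ring
  beta_reduce
  rw [this, key]
  ring

/-- The truncated formal square root `p` satisfies `g - p² = O(r³)`, and `√g - p = (g - p²) / (√g +
p)` with a denominator bounded below. -/
theorem HasExpansion.sqrt {g : I × ℝ → ℝ} {m : ℝ} (hg : HasExpansion 3 g) (hm : 0 < m)
    (hmg : ∀ᶠ q in nearZero I, m ≤ g q) : HasExpansion 3 fun q => Real.sqrt (g q) := by
  obtain ⟨a, b, c, ha, hb, hc, hR⟩ := hasExpansion_three.1 hg
  have ham := le_leading_coeff hb hc hR hmg
  have hsm : 0 < Real.sqrt m := Real.sqrt_pos.2 hm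
  have hsam : ∀ i, Real.sqrt m ≤ Real.sqrt (a i) := fun i => Real.sqrt_le_sqrt (ham i)
  have hs : BoundedFamily fun i => Real.sqrt (a i) := ha.sqrt
  have hd : BoundedFamily fun i => (Real.sqrt (a i))⁻¹ := .inv hsm hsam
  have hhalf : BoundedFamily fun _ : I => (1 / 2 : ℝ) := ⟨_, fun _ => le_rfl⟩
  set s := fun i => Real.sqrt (a i)
  set d := fun i => (Real.sqrt (a i))⁻¹
  have hsd : ∀ i, s i * d i = 1 := fun i => mul_inv_cancel₀ (hsm.trans_le (hsam i)).ne'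
  have hss : ∀ i, s i * s i = a i := fun i => Real.mul_self_sqrt (hm.le.trans (ham i))
  set s1 := fun i => 1 / 2 * (b i * d i)
  set s2 := fun i => 1 / 2 * ((c i - s1 i * s1 i) * d i)
  have hs1 : BoundedFamily s1 := hhalf.mul (hb.mul hd)
  have hs2 : BoundedFamily s2 := hhalf.mul ((hc.sub (hs1.mul hs1)).mul hd)
  refine hasExpansion_three.2 ⟨s, s1, s2, hs, hs1, hs2, ?_⟩
  -- Both `√g` and the leading coefficient `s` are at least `√m`, so the terms in `r` and `r²` may
  -- use up one `√m`. The radius is chosen so that they do not use more.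
  have hpos : ∀ᶠ q : I × ℝ in nearZero I,
      Real.sqrt m ≤ Real.sqrt (g q) + (s q.1 + s1 q.1 * q.2 + s2 q.1 * q.2 ^ 2) := by
    obtain ⟨A, hA⟩ := hs1
    obtain ⟨B, hB⟩ := hs2
    obtain ⟨ε, hε, hmg⟩ := eventually_nearZero.1 hmg
    refine eventually_nearZero.2 ⟨min ε (min 1 (Real.sqrt m / (|A| + |B| + 1))), by positivity,
      fun i r hr0 hr => ?_⟩
    have h6 := Real.sqrt_le_sqrt (hmg i r hr0 (hr.trans_le (min_le_left _ _)))
    replace hr := hr.trans_le (min_le_right _ _)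
    have hr1 : |r| < 1 := hr.trans_le (min_le_left _ _)
    have hr2 := hr.trans_le (min_le_right _ _)
    rw [lt_div_iff₀ (by positivity)] at hr2
    have h1 : |s1 i * r| ≤ |A| * |r| := by
      rw [abs_mul]
      exact mul_le_mul_of_nonneg_right ((hA i).trans (le_abs_self A)) (abs_nonneg _)
    have h2 : |s2 i * r ^ 2| ≤ |B| * |r| := by
      rw [abs_mul, abs_pow]
      refine mul_le_mul ((hB i).trans (le_abs_self B)) ?_ (by positivity) (abs_nonneg _)
      nlinarith [abs_nonneg r]
    have h3 := (abs_le.1 h1).1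
    have h4 := (abs_le.1 h2).1
    have h5 := hsam i
    simp only
    change Real.sqrt m ≤ s i at h5
    nlinarith [abs_nonneg r]
  have hI := isBigO_inv_one hsm hpos
  have h1 := hI.mul hR
  have h2 := hI.mul ((hs1.mul hs2).mul_pow_isBigO (k := 3) le_rfl)
  have h3 := hI.mul ((hs2.mul hs2).mul_pow_isBigO (k := 4) (by omega))
  simp only [pow_zero, one_mul] at h1 h2 h3
  refine ((h1.sub (h2.const_mul_left 2)).sub h3).congr' ((hpos.and hmg).mono fun q hq => ?_) .rfl
  obtain ⟨hq, hq'⟩ := hq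
  have hne : Real.sqrt (g q) + (s q.1 + s1 q.1 * q.2 + s2 q.1 * q.2 ^ 2) ≠ 0 :=
    (hsm.trans_le hq).ne'
  have hgq : Real.sqrt (g q) * Real.sqrt (g q) = g q := Real.mul_self_sqrt (hm.le.trans hq')
  have key : g q - (s q.1 + s1 q.1 * q.2 + s2 q.1 * q.2 ^ 2) ^ 2
      = (g q - (a q.1 + b q.1 * q.2 + c q.1 * q.2 ^ 2)) - 2 * (s1 q.1 * s2 q.1 * q.2 ^ 3)
        - s2 q.1 * s2 q.1 * q.2 ^ 4 := by
    have e1 := hsd q.1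
    have e2 := hss q.1
    have e3 : 2 * s q.1 * s1 q.1 = b q.1 := by
      simp only [s1]; linear_combination b q.1 * e1
    have e4 : 2 * s q.1 * s2 q.1 + s1 q.1 * s1 q.1 = c q.1 := by
      simp only [s2]; linear_combination (c q.1 - s1 q.1 * s1 q.1) * e1
    linear_combination -e2 - q.2 * e3 - q.2 ^ 2 * e4
  have e : Real.sqrt (g q) - (s q.1 + s1 q.1 * q.2 + s2 q.1 * q.2 ^ 2)
      = (Real.sqrt (g q) + (s q.1 + s1 q.1 * q.2 + s2 q.1 * q.2 ^ 2))⁻¹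
        * (g q - (s q.1 + s1 q.1 * q.2 + s2 q.1 * q.2 ^ 2) ^ 2) := by
    have aux : ∀ x y G : ℝ, x + y ≠ 0 → x * x = G → x - y = (x + y)⁻¹ * (G - y ^ 2) := by
      rintro x y _ h rfl
      field_simp
      ring
    exact aux _ _ _ hne hgq
  beta_reduce
  rw [e, key]
  ring

/-- An expansion in powers of `r` is an expansion in powers of `r S`, if `S` has an expansion
and is bounded below. -/
theorem HasExpansion.reexpand {Q S : I × ℝ → ℝ} {m : ℝ} (hQ : HasExpansion 3 Q)
    (hS : HasExpansion 3 S) (hm : 0 < m) (hmS : ∀ᶠ q in nearZero I, m ≤ S q) :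
    ∃ a b c : I → ℝ, BoundedFamily a ∧ BoundedFamily b ∧ BoundedFamily c ∧
      (fun q : I × ℝ => Q q - (a q.1 + b q.1 * (q.2 * S q) + c q.1 * (q.2 * S q) ^ 2))
        =O[nearZero I] fun q => q.2 ^ 3 := by
  obtain ⟨a, b, c, ha, hb, hc, hR⟩ := hasExpansion_three.1 hQ
  obtain ⟨s, s1, s2, hs, hs1, hs2, hR'⟩ := hasExpansion_three.1 hS
  have hsm := le_leading_coeff hs1 hs2 hR' hmS
  have hd : BoundedFamily fun i => (s i)⁻¹ := .inv hm hsm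
  set d := fun i => (s i)⁻¹
  have hsd : ∀ i, s i * d i = 1 := fun i => mul_inv_cancel₀ (hm.trans_le (hsm i)).ne'
  -- Coefficients found by inserting `r S = s r + s₁ r² + ⋯` and comparing powers: `b' s = b` and
  -- `c' s² + b' s₁ = c`.
  set b' := fun i => b i * d i
  set c' := fun i => (c i - b i * d i * s1 i) * (d i * d i)
  have hb' : BoundedFamily b' := hb.mul hd
  have hc' : BoundedFamily c' := (hc.sub ((hb.mul hd).mul hs1)).mul (hd.mul hd)
  refine ⟨a, b', c', ha, hb', hc', ?_⟩
  have hr1 : (fun q : I × ℝ => q.2 ^ 1) =O[nearZero I] fun q => q.2 ^ 0 :=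
    isBigO_pow_of_le (Nat.zero_le 1)
  have hr2 : (fun q : I × ℝ => q.2 ^ 2) =O[nearZero I] fun q => q.2 ^ 0 :=
    isBigO_pow_of_le (Nat.zero_le 2)
  have hone := isBigO_quadratic hs hs1 hs2
  have t1 := (hb'.isBigO.mul hr1).mul hR'
  have t2 := (hb'.mul hs2).mul_pow_isBigO (k := 3) le_rfl
  have t3 := (hc'.isBigO.mul hr2).mul (hR'.mul (hS.isBigO_one.add hone))
  have t4 := (hc'.mul (hs.mul hs1)).mul_pow_isBigO (k := 3) le_rfl
  have t5 := (hc'.mul (hs1.mul hs1)).mul_pow_isBigO (k := 4) (by omega)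
  have t6 := (hc'.mul (hs.mul hs2)).mul_pow_isBigO (k := 4) (by omega)
  have t7 := (hc'.mul (hs1.mul hs2)).mul_pow_isBigO (k := 5) (by omega)
  have t8 := (hc'.mul (hs2.mul hs2)).mul_pow_isBigO (k := 6) (by omega)
  simp only [pow_zero, mul_one, one_mul] at t1 t3
  refine ((((((((hR.sub t1).sub t2).sub t3).sub (t4.const_mul_left 2)).sub t5).sub
    (t6.const_mul_left 2)).sub (t7.const_mul_left 2)).sub t8).congr_left fun q => ?_
  have e := hsd q.1
  have e1 : b' q.1 * s q.1 = b q.1 := by simp only [b']; linear_combination b q.1 * e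
  have e2 : c' q.1 * (s q.1 * s q.1) + b' q.1 * s1 q.1 = c q.1 := by
    simp only [c', b']
    linear_combination (c q.1 - b q.1 * d q.1 * s1 q.1) * (s q.1 * d q.1 + 1) * e
  linear_combination q.2 * e1 + q.2 ^ 2 * e2

end Expansion

/-! ### Uniform Taylor expansions of smooth functions along segments. -/

/-- Taylor expansion with uniform remainder along segments contained in a compact set. -/
theorem exists_taylor_expansion {I X : Type} [NormedAddCommGroup X] [NormedSpace ℝ X]
    {U K : Set X} (hU : IsOpen U) (hK : IsCompact K) (hKU : K ⊆ U) {ε : ℝ} (hε : 0 < ε)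
    {p v : I → X} (hv : ∀ i, ‖v i‖ ≤ 1) (hpv : ∀ i r, |r| < ε → p i + r • v i ∈ K) (n : ℕ) :
    ∀ {F : Type} [NormedAddCommGroup F] [NormedSpace ℝ F] {f : X → F}, ContDiffOn ℝ n f U →
    ∃ (c : ℕ → I → F) (C : ℝ), (∀ k, BoundedFamily (c k)) ∧ ∀ i r, |r| < ε →
      ‖f (p i + r • v i) - ∑ k ∈ Finset.range n, r ^ k • c k i‖ ≤ C * |r| ^ n := by
  induction n with
  | zero =>
    intro F _ _ f hf
    obtain ⟨C, hC⟩ := hK.exists_bound_of_continuousOn (hf.continuousOn.mono hKU)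
    refine ⟨fun _ _ => 0, C, fun k => ⟨0, by simp⟩, fun i r hr => ?_⟩
    simpa using hC _ (hpv i r hr)
  | succ n ih =>
    intro F _ _ f hf
    have hf' : ContDiffOn ℝ n (fderiv ℝ f) U :=
      hf.fderiv_of_isOpen hU (by push_cast; exact le_rfl)
    obtain ⟨c, C, hc, hC⟩ := ih hf'
    obtain ⟨A, hA⟩ := hK.exists_bound_of_continuousOn (hf.continuousOn.mono hKU)
    have hp : ∀ i, p i ∈ K := fun i => by simpa using hpv i 0 (by simpa using hε)
    have hC0 : ∀ i r, |r| < ε → 0 ≤ C * |r| ^ n := fun i r hr =>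
      (norm_nonneg _).trans (hC i r hr)
    -- The coefficients of the derivative along `v i`, integrated term by term. The same constant
    -- `C` serves, because the mean value inequality contributes exactly one factor `|r|`.
    refine ⟨fun k i => match k with
      | 0 => f (p i)
      | k + 1 => ((k : ℝ) + 1)⁻¹ • c k i (v i), C, ?_, ?_⟩
    · rintro (_ | k)
      · exact ⟨A, fun i => hA _ (hp i)⟩
      · obtain ⟨B, hB⟩ := hc k
        refine ⟨B, fun i => ?_⟩
        have h1 : ‖c k i (v i)‖ ≤ B :=
          ((c k i).le_of_opNorm_le (hB i) (v i)).trans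
            (mul_le_of_le_one_right ((norm_nonneg _).trans (hB i)) (hv i))
        have h2 : ((k : ℝ) + 1)⁻¹ ≤ 1 := inv_le_one_of_one_le₀ (by linarith [k.cast_nonneg (α := ℝ)])
        simp only [norm_smul]
        rw [Real.norm_of_nonneg (by positivity)]
        exact (mul_le_of_le_one_left (norm_nonneg _) h2).trans h1
    · intro i r hr
      set h : ℝ → F := fun t => f (p i + t • v i) - (f (p i) +
        ∑ k ∈ Finset.range n, t ^ (k + 1) • (((k : ℝ) + 1)⁻¹ • c k i (v i)))
      have hd : ∀ t, |t| < ε → HasDerivAt h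
          ((fderiv ℝ f (p i + t • v i) - ∑ k ∈ Finset.range n, t ^ k • c k i) (v i)) t := by
        intro t ht
        have h1 : HasDerivAt (fun t : ℝ => p i + t • v i) (v i) t := by
          simpa using ((hasDerivAt_id t).smul_const (v i)).const_add (p i)
        have hmem : U ∈ 𝓝 (p i + t • v i) := hU.mem_nhds (hKU (hpv i t ht))
        have h2 : HasFDerivAt f (fderiv ℝ f (p i + t • v i)) (p i + t • v i) :=
          ((hf.contDiffAt hmem).differentiableAt (by simp)).hasFDerivAt
        have h3 : HasDerivAt (fun t : ℝ => ∑ k ∈ Finset.range n,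
            t ^ (k + 1) • (((k : ℝ) + 1)⁻¹ • c k i (v i)))
            (∑ k ∈ Finset.range n, t ^ k • c k i (v i)) t := by
          refine HasDerivAt.fun_sum fun k _ => ?_
          have := (hasDerivAt_pow (k + 1) t).smul_const (((k : ℝ) + 1)⁻¹ • c k i (v i))
          refine this.congr_deriv ?_
          rw [smul_smul]
          congr 1
          have : (k : ℝ) + 1 ≠ 0 := by positivity
          push_cast
          field_simp
        refine ((h2.comp_hasDerivAt t h1).sub (h3.const_add _)).congr_deriv ?_
        simp
      have hbound : ∀ t ∈ uIcc 0 r,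
          ‖(fderiv ℝ f (p i + t • v i) - ∑ k ∈ Finset.range n, t ^ k • c k i) (v i)‖
            ≤ C * |r| ^ n := by
        intro t ht
        have htr : |t| ≤ |r| := by
          have := abs_sub_left_of_mem_uIcc ht
          simpa using this
        have h1 := hC i t (htr.trans_lt hr)
        have hn := norm_nonneg (fderiv ℝ f (p i + t • v i) - ∑ k ∈ Finset.range n, t ^ k • c k i)
        refine (ContinuousLinearMap.le_opNorm _ _).trans
          ((mul_le_of_le_one_right hn (hv i)).trans (h1.trans ?_))
        -- The constant is not known to be nonnegative. If it is negative, `hC0` forces `C |t| ^ n =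
        -- 0`, so comparing the two powers needs no monotonicity.
        rcases lt_or_ge C 0 with hneg | hpos
        · have h2 := hC0 i t (htr.trans_lt hr)
          have h3 := hC0 i r hr
          have h4 : C * |t| ^ n ≤ 0 := mul_nonpos_of_nonpos_of_nonneg hneg.le (by positivity)
          linarith
        · gcongr
      have := (convex_uIcc (0 : ℝ) r).norm_image_sub_le_of_norm_hasDerivWithin_le
        (f := h) (fun t ht => (hd t (by
          have := abs_sub_left_of_mem_uIcc ht
          have : |t| ≤ |r| := by simpa using this
          exact this.trans_lt hr)).hasDerivWithinAt) hbound left_mem_uIcc right_mem_uIcc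
      have h0 : h 0 = 0 := by simp [h]
      rw [h0, sub_zero, sub_zero] at this
      rw [Finset.sum_range_succ']
      simp only [pow_zero, one_smul]
      rw [add_comm (∑ k ∈ Finset.range n, _)]
      refine this.trans_eq ?_
      rw [Real.norm_eq_abs]
      ring

theorem hasExpansion_of_contDiffOn {I X F : Type} [NormedAddCommGroup X] [NormedSpace ℝ X]
    [NormedAddCommGroup F] [NormedSpace ℝ F]
    {U K : Set X} (hU : IsOpen U) (hK : IsCompact K) (hKU : K ⊆ U) {ε : ℝ} (hε : 0 < ε)
    {p v : I → X} (hv : ∀ i, ‖v i‖ ≤ 1) (hpv : ∀ i r, |r| < ε → p i + r • v i ∈ K) {n : ℕ}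
    {f : X → F} (hf : ContDiffOn ℝ n f U) :
    HasExpansion n fun q : I × ℝ => f (p q.1 + q.2 • v q.1) := by
  obtain ⟨c, C, hc, hC⟩ := exists_taylor_expansion hU hK hKU hε hv hpv n hf
  refine ⟨c, hc, IsBigO.of_bound C (eventually_nearZero.2 ⟨ε, hε, fun i r _ hr => ?_⟩)⟩
  simpa using hC i r hr

/-! ### Polar coordinates in the plane and the fourth-order terms. -/

/-- The Euclidean plane. -/
abbrev E2 : Type := EuclideanSpace ℝ (Fin 2)

section Polar

/-- The product measure on pairs of a direction and a radius. -/
abbrev polarMeasure : Measure (Metric.sphere (0 : E2) 1 × Ioi (0 : ℝ)) :=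
  (volume : Measure E2).toSphere.prod (Measure.volumeIoiPow 1)

theorem measurePreserving_polar :
    MeasurePreserving (homeomorphUnitSphereProd E2) ((volume : Measure E2).comap (↑))
      polarMeasure := by
  have := (volume : Measure E2).measurePreserving_homeomorphUnitSphereProd
  rwa [finrank_euclideanSpace_fin] at this

theorem polar_comp (F : E2 → ℝ) (x : ({0}ᶜ : Set E2)) :
    F (((homeomorphUnitSphereProd E2 x).2 : ℝ) • ((homeomorphUnitSphereProd E2 x).1 : E2))
      = F x := by
  congr 1
  have : ‖(x : E2)‖ ≠ 0 := norm_ne_zero_iff.2 x.2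
  simp [smul_smul, this]

theorem integrable_iff_polar {F : E2 → ℝ} :
    Integrable F ↔ Integrable (fun p => F ((p.2 : ℝ) • (p.1 : E2))) polarMeasure := by
  have h : Integrable F ↔ IntegrableOn F {0}ᶜ := by
    rw [IntegrableOn, restrict_compl_singleton]
  rw [← measurePreserving_polar.integrable_comp_emb (Homeomorph.measurableEmbedding _), h,
    integrableOn_iff_comap_subtypeVal (measurableSet_singleton _).compl]
  simp only [Function.comp_def, polar_comp]

theorem integral_eq_polar (F : E2 → ℝ) :
    ∫ ξ, F ξ = ∫ p, F ((p.2 : ℝ) • (p.1 : E2)) ∂polarMeasure := by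
  rw [← measurePreserving_polar.integral_comp (Homeomorph.measurableEmbedding _)]
  simp only [polar_comp]
  rw [integral_subtype_comap (measurableSet_singleton _).compl, restrict_compl_singleton]

theorem integral_volumeIoiPow (h : ℝ → ℝ) :
    ∫ x : Ioi (0 : ℝ), h x ∂(Measure.volumeIoiPow 1) = ∫ r in Ioi (0 : ℝ), r * h r := by
  simp only [Measure.volumeIoiPow, ENNReal.ofReal]
  rw [integral_withDensity_eq_integral_smul,
    integral_subtype_comap measurableSet_Ioi fun a ↦ Real.toNNReal (a ^ 1) • h a]
  · refine setIntegral_congr_fun measurableSet_Ioi fun x hx => ?_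
    simp only [pow_one]
    rw [NNReal.smul_def, Real.coe_toNNReal _ (le_of_lt hx), smul_eq_mul]
  · exact (measurable_subtype_coe.pow_const _).real_toNNReal

theorem integrable_volumeIoiPow {h : ℝ → ℝ} :
    Integrable (fun x : Ioi (0 : ℝ) => h x) (Measure.volumeIoiPow 1) ↔
      IntegrableOn (fun r => r * h r) (Ioi 0) := by
  rw [integrableOn_iff_comap_subtypeVal measurableSet_Ioi, Measure.volumeIoiPow,
    integrable_withDensity_iff_integrable_smul']
  · refine integrable_congr (.of_forall ?_)
    rintro ⟨x, hx : 0 < x⟩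
    simp [ENNReal.toReal_ofReal hx.le]
  · fun_prop
  · simp

/-- A bound for a planar integral from bounds for the integrals along rays. -/
theorem abs_integral_le_of_polar {F : E2 → ℝ} (hF : Integrable F) {B : ℝ}
    (hB : ∀ w : E2, ‖w‖ = 1 → |∫ r in Ioi (0 : ℝ), r * F (r • w)| ≤ B) :
    |∫ ξ, F ξ| ≤ B * (volume : Measure E2).toSphere.real univ := by
  rw [integral_eq_polar, integral_prod _ (integrable_iff_polar.1 hF)]
  rw [← Real.norm_eq_abs]
  refine norm_integral_le_of_norm_le_const (.of_forall fun w => ?_)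
  have := integral_volumeIoiPow fun r => F (r • (w : E2))
  simp only at this ⊢
  rw [this]
  exact hB w (by simp)

/-- Homogeneity separates the variables: the integrand is `P` on the circle times `r · defect (r /
δ)`. With the polar weight `r` the radial factor is a rescaled second moment, which is zero. -/
theorem integrable_and_integral_errorIntegrand {δ : ℝ} (hδ : 0 < δ) {P : E2 → ℝ}
    (hP : Continuous P) (hhom : ∀ t : ℝ, 0 < t → ∀ ξ, P (t • ξ) = t ^ 4 * P ξ) :
    Integrable (errorIntegrand shapeFive δ P) ∧ ∫ ξ, errorIntegrand shapeFive δ P ξ = 0 := by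
  have hpolar : ∀ p : Metric.sphere (0 : E2) 1 × Ioi (0 : ℝ),
      errorIntegrand shapeFive δ P ((p.2 : ℝ) • (p.1 : E2))
        = P p.1 * ((4 * Real.pi)⁻¹ * ((p.2 : ℝ) * defect (p.2 / δ))) := by
    rintro ⟨⟨w, hw⟩, ⟨r, hr⟩⟩
    have hr : 0 < r := hr
    have hw : ‖w‖ = 1 := by simpa using hw
    simp only [errorIntegrand, norm_smul, hw, mul_one, Real.norm_eq_abs, abs_of_pos hr,
      hhom r hr, defect]
    field_simp
  have hPi : Integrable (fun w : Metric.sphere (0 : E2) 1 => P w)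
      (volume : Measure E2).toSphere :=
    (hP.comp continuous_subtype_val).integrable_of_hasCompactSupport
      (HasCompactSupport.of_compactSpace _)
  have hscale : ∀ r : ℝ, r * ((4 * Real.pi)⁻¹ * (r * defect (r / δ)))
      = (4 * Real.pi)⁻¹ * δ ^ 2 * ((δ⁻¹ * r) ^ 2 * defect (δ⁻¹ * r)) := by
    intro r
    rw [div_eq_inv_mul]
    field_simp
  have hR : Integrable (fun x : Ioi (0 : ℝ) => (4 * Real.pi)⁻¹ * ((x : ℝ) * defect (x / δ)))
      (Measure.volumeIoiPow 1) := by
    refine (integrable_volumeIoiPow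
      (h := fun r => (4 * Real.pi)⁻¹ * (r * defect (r / δ)))).2 ?_
    simp only [hscale]
    have := (integrableOn_Ioi_comp_mul_left_iff (fun r => r ^ 2 * defect r) 0
      (inv_pos.2 hδ)).2 (by simpa using integrableOn_pow_mul_defect 2)
    exact this.const_mul _
  constructor
  · rw [integrable_iff_polar]
    simp only [hpolar]
    exact hPi.mul_prod hR
  · rw [integral_eq_polar]
    simp only [hpolar]
    rw [integral_prod_mul (fun w : Metric.sphere (0 : E2) 1 => P w)
      (fun x : Ioi (0 : ℝ) => (4 * Real.pi)⁻¹ * ((x : ℝ) * defect (x / δ))),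
      integral_volumeIoiPow fun r => (4 * Real.pi)⁻¹ * (r * defect (r / δ))]
    simp only [hscale]
    rw [integral_const_mul, integral_comp_mul_left_Ioi (fun r => r ^ 2 * defect r) 0
      (inv_pos.2 hδ), mul_zero, integral_sq_mul_defect]
    simp

end Polar

/-! ### Hausdorff measure, parametrized surfaces and the area formula. -/

open scoped NNReal ENNReal

theorem euclideanHausdorffMeasure_image_le {X Y : Type*} [MetricSpace X] [MeasurableSpace X]
    [BorelSpace X] [MetricSpace Y] [MeasurableSpace Y] [BorelSpace Y] {f : X → Y} {s : Set X}
    {K : ℝ≥0} (hf : LipschitzOnWith K f s) (d : ℕ) :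
    Measure.euclideanHausdorffMeasure d (f '' s)
      ≤ (K : ℝ≥0∞) ^ d * Measure.euclideanHausdorffMeasure d s := by
  simp only [Measure.euclideanHausdorffMeasure_def, Measure.smul_apply, ENNReal.smul_def,
    smul_eq_mul]
  have := hf.hausdorffMeasure_image_le (d := d) (by positivity)
  rw [ENNReal.rpow_natCast] at this
  calc _ ≤ _ := mul_le_mul_right this _
    _ = _ := by ring

/-- Hausdorff measures of images under two maps that distort distances comparably. -/
theorem euclideanHausdorffMeasure_image_le_image {X Y : Type*} [MetricSpace Y]
    [MeasurableSpace Y] [BorelSpace Y] {g h : X → Y} {s : Set X} {K : ℝ≥0}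
    (hgh : ∀ x ∈ s, ∀ y ∈ s, dist (g x) (g y) ≤ K * dist (h x) (h y)) (d : ℕ) :
    Measure.euclideanHausdorffMeasure d (g '' s)
      ≤ (K : ℝ≥0∞) ^ d * Measure.euclideanHausdorffMeasure d (h '' s) := by
  rcases s.eq_empty_or_nonempty with rfl | ⟨x0, hx0⟩
  · simp
  have : Nonempty X := ⟨x0⟩
  set k := Function.invFunOn h s
  have hk : ∀ x ∈ s, k (h x) ∈ s ∧ h (k (h x)) = h x := fun x hx =>
    ⟨Function.invFunOn_mem ⟨x, hx, rfl⟩, Function.invFunOn_eq ⟨x, hx, rfl⟩⟩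
  -- With `k` a right inverse of `h`, the hypothesis says that `g ∘ k` is `K`-Lipschitz. Injectivity
  -- of `h` is not needed: points with equal `h` have equal `g`, which `himg` uses.
  have hL : LipschitzOnWith K (g ∘ k) (h '' s) := by
    refine LipschitzOnWith.of_dist_le_mul ?_
    rintro _ ⟨x, hx, rfl⟩ _ ⟨y, hy, rfl⟩
    have := hgh _ (hk x hx).1 _ (hk y hy).1
    rwa [(hk x hx).2, (hk y hy).2] at this
  have himg : (g ∘ k) '' (h '' s) = g '' s := by
    rw [← image_comp]
    refine image_congr fun x hx => ?_
    have := hgh _ (hk x hx).1 _ hx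
    rw [(hk x hx).2, dist_self, mul_zero] at this
    exact dist_le_zero.1 this
  rw [← himg]
  exact euclideanHausdorffMeasure_image_le hL d

/-- The Gram determinant of a linear map from the plane to space. -/
def gram (A : E2 →L[ℝ] E3) : ℝ :=
  ‖A (EuclideanSpace.single 0 1)‖ ^ 2 * ‖A (EuclideanSpace.single 1 1)‖ ^ 2
    - inner ℝ (A (EuclideanSpace.single 0 1)) (A (EuclideanSpace.single 1 1)) ^ 2

theorem det_eq (T : E2 →ₗ[ℝ] E2) : LinearMap.det T =
    T (EuclideanSpace.single 0 1) 0 * T (EuclideanSpace.single 1 1) 1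
      - T (EuclideanSpace.single 1 1) 0 * T (EuclideanSpace.single 0 1) 1 := by
  rw [← LinearMap.det_toMatrix (EuclideanSpace.basisFun (Fin 2) ℝ).toBasis, Matrix.det_fin_two]
  simp [LinearMap.toMatrix_apply]

/-- The range of `A` is a plane, identified isometrically with `E2` by an orthonormal basis.
Hausdorff measure ignores `ι`, so areas scale by `|det T|`, and `det T ^ 2` depends only on inner
products of columns, which `ι` preserves. -/
theorem exists_isometry_factor (A : E2 →L[ℝ] E3) (hA : Function.Injective A) :
    ∃ (ι : E2 →ₗᵢ[ℝ] E3) (T : E2 →ₗ[ℝ] E2), (∀ v, A v = ι (T v)) ∧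
      LinearMap.det T ^ 2 = gram A ∧ LinearMap.det T ≠ 0 := by
  set W := LinearMap.range (A : E2 →ₗ[ℝ] E3)
  have hW : Module.finrank ℝ W = 2 := by
    rw [LinearMap.finrank_range_of_inj hA, finrank_euclideanSpace_fin]
  set e : W ≃ₗᵢ[ℝ] E2 := ((stdOrthonormalBasis ℝ W).reindex (finCongr hW)).repr
  set T : E2 →ₗ[ℝ] E2 := e.toLinearEquiv.toLinearMap ∘ₗ (A : E2 →ₗ[ℝ] E3).rangeRestrict
  set ι : E2 →ₗᵢ[ℝ] E3 := W.subtypeₗᵢ.comp e.symm.toLinearIsometry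
  have hAT : ∀ v, A v = ι (T v) := fun v => by simp [ι, T]
  refine ⟨ι, T, hAT, ?_, ?_⟩
  · have hn : ∀ v, ‖A v‖ = ‖T v‖ := fun v => by rw [hAT, ι.norm_map]
    rw [gram, hn, hn, hAT, hAT, ι.inner_map_map, det_eq, EuclideanSpace.real_norm_sq_eq,
      EuclideanSpace.real_norm_sq_eq, PiLp.inner_apply]
    simp only [Fin.sum_univ_two]
    simp
    ring
  · intro h0
    have := LinearMap.bot_lt_ker_of_det_eq_zero h0
    have hinj : Function.Injective T := by
      intro v w hvw
      apply hA
      rw [hAT, hAT, hvw]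
    rw [LinearMap.ker_eq_bot.2 hinj] at this
    exact lt_irrefl _ this

theorem gram_pos {A : E2 →L[ℝ] E3} (hA : Function.Injective A) : 0 < gram A := by
  obtain ⟨ι, T, _, h, h0⟩ := exists_isometry_factor A hA
  rw [← h]
  positivity

theorem euclideanHausdorffMeasure_linear_image {A : E2 →L[ℝ] E3} (hA : Function.Injective A)
    (s : Set E2) : Measure.euclideanHausdorffMeasure 2 (A '' s)
      = ENNReal.ofReal (Real.sqrt (gram A)) * volume s := by
  obtain ⟨ι, T, hT, h, h0⟩ := exists_isometry_factor A hA
  have himg : A '' s = ι '' (T '' s) := by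
    rw [← image_comp]
    exact image_congr fun v _ => hT v
  rw [himg, ι.isometry.euclideanHausdorffMeasure_image,
    EuclideanSpace.euclideanHausdorffMeasure_eq_volume, Measure.addHaar_image_linearMap, ← h,
    Real.sqrt_sq_eq_abs]

/-- The difference quotients of `t ↦ G (x + t • v)` have norm at least `‖v‖`, and this survives the
limit. -/
theorem norm_le_fderiv_of_expanding {G : E2 → E3} {A : E2 →L[ℝ] E3} {U : Set E2} {x : E2}
    (hU : U ∈ 𝓝 x) (hexp : ∀ ξ ∈ U, ∀ η ∈ U, ‖ξ - η‖ ≤ ‖G ξ - G η‖) (hG : HasFDerivAt G A x)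
    (v : E2) : ‖v‖ ≤ ‖A v‖ := by
  have hline : HasDerivAt (fun t : ℝ => x + t • v) v 0 := by
    simpa using ((hasDerivAt_id (0 : ℝ)).smul_const v).const_add x
  have hd : HasDerivAt (fun t : ℝ => G (x + t • v)) (A v) 0 :=
    HasFDerivAt.comp_hasDerivAt (0 : ℝ) (by simpa using hG) hline
  have hin : ∀ᶠ t : ℝ in 𝓝[≠] 0, x + t • v ∈ U := by
    refine nhdsWithin_le_nhds (hline.continuousAt.eventually ?_)
    simpa using hU
  have hs := (hasDerivAt_iff_tendsto_slope.1 hd).norm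
  refine ge_of_tendsto hs ?_
  filter_upwards [hin, self_mem_nhdsWithin] with t ht ht0
  have ht0 : t ≠ 0 := ht0
  have := hexp _ ht _ (mem_of_mem_nhds hU)
  simp only [add_sub_cancel_left, norm_smul, slope, sub_zero, vsub_eq_sub, zero_smul, add_zero,
    norm_inv] at this ⊢
  rw [inv_mul_eq_div, le_div_iff₀ (norm_pos_iff.2 ht0), mul_comm]
  exact this

/-- A graph-like parametrization of a piece of a surface over an open set `U` of the plane. -/
structure IsParametrization (U : Set E2) (G : E2 → E3) (π : E3 → E2) (L : ℝ≥0) : Prop where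
  isOpen : IsOpen U
  contDiffOn : ContDiffOn ℝ 8 G U
  lipschitz : LipschitzOnWith L G U
  expanding : ∀ ξ ∈ U, ∀ η ∈ U, ‖ξ - η‖ ≤ ‖G ξ - G η‖
  measurable : Measurable π
  leftInv : ∀ ξ ∈ U, π (G ξ) = ξ

namespace IsParametrization

variable {U : Set E2} {G : E2 → E3} {π : E3 → E2} {L : ℝ≥0}

theorem hasStrictFDerivAt (h : IsParametrization U G π L) {x : E2} (hx : x ∈ U) :
    HasStrictFDerivAt G (fderiv ℝ G x) x :=
  (h.contDiffOn.contDiffAt (h.isOpen.mem_nhds hx)).hasStrictFDerivAt (by simp)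

theorem norm_le_fderiv (h : IsParametrization U G π L) {x : E2} (hx : x ∈ U) (v : E2) :
    ‖v‖ ≤ ‖fderiv ℝ G x v‖ :=
  norm_le_fderiv_of_expanding (h.isOpen.mem_nhds hx) h.expanding
    (h.hasStrictFDerivAt hx).hasFDerivAt v

theorem fderiv_injective (h : IsParametrization U G π L) {x : E2} (hx : x ∈ U) :
    Function.Injective (fderiv ℝ G x) :=
  (injective_iff_map_eq_zero _).2 fun v hv => by
    have := h.norm_le_fderiv hx v
    rw [hv, norm_zero] at this
    exact norm_le_zero_iff.1 this

theorem injOn (h : IsParametrization U G π L) : InjOn G U := fun ξ hξ η hη he => by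
  rw [← h.leftInv ξ hξ, he, h.leftInv η hη]

theorem measurableSet_image (h : IsParametrization U G π L) {s : Set E2} (hs : MeasurableSet s)
    (hsU : s ⊆ U) : MeasurableSet (G '' s) :=
  hs.image_of_continuousOn_injOn (h.lipschitz.continuousOn.mono hsU) (h.injOn.mono hsU)

/-- The surface measure, pulled back to the parameter domain. -/
def pullback (U : Set E2) (G : E2 → E3) (π : E3 → E2) : Measure E2 :=
  ((Measure.euclideanHausdorffMeasure 2).restrict (G '' U)).map π

theorem pullback_apply (h : IsParametrization U G π L) {s : Set E2} (hs : MeasurableSet s) :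
    pullback U G π s = Measure.euclideanHausdorffMeasure 2 (G '' (s ∩ U)) := by
  rw [pullback, Measure.map_apply h.measurable hs, Measure.restrict_apply (h.measurable hs)]
  congr 1
  ext x
  constructor
  · rintro ⟨hx, ξ, hξ, rfl⟩
    exact ⟨ξ, ⟨by simpa [h.leftInv ξ hξ] using hx, hξ⟩, rfl⟩
  · rintro ⟨ξ, ⟨hs, hξ⟩, rfl⟩
    exact ⟨by simpa [h.leftInv ξ hξ] using hs, ξ, hξ, rfl⟩

/-- Supplies the local finiteness and absolute continuity on which the differentiation of measures
in `pullback_eq` depends. -/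
theorem pullback_le (h : IsParametrization U G π L) :
    pullback U G π ≤ ((L : ℝ≥0∞) ^ 2) • volume := by
  refine Measure.le_iff.2 fun s hs => ?_
  rw [h.pullback_apply hs]
  refine (euclideanHausdorffMeasure_image_le (h.lipschitz.mono inter_subset_right) 2).trans ?_
  rw [EuclideanSpace.euclideanHausdorffMeasure_eq_volume, Measure.smul_apply, smul_eq_mul]
  gcongr
  exact inter_subset_left

instance isLocallyFinite_smul_volume (c : ℝ≥0) :
    IsLocallyFiniteMeasure ((c : ℝ≥0∞) • (volume : Measure E2)) :=
  inferInstanceAs (IsLocallyFiniteMeasure (c • (volume : Measure E2)))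

theorem isLocallyFiniteMeasure_pullback (h : IsParametrization U G π L) :
    IsLocallyFiniteMeasure (pullback U G π) := by
  have hle := h.pullback_le
  have : IsLocallyFiniteMeasure (((L : ℝ≥0∞) ^ 2) • (volume : Measure E2)) := by
    have := isLocallyFinite_smul_volume (L ^ 2)
    simpa using this
  exact Measure.isLocallyFiniteMeasure_of_le hle

/-- By strict differentiability `G ξ - G η` and `A (ξ - η)` differ by at most `c ‖ξ - η‖` on a small
ball. Each of them dominates `‖ξ - η‖` in norm, so this additive error is a factor `1 + c` either
way, and areas are comparable up to `(1 + c)²`. -/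
theorem eventually_compare (h : IsParametrization U G π L) {x : E2} (hx : x ∈ U) {c : ℝ≥0}
    (hc : 0 < c) : ∀ᶠ r in 𝓝[>] (0 : ℝ),
      pullback U G π (Metric.closedBall x r) ≤ ((1 + c : ℝ≥0) : ℝ≥0∞) ^ 2 *
        (ENNReal.ofReal (Real.sqrt (gram (fderiv ℝ G x))) * volume (Metric.closedBall x r)) ∧
      ENNReal.ofReal (Real.sqrt (gram (fderiv ℝ G x))) * volume (Metric.closedBall x r) ≤
        ((1 + c : ℝ≥0) : ℝ≥0∞) ^ 2 * pullback U G π (Metric.closedBall x r) := by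
  set A := fderiv ℝ G x
  have hstrict := (h.hasStrictFDerivAt hx).isLittleO.def (c := c) (by exact_mod_cast hc)
  obtain ⟨V, W, hVo, hxV, hWo, hxW, hsub⟩ := mem_nhds_prod_iff'.1 hstrict
  have hnhds : V ∩ W ∩ U ∈ 𝓝 x :=
    ((hVo.inter hWo).inter h.isOpen).mem_nhds ⟨⟨hxV, hxW⟩, hx⟩
  obtain ⟨r0, hr0, hr⟩ := Metric.nhds_basis_closedBall.mem_iff.1 hnhds
  filter_upwards [Ioc_mem_nhdsGT hr0] with r hr'
  have hB : Metric.closedBall x r ⊆ V ∩ W ∩ U := (Metric.closedBall_subset_closedBall hr'.2).trans hr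
  have key : ∀ ξ ∈ Metric.closedBall x r, ∀ η ∈ Metric.closedBall x r,
      ‖G ξ - G η - A (ξ - η)‖ ≤ c * ‖ξ - η‖ := by
    intro ξ hξ η hη
    have h1 : (ξ, η) ∈ V ×ˢ W := mk_mem_prod (hB hξ).1.1 (hB hη).1.2
    have h2 := hsub h1
    rw [mem_ofPred_eq] at h2
    exact h2
  have hinter : Metric.closedBall x r ∩ U = Metric.closedBall x r :=
    inter_eq_left.2 fun ξ hξ => (hB hξ).2
  rw [h.pullback_apply Metric.isClosed_closedBall.measurableSet, hinter,
    ← euclideanHausdorffMeasure_linear_image (h.fderiv_injective hx)]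
  constructor
  · refine euclideanHausdorffMeasure_image_le_image (fun ξ hξ η hη => ?_) 2
    have h1 := key ξ hξ η hη
    have h2 := h.norm_le_fderiv hx (ξ - η)
    have h3 := norm_sub_norm_le (G ξ - G η) (A (ξ - η))
    have h4 := mul_le_mul_of_nonneg_left h2 c.coe_nonneg
    rw [dist_eq_norm, dist_eq_norm, ← map_sub, NNReal.coe_add, NNReal.coe_one]
    linarith
  · refine euclideanHausdorffMeasure_image_le_image (fun ξ hξ η hη => ?_) 2
    have h1 := key ξ hξ η hη
    have h2 := h.expanding ξ (hB hξ).2 η (hB hη).2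
    have h3 := norm_sub_norm_le (A (ξ - η)) (G ξ - G η)
    rw [norm_sub_rev (A (ξ - η))] at h3
    have h4 := mul_le_mul_of_nonneg_left h2 c.coe_nonneg
    rw [dist_eq_norm, dist_eq_norm, ← map_sub, NNReal.coe_add, NNReal.coe_one]
    linarith

/-- The area formula. -/
theorem pullback_eq (h : IsParametrization U G π L) : pullback U G π =
    (volume.restrict U).withDensity
      fun ξ => ENNReal.ofReal (Real.sqrt (gram (fderiv ℝ G ξ))) := by
  have := h.isLocallyFiniteMeasure_pullback
  have hac : pullback U G π ≪ volume :=
    (Measure.absolutelyContinuous_of_le h.pullback_le).trans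
      (Measure.smul_absolutelyContinuous)
  have hU0 : pullback U G π Uᶜ = 0 := by
    rw [h.pullback_apply h.isOpen.measurableSet.compl]
    simp
  have hderiv : ∀ᵐ x ∂(volume.restrict U), (pullback U G π).rnDeriv volume x
      = ENNReal.ofReal (Real.sqrt (gram (fderiv ℝ G x))) := by
    rw [ae_restrict_iff' h.isOpen.measurableSet]
    -- The density is almost everywhere the limit of ratios of measures of balls.
    -- `eventually_compare` traps this limit between multiples of the Jacobian, and then `c → 0`.
    filter_upwards [Besicovitch.ae_tendsto_rnDeriv (pullback U G π) volume] with x hx hxU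
    set J := ENNReal.ofReal (Real.sqrt (gram (fderiv ℝ G x)))
    set l := (pullback U G π).rnDeriv volume x
    have hpos : ∀ᶠ r in 𝓝[>] (0 : ℝ), volume (Metric.closedBall x r) ≠ 0 ∧
        volume (Metric.closedBall x r) ≠ ⊤ := by
      filter_upwards [self_mem_nhdsWithin] with r hr
      exact ⟨(Metric.measure_closedBall_pos _ _ hr).ne', measure_closedBall_lt_top.ne⟩
    have hcont : ∀ a : ℝ≥0∞, a ≠ ⊤ → Tendsto (fun c : ℝ≥0 => ((1 + c : ℝ≥0) : ℝ≥0∞) ^ 2 * a)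
        (𝓝[>] 0) (𝓝 a) := by
      intro a ha
      have h1 : Tendsto (fun c : ℝ≥0 => (1 + c) ^ 2) (𝓝[>] 0) (𝓝 1) := by
        have : Continuous fun c : ℝ≥0 => (1 + c) ^ 2 := by fun_prop
        simpa using (this.tendsto 0).mono_left nhdsWithin_le_nhds
      have h2 := ENNReal.Tendsto.mul_const (b := a) (ENNReal.tendsto_coe.2 h1) (Or.inr ha)
      simpa using h2
    have hle : ∀ c : ℝ≥0, 0 < c → l ≤ ((1 + c : ℝ≥0) : ℝ≥0∞) ^ 2 * J := by
      intro c hc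
      refine le_of_tendsto hx ?_
      filter_upwards [h.eventually_compare hxU hc, hpos] with r hr hv
      rw [ENNReal.div_le_iff hv.1 hv.2, mul_assoc]
      exact hr.1
    have hge : ∀ c : ℝ≥0, 0 < c → J ≤ ((1 + c : ℝ≥0) : ℝ≥0∞) ^ 2 * l := by
      intro c hc
      refine ge_of_tendsto (ENNReal.Tendsto.const_mul hx (Or.inr (by finiteness))) ?_
      filter_upwards [h.eventually_compare hxU hc, hpos] with r hr hv
      rw [← mul_div_assoc, ENNReal.le_div_iff_mul_le (Or.inl hv.1) (Or.inl hv.2)]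
      exact hr.2
    have hJ : J ≠ ⊤ := ENNReal.ofReal_ne_top
    have hlJ : l ≤ J := ge_of_tendsto (hcont J hJ)
      (by filter_upwards [self_mem_nhdsWithin] with c hc using hle c hc)
    refine le_antisymm hlJ (ge_of_tendsto (hcont l (ne_top_of_le_ne_top hJ hlJ))
      (by filter_upwards [self_mem_nhdsWithin] with c hc using hge c hc))
  have hrestrict : pullback U G π = (pullback U G π).restrict U := by
    refine (Measure.restrict_eq_self_of_ae_mem ?_).symm
    exact measure_eq_zero_iff_ae_notMem.1 hU0 |>.mono fun x hx => not_not.1 hx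
  rw [← withDensity_congr_ae hderiv, ← restrict_withDensity h.isOpen.measurableSet,
    Measure.withDensity_rnDeriv_eq _ _ hac, ← hrestrict]

end IsParametrization

/-! ### The boundary as a zero set and as a graph over its tangent plane. -/

namespace IsDefiningFunctionOn

variable {Ω U : Set E3} {ρ : E3 → ℝ}

theorem mem_iff (h : IsDefiningFunctionOn Ω U ρ) {x : E3} (hx : x ∈ U) : x ∈ Ω ↔ ρ x < 0 := by
  have := Set.ext_iff.1 h.inter_eq x
  simp only [Set.mem_inter_iff, Set.mem_ofPred_eq] at this
  tauto

theorem contDiffAt (h : IsDefiningFunctionOn Ω U ρ) {x : E3} (hx : x ∈ U) :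
    ContDiffAt ℝ ∞ ρ x :=
  h.smooth.contDiffAt (h.isOpen.mem_nhds hx)

theorem differentiableAt (h : IsDefiningFunctionOn Ω U ρ) {x : E3} (hx : x ∈ U) :
    DifferentiableAt ℝ ρ x :=
  (h.contDiffAt hx).differentiableAt (by simp)

/-- Inside `U` the boundary of `Ω` is the zero set of a defining function. -/
theorem mem_frontier_iff (h : IsDefiningFunctionOn Ω U ρ) {x : E3} (hx : x ∈ U) :
    x ∈ frontier Ω ↔ ρ x = 0 := by
  have hUn : U ∈ 𝓝 x := h.isOpen.mem_nhds hx
  have hcont : ContinuousAt ρ x := (h.differentiableAt hx).continuousAt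
  constructor
  · intro hy
    rcases lt_trichotomy (ρ x) 0 with hlt | heq | hgt
    · exfalso
      refine hy.2 (mem_interior_iff_mem_nhds.2 ?_)
      filter_upwards [hcont.eventually (gt_mem_nhds hlt), hUn] with z hz hzU
      exact (h.mem_iff hzU).2 hz
    · exact heq
    · exfalso
      have hev : ∀ᶠ z in 𝓝 x, z ∉ Ω := by
        filter_upwards [hcont.eventually (lt_mem_nhds hgt), hUn] with z hz hzU hzΩ
        exact absurd ((h.mem_iff hzU).1 hzΩ) (not_lt.2 (le_of_lt hz))
      exact (mem_closure_iff_frequently.1 hy.1) hev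
  · intro h0
    refine ⟨?_, fun hint => ?_⟩
    · rw [mem_closure_iff_frequently]
      intro hev
      -- A zero of `ρ` outside the closure of `Ω` would be a local minimum, hence a critical point.
      have hmin : IsLocalMin ρ x := by
        filter_upwards [hev, hUn] with z hz hzU
        rw [h0]
        exact not_lt.1 fun hlt => hz ((h.mem_iff hzU).2 hlt)
      refine h.gradient_ne_zero x hx ?_
      rw [gradient, hmin.fderiv_eq_zero, map_zero]
    · have := (h.mem_iff hx).1 (interior_subset hint)
      linarith

theorem outwardNormal_eq (h : IsDefiningFunctionOn Ω U ρ) (hΩ : HasSmoothBoundary Ω) {x : E3}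
    (hx : x ∈ U) (hxf : x ∈ frontier Ω) :
    outwardNormal Ω x = ‖gradient ρ x‖⁻¹ • gradient ρ x :=
  (outwardNormal_spec hΩ hxf).unique hxf ⟨U, ρ, hx, h, rfl⟩

theorem contDiffOn_unitGradient (h : IsDefiningFunctionOn Ω U ρ) (n : ℕ) :
    ContDiffOn ℝ n (fun x => ‖gradient ρ x‖⁻¹ • gradient ρ x) U := by
  have hg : ContDiffOn ℝ n (gradient ρ) U := by
    have h1 : ContDiffOn ℝ n (fderiv ℝ ρ) U :=
      (h.smooth.of_le (m := (n + 1 : ℕ)) (by exact_mod_cast le_top)).fderiv_of_isOpen h.isOpen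
        (by push_cast; exact le_rfl)
    exact (InnerProductSpace.toDual ℝ E3).symm.contDiff.comp_contDiffOn h1
  exact ((hg.norm ℝ h.gradient_ne_zero).inv
    fun x hx => (norm_pos_iff.2 (h.gradient_ne_zero x hx)).ne').smul hg

/-- Near a boundary point the boundary is parametrized by the tangent plane. -/
theorem exists_parametrization (h : IsDefiningFunctionOn Ω U ρ) {y : E3} (hy : y ∈ frontier Ω)
    (hyU : y ∈ U) : ∃ (ε : ℝ) (G : E2 → E3) (π : E3 → E2) (L : ℝ≥0), 0 < ε ∧
      IsParametrization (Metric.ball 0 ε) G π L ∧ G 0 = y ∧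
      (∀ ξ ∈ Metric.ball (0 : E2) ε, G ξ ∈ frontier Ω ∧ G ξ ∈ U) ∧
      ∀ᶠ x in 𝓝 y, x ∈ frontier Ω → π x ∈ Metric.ball (0 : E2) ε ∧ G (π x) = x := by
  have hgrad := h.gradient_ne_zero y hyU
  set n0 := ‖gradient ρ y‖⁻¹ • gradient ρ y
  have hn0 : ‖n0‖ = 1 := by simp [n0, norm_smul, hgrad]
  -- An orthonormal frame whose third vector is the unit normal at `y`; the first two span the
  -- tangent plane, and `Φ` gives the corresponding coordinates centred at `y`.
  obtain ⟨b, hb⟩ := Orthonormal.exists_orthonormalBasis_extension_of_card_eq (𝕜 := ℝ) (E := E3)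
    (ι := Fin 3) (by simp) (v := fun _ => n0) (s := {2}) (by
      rw [orthonormal_iff_ite]
      rintro ⟨i, hi⟩ ⟨j, hj⟩
      obtain rfl : i = 2 := hi
      obtain rfl : j = 2 := hj
      simp [hn0])
  have hb2 : b 2 = n0 := hb 2 rfl
  set Φ' : E2 × ℝ →L[ℝ] E3 :=
    ((EuclideanSpace.proj 0 : E2 →L[ℝ] ℝ).comp (.fst ℝ E2 ℝ)).smulRight (b 0)
      + ((EuclideanSpace.proj 1 : E2 →L[ℝ] ℝ).comp (.fst ℝ E2 ℝ)).smulRight (b 1)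
      + (ContinuousLinearMap.snd ℝ E2 ℝ).smulRight (b 2)
  set Φ : E2 × ℝ → E3 := fun q => y + Φ' q
  have hΦ' : ∀ q : E2 × ℝ, Φ' q = q.1 0 • b 0 + q.1 1 • b 1 + q.2 • b 2 := fun q => rfl
  set π : E3 → E2 := fun x => !₂[inner ℝ (b 0) (x - y), inner ℝ (b 1) (x - y)]
  have hinner : ∀ i j, inner ℝ (b i) (b j) = if i = j then (1 : ℝ) else 0 :=
    orthonormal_iff_ite.1 b.orthonormal
  have hπΦ : ∀ q, π (Φ q) = q.1 := by
    intro q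
    ext i
    fin_cases i <;>
      simp [π, Φ, hΦ', inner_add_right, inner_smul_right, hinner]
  have hΦπ : ∀ x, Φ (π x, inner ℝ (b 2) (x - y)) = x := by
    intro x
    have := b.sum_repr' (x - y)
    rw [Fin.sum_univ_three] at this
    simp only [Φ, hΦ', π]
    simp only [Matrix.cons_val_zero, Matrix.cons_val_one]
    rw [this]
    abel
  have hπcont : Continuous π := by
    refine (PiLp.continuous_toLp 2 _).comp (continuous_pi fun i => ?_)
    fin_cases i
    · exact continuous_const.inner (continuous_id.sub continuous_const)
    · exact continuous_const.inner (continuous_id.sub continuous_const)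
  -- Orthogonal projection does not increase distances. Since `G` is a section of `π`, this makes
  -- `G` expanding.
  have hπle : ∀ x z, ‖π x - π z‖ ≤ ‖x - z‖ := by
    intro x z
    rw [← sq_le_sq₀ (norm_nonneg _) (norm_nonneg _), ← b.sum_sq_norm_inner_right (x - z),
      EuclideanSpace.real_norm_sq_eq, Fin.sum_univ_two, Fin.sum_univ_three]
    simp only [π, PiLp.sub_apply, Matrix.cons_val_zero, Matrix.cons_val_one,
      ← inner_sub_right, sub_sub_sub_cancel_right, Real.norm_eq_abs, sq_abs]
    nlinarith [sq_nonneg (inner ℝ (b 2) (x - z))]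
  have hΦ0 : Φ 0 = y := by simp [Φ]
  set F : E2 × ℝ → ℝ := fun q => ρ (Φ q)
  have hΦsmooth : ContDiff ℝ 8 Φ := contDiff_const.add Φ'.contDiff
  have hFc : ContDiffAt ℝ 8 F 0 := by
    refine ContDiffAt.comp (0 : E2 × ℝ) ?_ hΦsmooth.contDiffAt
    rw [hΦ0]
    exact contDiffAt_infty.1 (h.contDiffAt hyU) 8
  have hFd : HasFDerivAt F ((InnerProductSpace.toDual ℝ E3 (gradient ρ y)).comp Φ') 0 := by
    have h1 : HasFDerivAt ρ (InnerProductSpace.toDual ℝ E3 (gradient ρ y)) (Φ 0) := by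
      rw [hΦ0]
      exact (h.differentiableAt hyU).hasGradientAt.hasFDerivAt
    exact h1.comp (0 : E2 × ℝ) (Φ'.hasFDerivAt.const_add y)
  -- The partial derivative in the normal direction is multiplication by `‖gradient ρ y‖ ≠ 0`.
  have hinv : (fderiv ℝ F 0 ∘L .inr ℝ E2 ℝ).IsInvertible := by
    have hc : ‖gradient ρ y‖ ≠ 0 := norm_ne_zero_iff.2 hgrad
    refine ⟨ContinuousLinearEquiv.unitsEquivAut ℝ (Units.mk0 _ hc), ?_⟩
    ext
    rw [hFd.fderiv]
    simp [hΦ', hb2, n0]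
    field_simp
    rw [← real_inner_self_eq_norm_sq]
    exact InnerProductSpace.toDual_symm_apply
  set u : E2 → ℝ := hFc.implicitFunction (by norm_num) hinv
  have hu0 : u 0 = 0 := hFc.implicitFunction_apply_self (by norm_num) hinv
  have huc : ContDiffAt ℝ 8 u 0 := hFc.contDiffAt_implicitFunction (by norm_num) hinv
  set G : E2 → E3 := fun ξ => Φ (ξ, u ξ)
  have hG0 : G 0 = y := by
    simp only [G, hu0]
    exact hΦ0
  have hGc : ContDiffAt ℝ 8 G 0 :=
    hΦsmooth.contDiffAt.comp (0 : E2) (contDiffAt_id.prodMk huc)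
  obtain ⟨L, t, ht, hL⟩ := (hGc.of_le (by norm_num)).exists_lipschitzOnWith
  have hzero : ρ y = 0 := (h.mem_frontier_iff hyU).1 hy
  have hev1 : ∀ᶠ ξ in 𝓝 (0 : E2), ρ (G ξ) = 0 := by
    have := hFc.eventually_apply_implicitFunction (by norm_num) hinv
    filter_upwards [this] with ξ hξ
    rw [show ρ (G ξ) = F 0 from hξ]
    simp only [F, hΦ0, hzero]
  have hev2 : ∀ᶠ ξ in 𝓝 (0 : E2), G ξ ∈ U :=
    hGc.continuousAt.eventually (by rw [hG0]; exact h.isOpen.mem_nhds hyU)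
  have hev3 : ∀ᶠ ξ in 𝓝 (0 : E2), ContDiffAt ℝ 8 G ξ := hGc.eventually (by simp)
  obtain ⟨ε, hε, hball⟩ := Metric.eventually_nhds_iff_ball.1
    ((hev1.and hev2).and (hev3.and (eventually_of_mem ht fun ξ hξ => hξ)))
  have hleft : ∀ ξ, π (G ξ) = ξ := fun ξ => hπΦ _
  refine ⟨ε, G, π, L, hε, ⟨Metric.isOpen_ball, fun ξ hξ => (hball ξ hξ).2.1.contDiffWithinAt,
    hL.mono fun ξ hξ => (hball ξ hξ).2.2, fun ξ _ η _ => ?_, hπcont.measurable,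
    fun ξ _ => hleft ξ⟩, hG0, fun ξ hξ => ?_, ?_⟩
  · have := hπle (G ξ) (G η)
    rwa [hleft, hleft] at this
  · have h1 := (hball ξ hξ).1
    exact ⟨(h.mem_frontier_iff h1.2).2 h1.1, h1.2⟩
  · have hπy : π y = 0 := by
      have := hleft 0
      rwa [hG0] at this
    have hev4 : ∀ᶠ x in 𝓝 y, π x ∈ Metric.ball (0 : E2) ε :=
      hπcont.continuousAt.eventually (by rw [hπy]; exact Metric.ball_mem_nhds _ hε)
    have hψ : ContinuousAt (fun x => (π x, inner ℝ (b 2) (x - y))) y :=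
      (hπcont.prodMk (continuous_const.inner (continuous_id.sub continuous_const))).continuousAt
    have hψy : (π y, inner ℝ (b 2) (y - y)) = (0 : E2 × ℝ) := by
      simp [hπy]
    -- Local uniqueness in the implicit function theorem: every boundary point near `y` lies on the
    -- graph.
    have hev5 : ∀ᶠ v in 𝓝 (π y, inner ℝ (b 2) (y - y)), F v = F 0 ↔ u v.1 = v.2 :=
      hψy.symm ▸ hFc.eventually_apply_eq_iff_implicitFunction (by norm_num) hinv
    filter_upwards [hev4, hψ.eventually hev5, h.isOpen.mem_nhds hyU] with x hx1 hx2 hxU hxf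
    refine ⟨hx1, ?_⟩
    have h1 : u (π x) = inner ℝ (b 2) (x - y) := by
      refine hx2.1 ?_
      simp only [F, hΦπ, hΦ0, hzero]
      exact (h.mem_frontier_iff hxU).1 hxf
    simp only [G, h1, hΦπ]

end IsDefiningFunctionOn

/-! ### Second-order estimates and the cubic bound for the numerator. -/

section SecondOrder

variable {X F : Type*} [NormedAddCommGroup X] [NormedSpace ℝ X] [NormedAddCommGroup F]
  [NormedSpace ℝ F]

theorem exists_norm_fderiv_le {U K : Set X} (hU : IsOpen U) (hK : IsCompact K) (hKU : K ⊆ U)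
    {f : X → F} (hf : ContDiffOn ℝ 1 f U) : ∃ C, 0 ≤ C ∧ ∀ x ∈ K, ‖fderiv ℝ f x‖ ≤ C := by
  obtain ⟨C, hC⟩ := hK.exists_bound_of_continuousOn
    ((hf.continuousOn_fderiv_of_isOpen hU le_rfl).mono hKU)
  exact ⟨|C|, abs_nonneg C, fun x hx => (hC x hx).trans (le_abs_self C)⟩

/-- The derivative varies by at most `C ‖y - x‖` on the segment. The linearization is taken at the
endpoint `y`, which is where the orthogonality of normal and tangent vectors will be applied. -/
theorem exists_second_order_bound {U K : Set X} (hU : IsOpen U) (hK : IsCompact K)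
    (hconv : Convex ℝ K) (hKU : K ⊆ U) {f : X → F} (hf : ContDiffOn ℝ 2 f U) :
    ∃ C, 0 ≤ C ∧ ∀ x ∈ K, ∀ y ∈ K,
      ‖f y - f x - fderiv ℝ f y (y - x)‖ ≤ C * ‖y - x‖ ^ 2 := by
  have hf' : ContDiffOn ℝ 1 (fderiv ℝ f) U := hf.fderiv_of_isOpen hU (by norm_num)
  obtain ⟨C, hC0, hC⟩ := exists_norm_fderiv_le hU hK hKU hf'
  refine ⟨C, hC0, fun x hx y hy => ?_⟩
  have hseg : segment ℝ x y ⊆ K := hconv.segment_subset hx hy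
  have hlip : ∀ z ∈ segment ℝ x y, ‖fderiv ℝ f z - fderiv ℝ f y‖ ≤ C * ‖y - x‖ := by
    intro z hz
    have h1 := hconv.norm_image_sub_le_of_norm_hasFDerivWithin_le (f := fderiv ℝ f)
      (fun w hw => (((hf'.contDiffAt (hU.mem_nhds (hKU hw))).differentiableAt
        (by simp)).hasFDerivAt.hasFDerivWithinAt)) hC hy (hseg hz)
    refine h1.trans (mul_le_mul_of_nonneg_left ?_ hC0)
    obtain ⟨s, t, hs, ht, hst, rfl⟩ := hz
    have : s • x + t • y - y = s • (x - y) := by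
      have : t = 1 - s := by linarith
      rw [this]
      module
    rw [this, norm_smul, Real.norm_of_nonneg hs, norm_sub_rev x y]
    exact mul_le_of_le_one_left (norm_nonneg _) (by linarith)
  have h2 := (convex_segment x y).norm_image_sub_le_of_norm_hasFDerivWithin_le' (f := f)
      (fun w hw => (((hf.contDiffAt (hU.mem_nhds (hKU (hseg hw)))).differentiableAt
        (by simp)).hasFDerivAt.hasFDerivWithinAt)) hlip (left_mem_segment ℝ x y)
      (right_mem_segment ℝ x y)
  refine h2.trans_eq ?_
  ring

end SecondOrder

/-- A parametrization of a piece of a surface, together with the unit normal `ν` and a density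
`g`, both expressed in the parameter. -/
structure IsSurfacePatch (R : ℝ) (G ν : E2 → E3) (π : E3 → E2) (L : ℝ≥0) (g : E2 → ℝ) : Prop
    extends IsParametrization (Metric.ball 0 R) G π L where
  radius_pos : 0 < R
  normal : ContDiffOn ℝ 7 ν (Metric.ball 0 R)
  density : ContDiffOn ℝ 7 g (Metric.ball 0 R)
  orthogonal : ∀ ξ ∈ Metric.ball (0 : E2) R, ∀ v, inner ℝ (ν ξ) (fderiv ℝ G ξ v) = 0

/-- The numerator of the integrand, in parameters. -/
def numerator (G ν : E2 → E3) (g : E2 → ℝ) (a b : E2) : ℝ :=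
  inner ℝ (g b • ν a + g a • ν b) (G a - G b)

/-- The area density of a parametrization. -/
def areaDensity (G : E2 → E3) (b : E2) : ℝ := Real.sqrt (gram (fderiv ℝ G b))

namespace IsSurfacePatch

variable {R : ℝ} {G ν : E2 → E3} {π : E3 → E2} {L : ℝ≥0} {g : E2 → ℝ}

theorem closedBall_subset (h : IsSurfacePatch R G ν π L g) :
    Metric.closedBall (0 : E2) (R / 2) ⊆ Metric.ball 0 R :=
  Metric.closedBall_subset_ball (by linarith [h.radius_pos])

theorem contDiffOn_fderiv (h : IsSurfacePatch R G ν π L g) :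
    ContDiffOn ℝ 7 (fderiv ℝ G) (Metric.ball 0 R) :=
  h.contDiffOn.fderiv_of_isOpen h.isOpen (by norm_num)

theorem contDiffOn_areaDensity (h : IsSurfacePatch R G ν π L g) :
    ContDiffOn ℝ 7 (areaDensity G) (Metric.ball 0 R) := by
  have h0 := h.contDiffOn_fderiv.clm_apply (contDiffOn_const (c := EuclideanSpace.single 0 1))
  have h1 := h.contDiffOn_fderiv.clm_apply (contDiffOn_const (c := EuclideanSpace.single 1 1))
  have hgram : ContDiffOn ℝ 7 (fun b => gram (fderiv ℝ G b)) (Metric.ball 0 R) :=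
    ((h0.norm_sq ℝ).mul (h1.norm_sq ℝ)).sub ((h0.inner ℝ h1).pow 2)
  exact hgram.sqrt fun x hx => (gram_pos (h.fderiv_injective hx)).ne'

theorem hasFDerivAt (h : IsSurfacePatch R G ν π L g) {x : E2} (hx : x ∈ Metric.ball 0 R) :
    HasFDerivAt G (fderiv ℝ G x) x :=
  (h.hasStrictFDerivAt hx).hasFDerivAt

theorem hasFDerivAt_normal (h : IsSurfacePatch R G ν π L g) {x : E2}
    (hx : x ∈ Metric.ball 0 R) : HasFDerivAt ν (fderiv ℝ ν x) x :=
  ((h.normal.contDiffAt (h.isOpen.mem_nhds hx)).differentiableAt (by simp)).hasFDerivAt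

/-- The trapezoidal rule on the surface: the mean normal is orthogonal to chords up to third
order. -/
theorem exists_trapezoid_bound (h : IsSurfacePatch R G ν π L g) :
    ∃ C, 0 ≤ C ∧ ∀ a ∈ Metric.closedBall (0 : E2) (R / 2), ∀ b ∈ Metric.closedBall (0 : E2) (R / 2),
      |inner ℝ (ν a + ν b) (G b - G a)| ≤ C * ‖b - a‖ ^ 3 := by
  have hK := isCompact_closedBall (0 : E2) (R / 2)
  have hconv := convex_closedBall (0 : E2) (R / 2)
  have hKU := h.closedBall_subset
  obtain ⟨A, hA0, hA⟩ := exists_norm_fderiv_le h.isOpen hK hKU (h.contDiffOn.of_le (by norm_num))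
  obtain ⟨B, hB0, hB⟩ := exists_norm_fderiv_le h.isOpen hK hKU (h.normal.of_le (by norm_num))
  obtain ⟨A', hA'0, hA'⟩ := exists_second_order_bound h.isOpen hK hconv hKU
    (h.contDiffOn.of_le (by norm_num))
  obtain ⟨B', hB'0, hB'⟩ := exists_second_order_bound h.isOpen hK hconv hKU
    (h.normal.of_le (by norm_num))
  refine ⟨B * A' + B' * A, by positivity, fun a ha b hb => ?_⟩
  set w := b - a
  set T : ℝ → ℝ := fun t => inner ℝ (ν a + ν (a + t • w)) (G (a + t • w) - G a)
  have hmem : ∀ t ∈ Icc (0 : ℝ) 1, a + t • w ∈ Metric.closedBall (0 : E2) (R / 2) := by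
    intro t ht
    have := hconv.add_smul_sub_mem ha hb ht
    exact this
  have hd : ∀ t ∈ Icc (0 : ℝ) 1, HasDerivAt T
      (inner ℝ (ν a + ν (a + t • w)) (fderiv ℝ G (a + t • w) w)
        + inner ℝ (fderiv ℝ ν (a + t • w) w) (G (a + t • w) - G a)) t := by
    intro t ht
    have hx := hKU (hmem t ht)
    have hline : HasDerivAt (fun t : ℝ => a + t • w) w t := by
      simpa using ((hasDerivAt_id t).smul_const w).const_add a
    have h1 := (h.hasFDerivAt hx).comp_hasDerivAt t hline
    have h2 := (h.hasFDerivAt_normal hx).comp_hasDerivAt t hline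
    exact (h2.const_add (ν a)).inner ℝ (h1.sub_const (G a))
  have hbound : ∀ t ∈ Icc (0 : ℝ) 1,
      ‖inner ℝ (ν a + ν (a + t • w)) (fderiv ℝ G (a + t • w) w)
        + inner ℝ (fderiv ℝ ν (a + t • w) w) (G (a + t • w) - G a)‖
        ≤ (B * A' + B' * A) * ‖w‖ ^ 3 := by
    intro t ht
    have hx := hmem t ht
    set x := a + t • w with hxdef
    have hxa : x - a = t • w := by rw [hxdef]; abel
    have e1 := h.orthogonal x (hKU hx) w
    have h1 := hA' a ha x hx
    have h2 := hB' a ha x hx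
    rw [hxa] at h1 h2
    -- Orthogonality at `x` removes `ν x` from the first term. The bilinear terms `t ⟨Dν w, DG w⟩`
    -- added to both remainders cancel, so only products of a first-order and a second-order
    -- quantity are left.
    have e : inner ℝ (ν a + ν x) (fderiv ℝ G x w) + inner ℝ (fderiv ℝ ν x w) (G x - G a)
        = inner ℝ (fderiv ℝ ν x w) (G x - G a - fderiv ℝ G x (t • w))
          - inner ℝ (ν x - ν a - fderiv ℝ ν x (t • w)) (fderiv ℝ G x w) := by
      simp only [inner_add_left, inner_sub_left, inner_sub_right, map_smul, inner_smul_left,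
        inner_smul_right, e1]
      simp
      ring
    have htw : ‖t • w‖ ≤ ‖w‖ := by
      rw [norm_smul, Real.norm_of_nonneg ht.1]
      exact mul_le_of_le_one_left (norm_nonneg _) ht.2
    have htw2 : ‖t • w‖ ^ 2 ≤ ‖w‖ ^ 2 := pow_le_pow_left₀ (norm_nonneg _) htw 2
    have hνw : ‖fderiv ℝ ν x w‖ ≤ B * ‖w‖ := (fderiv ℝ ν x).le_of_opNorm_le (hB x hx) w
    have hGw : ‖fderiv ℝ G x w‖ ≤ A * ‖w‖ := (fderiv ℝ G x).le_of_opNorm_le (hA x hx) w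
    rw [e]
    calc _ ≤ ‖inner ℝ (fderiv ℝ ν x w) (G x - G a - fderiv ℝ G x (t • w))‖
          + ‖inner ℝ (ν x - ν a - fderiv ℝ ν x (t • w)) (fderiv ℝ G x w)‖ := norm_sub_le _ _
      _ ≤ (B * ‖w‖) * (A' * ‖w‖ ^ 2) + (B' * ‖w‖ ^ 2) * (A * ‖w‖) := by
          refine add_le_add ((norm_inner_le_norm _ _).trans ?_)
            ((norm_inner_le_norm _ _).trans ?_)
          · exact mul_le_mul hνw (h1.trans (by gcongr)) (norm_nonneg _) (by positivity)
          · exact mul_le_mul (h2.trans (by gcongr)) hGw (norm_nonneg _) (by positivity)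
      _ = _ := by ring
  have := (convex_Icc (0 : ℝ) 1).norm_image_sub_le_of_norm_hasDerivWithin_le
    (fun t ht => (hd t ht).hasDerivWithinAt) hbound (left_mem_Icc.2 zero_le_one)
    (right_mem_Icc.2 zero_le_one)
  simp only [T, one_smul, zero_smul, add_zero, sub_self, inner_zero_right, sub_zero, norm_one,
    mul_one] at this
  have hw : a + w = b := by simp [w]
  rwa [hw] at this

/-- This is what the modified form of the potential achieves: the symmetric part is the trapezoidal
expression, and the rest pairs `g b - g a = O(‖b - a‖)` with a normal component of the chord of size
`O(‖b - a‖²)`. After division by the cubed distance the kernel is bounded. -/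
theorem exists_numerator_bound (h : IsSurfacePatch R G ν π L g) :
    ∃ C, 0 ≤ C ∧ ∀ a ∈ Metric.closedBall (0 : E2) (R / 2), ∀ b ∈ Metric.closedBall (0 : E2) (R / 2),
      |numerator G ν g a b| ≤ C * ‖b - a‖ ^ 3 := by
  have hK := isCompact_closedBall (0 : E2) (R / 2)
  have hconv := convex_closedBall (0 : E2) (R / 2)
  have hKU := h.closedBall_subset
  obtain ⟨T, hT0, hT⟩ := h.exists_trapezoid_bound
  obtain ⟨A, hA0, hA⟩ := exists_second_order_bound h.isOpen hK hconv hKU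
    (h.contDiffOn.of_le (by norm_num))
  obtain ⟨B, hB0, hB⟩ := exists_norm_fderiv_le h.isOpen hK hKU (h.density.of_le (by norm_num))
  obtain ⟨M, hM⟩ := hK.exists_bound_of_continuousOn (h.density.continuousOn.mono hKU)
  obtain ⟨N, hN⟩ := hK.exists_bound_of_continuousOn (h.normal.continuousOn.mono hKU)
  refine ⟨|M| * T + B * (|N| * A), by positivity, fun a ha b hb => ?_⟩
  have e : numerator G ν g a b = -(g a * inner ℝ (ν a + ν b) (G b - G a))
      + (g b - g a) * inner ℝ (ν a) (G a - G b - fderiv ℝ G a (a - b)) := by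
    have := h.orthogonal a (hKU ha) (a - b)
    simp only [numerator, inner_add_left, inner_sub_right, inner_smul_left, this]
    simp
    ring
  have h1 : |g b - g a| ≤ B * ‖b - a‖ :=
    hconv.norm_image_sub_le_of_norm_hasFDerivWithin_le
      (fun w hw => (((h.density.contDiffAt (h.isOpen.mem_nhds (hKU hw))).differentiableAt
        (by simp)).hasFDerivAt.hasFDerivWithinAt)) hB ha hb
  have h2 : |inner ℝ (ν a) (G a - G b - fderiv ℝ G a (a - b))| ≤ |N| * (A * ‖b - a‖ ^ 2) := by
    refine (abs_real_inner_le_norm _ _).trans ?_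
    refine mul_le_mul ((hN a ha).trans (le_abs_self N)) ?_ (norm_nonneg _) (abs_nonneg _)
    rw [norm_sub_rev b a]
    exact hA b hb a ha
  have h3 : |g a| ≤ |M| := (hM a ha).trans (le_abs_self M)
  rw [e]
  calc _ ≤ |-(g a * inner ℝ (ν a + ν b) (G b - G a))|
        + |(g b - g a) * inner ℝ (ν a) (G a - G b - fderiv ℝ G a (a - b))| := abs_add_le _ _
    _ ≤ |M| * (T * ‖b - a‖ ^ 3) + (B * ‖b - a‖) * (|N| * (A * ‖b - a‖ ^ 2)) := by
        rw [abs_neg, abs_mul, abs_mul]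
        refine add_le_add ?_ ?_
        · exact mul_le_mul h3 (hT a ha b hb) (abs_nonneg _) (abs_nonneg _)
        · exact mul_le_mul h1 h2 (abs_nonneg _) (by positivity)
    _ = _ := by ring

end IsSurfacePatch

/-! ### Expansion of the kernel along rays, uniform in base point and direction. -/

/-- Rays in the parameter plane: a base point and a direction. -/
abbrev Ray (R : ℝ) : Type := {q : E2 × E2 // ‖q.1‖ ≤ R / 4 ∧ ‖q.2‖ = 1}

namespace Ray

variable {R : ℝ}

/-- The opposite ray. -/
def opp (i : Ray R) : Ray R := ⟨(i.1.1, -i.1.2), i.2.1, by simpa using i.2.2⟩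

/-- The point at parameter `r` on a ray. -/
def point (i : Ray R) (r : ℝ) : E2 := i.1.1 + r • i.1.2

theorem opp_opp (i : Ray R) : i.opp.opp = i := by
  simp [opp]

theorem opp_point (i : Ray R) (r : ℝ) : i.opp.point (-r) = i.point r := by
  simp [opp, point]

theorem norm_point_sub (i : Ray R) (r : ℝ) : ‖i.point r - i.1.1‖ = |r| := by
  simp [point, norm_smul, i.2.2]

theorem point_mem (i : Ray R) {r : ℝ} (hr : |r| < R / 4) :
    i.point r ∈ Metric.closedBall (0 : E2) (R / 2) := by
  have h1 : ‖i.point r‖ ≤ ‖i.1.1‖ + ‖r • i.1.2‖ := norm_add_le _ _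
  rw [norm_smul, i.2.2, mul_one, Real.norm_eq_abs] at h1
  have := i.2.1
  rw [mem_closedBall_zero_iff]
  linarith

end Ray

namespace IsSurfacePatch

variable {R : ℝ} {G ν : E2 → E3} {π : E3 → E2} {L : ℝ≥0} {g : E2 → ℝ}

theorem base_mem (h : IsSurfacePatch R G ν π L g) (i : Ray R) :
    i.1.1 ∈ Metric.closedBall (0 : E2) (R / 2) := by
  rw [mem_closedBall_zero_iff]
  linarith [i.2.1, h.radius_pos]

/-- The numerator with the area density, along rays. -/
def numeratorRay (R : ℝ) (G ν : E2 → E3) (g : E2 → ℝ) (q : Ray R × ℝ) : ℝ :=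
  numerator G ν g q.1.1.1 (q.1.point q.2) * areaDensity G (q.1.point q.2)

/-- The squared chord length along rays. -/
def chordSq (R : ℝ) (G : E2 → E3) (q : Ray R × ℝ) : ℝ :=
  ‖G (q.1.point q.2) - G q.1.1.1‖ ^ 2

/-- Half the derivative of the squared chord length along rays. -/
def chordDeriv (R : ℝ) (G : E2 → E3) (q : Ray R × ℝ) : ℝ :=
  inner ℝ (G (q.1.point q.2) - G q.1.1.1) (fderiv ℝ G (q.1.point q.2) q.1.1.2)

theorem contDiffOn_numerator (h : IsSurfacePatch R G ν π L g) :
    ContDiffOn ℝ 7 (fun p : E2 × E2 => numerator G ν g p.1 p.2 * areaDensity G p.2)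
      (Metric.ball 0 R ×ˢ Metric.ball 0 R) := by
  have h1 : MapsTo Prod.fst (Metric.ball (0 : E2) R ×ˢ Metric.ball (0 : E2) R)
    (Metric.ball 0 R) := fun p hp => hp.1
  have h2 : MapsTo Prod.snd (Metric.ball (0 : E2) R ×ˢ Metric.ball (0 : E2) R)
    (Metric.ball 0 R) := fun p hp => hp.2
  have hG : ContDiffOn ℝ 7 G (Metric.ball 0 R) := h.contDiffOn.of_le (by norm_num)
  exact ((((h.density.comp contDiffOn_snd h2).smul (h.normal.comp contDiffOn_fst h1)).add
    ((h.density.comp contDiffOn_fst h1).smul (h.normal.comp contDiffOn_snd h2))).inner ℝ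
    ((hG.comp contDiffOn_fst h1).sub (hG.comp contDiffOn_snd h2))).mul
    (h.contDiffOn_areaDensity.comp contDiffOn_snd h2)

theorem contDiffOn_chordSq (h : IsSurfacePatch R G ν π L g) :
    ContDiffOn ℝ 7 (fun p : E2 × E2 => ‖G p.2 - G p.1‖ ^ 2)
      (Metric.ball 0 R ×ˢ Metric.ball 0 R) := by
  have h1 : MapsTo Prod.fst (Metric.ball (0 : E2) R ×ˢ Metric.ball (0 : E2) R)
    (Metric.ball 0 R) := fun p hp => hp.1
  have h2 : MapsTo Prod.snd (Metric.ball (0 : E2) R ×ˢ Metric.ball (0 : E2) R)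
    (Metric.ball 0 R) := fun p hp => hp.2
  have hG : ContDiffOn ℝ 7 G (Metric.ball 0 R) := h.contDiffOn.of_le (by norm_num)
  exact ((hG.comp contDiffOn_snd h2).sub (hG.comp contDiffOn_fst h1)).norm_sq ℝ

theorem contDiffOn_chordDeriv (h : IsSurfacePatch R G ν π L g) :
    ContDiffOn ℝ 7 (fun p : E2 × E2 × E2 =>
        (inner ℝ (G p.2.1 - G p.1) (fderiv ℝ G p.2.1 p.2.2) : ℝ))
      (Metric.ball 0 R ×ˢ Metric.ball 0 R ×ˢ univ) := by
  have h1 : MapsTo Prod.fst (Metric.ball (0 : E2) R ×ˢ Metric.ball (0 : E2) R ×ˢ (univ : Set E2))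
    (Metric.ball 0 R) := fun p hp => hp.1
  have h2 : MapsTo (fun p : E2 × E2 × E2 => p.2.1)
    (Metric.ball (0 : E2) R ×ˢ Metric.ball (0 : E2) R ×ˢ (univ : Set E2))
    (Metric.ball 0 R) := fun p hp => hp.2.1
  have hG : ContDiffOn ℝ 7 G (Metric.ball 0 R) := h.contDiffOn.of_le (by norm_num)
  have hs : ContDiff ℝ 7 (fun p : E2 × E2 × E2 => p.2.1) := by fun_prop
  have hs' : ContDiff ℝ 7 (fun p : E2 × E2 × E2 => p.2.2) := by fun_prop
  exact ((hG.comp hs.contDiffOn h2).sub (hG.comp contDiffOn_fst h1)).inner ℝ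
    ((h.contDiffOn_fderiv.comp hs.contDiffOn h2).clm_apply hs'.contDiffOn)

/-- Order six, because three divisions by `r` have to leave order three; the squared chord and its
derivative start from five and four for the same reason. The Taylor segment in the product space
keeps the first point fixed and moves only the second. -/
theorem hasExpansion_numeratorRay (h : IsSurfacePatch R G ν π L g) :
    HasExpansion 6 (numeratorRay R G ν g) := by
  have hK := isCompact_closedBall (0 : E2) (R / 2)
  have hKU := h.closedBall_subset
  have hR : 0 < R / 4 := by linarith [h.radius_pos]
  have := hasExpansion_of_contDiffOn (I := Ray R) (n := 6) (h.isOpen.prod h.isOpen) (hK.prod hK)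
    (prod_mono hKU hKU) hR (p := fun i => (i.1.1, i.1.1)) (v := fun i => (0, i.1.2))
    (fun i => by simp [i.2.2])
    (fun i r hr => by
      simpa [Ray.point] using And.intro (mem_closedBall_zero_iff.1 (h.base_mem i))
        (mem_closedBall_zero_iff.1 (i.point_mem hr)))
    (h.contDiffOn_numerator.of_le (by norm_num))
  refine cast (congrArg (HasExpansion 6) ?_) this
  ext q
  simp [numeratorRay, Ray.point]

theorem hasExpansion_chordSq (h : IsSurfacePatch R G ν π L g) :
    HasExpansion 5 (chordSq R G) := by
  have hK := isCompact_closedBall (0 : E2) (R / 2)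
  have hKU := h.closedBall_subset
  have hR : 0 < R / 4 := by linarith [h.radius_pos]
  have := hasExpansion_of_contDiffOn (I := Ray R) (n := 5) (h.isOpen.prod h.isOpen) (hK.prod hK)
    (prod_mono hKU hKU) hR (p := fun i => (i.1.1, i.1.1)) (v := fun i => (0, i.1.2))
    (fun i => by simp [i.2.2])
    (fun i r hr => by
      simpa [Ray.point] using And.intro (mem_closedBall_zero_iff.1 (h.base_mem i))
        (mem_closedBall_zero_iff.1 (i.point_mem hr)))
    (h.contDiffOn_chordSq.of_le (by norm_num))
  refine cast (congrArg (HasExpansion 5) ?_) this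
  ext q
  simp [chordSq, Ray.point]

theorem hasExpansion_chordDeriv (h : IsSurfacePatch R G ν π L g) :
    HasExpansion 4 (chordDeriv R G) := by
  have hK := isCompact_closedBall (0 : E2) (R / 2)
  have hKU := h.closedBall_subset
  have hR : 0 < R / 4 := by linarith [h.radius_pos]
  have := hasExpansion_of_contDiffOn (I := Ray R) (n := 4)
    (h.isOpen.prod (h.isOpen.prod isOpen_univ)) (hK.prod (hK.prod (isCompact_closedBall (0 : E2) 1)))
    (prod_mono hKU (prod_mono hKU (subset_univ _))) hR
    (p := fun i => (i.1.1, i.1.1, i.1.2)) (v := fun i => (0, i.1.2, 0))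
    (fun i => by simp [i.2.2])
    (fun i r hr => by
      simpa [Ray.point, i.2.2] using And.intro (mem_closedBall_zero_iff.1 (h.base_mem i))
        (mem_closedBall_zero_iff.1 (i.point_mem hr)))
    (h.contDiffOn_chordDeriv.of_le (by norm_num))
  refine cast (congrArg (HasExpansion 4) ?_) this
  ext q
  simp [chordDeriv, Ray.point]

theorem abs_le_norm_chord (h : IsSurfacePatch R G ν π L g) (i : Ray R) {r : ℝ}
    (hr : |r| < R / 4) : |r| ≤ ‖G (i.point r) - G i.1.1‖ := by
  have := h.expanding _ (h.closedBall_subset (i.point_mem hr)) _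
    (h.closedBall_subset (h.base_mem i))
  rwa [i.norm_point_sub] at this

theorem norm_chord_le (h : IsSurfacePatch R G ν π L g) (i : Ray R) {r : ℝ}
    (hr : |r| < R / 4) : ‖G (i.point r) - G i.1.1‖ ≤ L * |r| := by
  have := h.lipschitz.norm_sub_le (h.closedBall_subset (i.point_mem hr))
    (h.closedBall_subset (h.base_mem i))
  rwa [i.norm_point_sub] at this

theorem exists_areaDensity_le (h : IsSurfacePatch R G ν π L g) :
    ∃ C, 0 ≤ C ∧ ∀ b ∈ Metric.closedBall (0 : E2) (R / 2), |areaDensity G b| ≤ C := by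
  obtain ⟨C, hC⟩ := (isCompact_closedBall (0 : E2) (R / 2)).exists_bound_of_continuousOn
    (h.contDiffOn_areaDensity.continuousOn.mono h.closedBall_subset)
  exact ⟨|C|, abs_nonneg C, fun b hb => (hC b hb).trans (le_abs_self C)⟩

theorem exists_numeratorRay_le (h : IsSurfacePatch R G ν π L g) :
    ∃ C, 0 ≤ C ∧ ∀ (i : Ray R) (r : ℝ), |r| < R / 4 →
      |numeratorRay R G ν g (i, r)| ≤ C * |r| ^ 3 := by
  obtain ⟨C, hC0, hC⟩ := h.exists_numerator_bound
  obtain ⟨A, hA0, hA⟩ := h.exists_areaDensity_le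
  refine ⟨C * A, by positivity, fun i r hr => ?_⟩
  have h1 := hC _ (h.base_mem i) _ (i.point_mem hr)
  rw [i.norm_point_sub] at h1
  rw [numeratorRay, abs_mul]
  calc _ ≤ (C * |r| ^ 3) * A :=
        mul_le_mul h1 (hA _ (i.point_mem hr)) (abs_nonneg _) (by positivity)
    _ = _ := by ring

/-- The chord equals `r` times the tangent vector at its moving end up to `O(r²)`. Used to keep `D /
r` away from zero. -/
theorem exists_chordDeriv_sub_le (h : IsSurfacePatch R G ν π L g) :
    ∃ C, 0 ≤ C ∧ ∀ (i : Ray R) (r : ℝ), |r| < R / 4 →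
      |chordDeriv R G (i, r) - r * ‖fderiv ℝ G (i.point r) i.1.2‖ ^ 2| ≤ C * r ^ 2 := by
  have hK := isCompact_closedBall (0 : E2) (R / 2)
  have hconv := convex_closedBall (0 : E2) (R / 2)
  have hKU := h.closedBall_subset
  obtain ⟨C, hC0, hC⟩ := exists_second_order_bound h.isOpen hK hconv hKU
    (h.contDiffOn.of_le (by norm_num))
  obtain ⟨A, hA0, hA⟩ := exists_norm_fderiv_le h.isOpen hK hKU (h.contDiffOn.of_le (by norm_num))
  refine ⟨C * A, by positivity, fun i r hr => ?_⟩
  have h1 := hC _ (h.base_mem i) _ (i.point_mem hr)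
  rw [i.norm_point_sub, sq_abs] at h1
  have hw : ‖fderiv ℝ G (i.point r) i.1.2‖ ≤ A := by
    have := (fderiv ℝ G (i.point r)).le_of_opNorm_le (hA _ (i.point_mem hr)) i.1.2
    rwa [i.2.2, mul_one] at this
  have e : i.point r - i.1.1 = r • i.1.2 := by simp [Ray.point]
  rw [e, map_smul] at h1
  have e2 : chordDeriv R G (i, r) - r * ‖fderiv ℝ G (i.point r) i.1.2‖ ^ 2
      = inner ℝ (G (i.point r) - G i.1.1 - r • fderiv ℝ G (i.point r) i.1.2)
        (fderiv ℝ G (i.point r) i.1.2) := by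
    rw [chordDeriv, inner_sub_left _ (r • _), real_inner_smul_left, real_inner_self_eq_norm_sq]
  rw [e2]
  calc _ ≤ _ := abs_real_inner_le_norm _ _
    _ ≤ (C * r ^ 2) * A := mul_le_mul h1 hw (norm_nonneg _) (by positivity)
    _ = _ := by ring

theorem exists_abs_chordDeriv_le (h : IsSurfacePatch R G ν π L g) :
    ∃ C, 0 ≤ C ∧ ∀ (i : Ray R) (r : ℝ), |r| < R / 4 → |chordDeriv R G (i, r)| ≤ C * |r| := by
  obtain ⟨A, hA0, hA⟩ := exists_norm_fderiv_le h.isOpen (isCompact_closedBall (0 : E2) (R / 2))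
    h.closedBall_subset (h.contDiffOn.of_le (by norm_num))
  refine ⟨L * A, by positivity, fun i r hr => ?_⟩
  have hw : ‖fderiv ℝ G (i.point r) i.1.2‖ ≤ A := by
    have := (fderiv ℝ G (i.point r)).le_of_opNorm_le (hA _ (i.point_mem hr)) i.1.2
    rwa [i.2.2, mul_one] at this
  calc _ ≤ _ := abs_real_inner_le_norm _ _
    _ ≤ (L * |r|) * A :=
        mul_le_mul (h.norm_chord_le i hr) hw (norm_nonneg _) (by positivity)
    _ = _ := by ring

theorem eventually_of_lt (h : IsSurfacePatch R G ν π L g) {p : Ray R × ℝ → Prop}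
    (hp : ∀ (i : Ray R) (r : ℝ), r ≠ 0 → |r| < R / 4 → p (i, r)) :
    ∀ᶠ q in nearZero (Ray R), p q :=
  eventually_nearZero.2 ⟨R / 4, by linarith [h.radius_pos], hp⟩

theorem isBigO_of_le (h : IsSurfacePatch R G ν π L g) {F : Ray R × ℝ → ℝ} {C : ℝ} {n : ℕ}
    (hF : ∀ (i : Ray R) (r : ℝ), r ≠ 0 → |r| < R / 4 → |F (i, r)| ≤ C * |r| ^ n) :
    F =O[nearZero (Ray R)] fun q => q.2 ^ n := by
  refine IsBigO.of_bound C (h.eventually_of_lt fun i r hr0 hr => ?_)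
  rw [norm_pow]
  exact hF i r hr0 hr

theorem hasExpansion_numeratorRay_div (h : IsSurfacePatch R G ν π L g) :
    HasExpansion 3 fun q => numeratorRay R G ν g q / q.2 / q.2 / q.2 := by
  obtain ⟨C, hC0, hC⟩ := h.exists_numeratorRay_le
  have h3 : numeratorRay R G ν g =O[nearZero (Ray R)] fun q => q.2 ^ 3 :=
    h.isBigO_of_le fun i r _ hr => hC i r hr
  have h2 : (fun q => numeratorRay R G ν g q / q.2) =O[nearZero (Ray R)] fun q => q.2 ^ 2 := by
    refine h.isBigO_of_le (C := C) fun i r hr0 hr => ?_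
    rw [abs_div, div_le_iff₀ (abs_pos.2 hr0)]
    exact (hC i r hr).trans_eq (by ring)
  have h1 : (fun q => numeratorRay R G ν g q / q.2 / q.2) =O[nearZero (Ray R)]
      fun q => q.2 ^ 1 := by
    refine h.isBigO_of_le (C := C) fun i r hr0 hr => ?_
    rw [abs_div, div_le_iff₀ (abs_pos.2 hr0), abs_div, div_le_iff₀ (abs_pos.2 hr0)]
    exact (hC i r hr).trans_eq (by ring)
  exact ((h.hasExpansion_numeratorRay.div (h3.trans (isBigO_pow_of_le (by norm_num)))).div
    (h2.trans (isBigO_pow_of_le (by norm_num)))).div h1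

theorem hasExpansion_chordSq_div (h : IsSurfacePatch R G ν π L g) :
    HasExpansion 3 fun q => chordSq R G q / q.2 / q.2 := by
  have hC : ∀ (i : Ray R) (r : ℝ), |r| < R / 4 → |chordSq R G (i, r)| ≤ (L : ℝ) ^ 2 * |r| ^ 2 := by
    intro i r hr
    rw [chordSq, abs_of_nonneg (by positivity), ← mul_pow]
    exact pow_le_pow_left₀ (norm_nonneg _) (h.norm_chord_le i hr) 2
  have h2 : chordSq R G =O[nearZero (Ray R)] fun q => q.2 ^ 2 :=
    h.isBigO_of_le fun i r _ hr => hC i r hr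
  have h1 : (fun q => chordSq R G q / q.2) =O[nearZero (Ray R)] fun q => q.2 ^ 1 := by
    refine h.isBigO_of_le (C := (L : ℝ) ^ 2) fun i r hr0 hr => ?_
    rw [abs_div, div_le_iff₀ (abs_pos.2 hr0)]
    exact (hC i r hr).trans_eq (by ring)
  exact (h.hasExpansion_chordSq.div (h2.trans (isBigO_pow_of_le (by norm_num)))).div h1

theorem hasExpansion_chordDeriv_div (h : IsSurfacePatch R G ν π L g) :
    HasExpansion 3 fun q => chordDeriv R G q / q.2 := by
  obtain ⟨C, hC0, hC⟩ := h.exists_abs_chordDeriv_le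
  exact h.hasExpansion_chordDeriv.div
    (h.isBigO_of_le fun i r _ hr => (hC i r hr).trans_eq (by ring))

theorem one_le_chordSq_div (h : IsSurfacePatch R G ν π L g) :
    ∀ᶠ q in nearZero (Ray R), 1 ≤ chordSq R G q / q.2 / q.2 := by
  refine h.eventually_of_lt fun i r hr0 hr => ?_
  rw [div_div, le_div_iff₀ (mul_self_pos.2 hr0), one_mul, chordSq, ← sq, ← sq_abs]
  exact pow_le_pow_left₀ (abs_nonneg r) (h.abs_le_norm_chord i hr) 2

theorem half_le_chordDeriv_div (h : IsSurfacePatch R G ν π L g) :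
    ∀ᶠ q in nearZero (Ray R), 1 / 2 ≤ chordDeriv R G q / q.2 := by
  obtain ⟨C, hC0, hC⟩ := h.exists_chordDeriv_sub_le
  have hR := h.radius_pos
  refine eventually_nearZero.2 ⟨min (R / 4) (1 / (2 * (C + 1))), by positivity,
    fun i r hr0 hr => ?_⟩
  have hr1 := hr.trans_le (min_le_left _ _)
  have hr2 := hr.trans_le (min_le_right _ _)
  rw [lt_div_iff₀ (by positivity)] at hr2
  have h1 := hC i r hr1
  have h2 : 1 ≤ ‖fderiv ℝ G (i.point r) i.1.2‖ := by
    have := h.norm_le_fderiv (h.closedBall_subset (i.point_mem hr1)) i.1.2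
    rwa [i.2.2] at this
  have h3 : chordDeriv R G (i, r) / r - ‖fderiv ℝ G (i.point r) i.1.2‖ ^ 2
      = (chordDeriv R G (i, r) - r * ‖fderiv ℝ G (i.point r) i.1.2‖ ^ 2) / r := by
    field_simp
  have h4 : |chordDeriv R G (i, r) / r - ‖fderiv ℝ G (i.point r) i.1.2‖ ^ 2| ≤ C * |r| := by
    rw [h3, abs_div, div_le_iff₀ (abs_pos.2 hr0)]
    refine h1.trans_eq ?_
    rw [← sq_abs]
    ring
  have h5 := (abs_le.1 h4).1
  have h6 : 1 ≤ ‖fderiv ℝ G (i.point r) i.1.2‖ ^ 2 := one_le_pow₀ h2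
  have h7 : 0 < |r| := abs_pos.2 hr0
  simp only
  nlinarith

/-- Expansion of the kernel along rays in powers of the chord length, with parity. -/
theorem exists_radial_expansion (h : IsSurfacePatch R G ν π L g) :
    ∃ (ε C : ℝ) (a b c : Ray R → ℝ), 0 < ε ∧ ε ≤ R / 4 ∧ 0 ≤ C ∧
      (∀ i, |a i| ≤ C ∧ |b i| ≤ C ∧ |c i| ≤ C) ∧
      (∀ i, a i.opp = -a i ∧ c i.opp = -c i) ∧
      ∀ i r, 0 < r → r < ε →
        |numeratorRay R G ν g (i, r) * r / ‖G (i.point r) - G i.1.1‖ ^ 3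
          - chordDeriv R G (i, r) * (a i + b i * ‖G (i.point r) - G i.1.1‖
            + c i * ‖G (i.point r) - G i.1.1‖ ^ 2)| ≤ C * r ^ 4 := by
  set N := numeratorRay R G ν g
  set E := chordSq R G
  set D := chordDeriv R G
  set S : Ray R × ℝ → ℝ := fun q => Real.sqrt (E q / q.2 / q.2)
  set Q : Ray R × ℝ → ℝ := fun q => N q / q.2 / q.2 / q.2 * (S q * S q * S q)⁻¹ * (D q / q.2)⁻¹
  have hS : HasExpansion 3 S := h.hasExpansion_chordSq_div.sqrt one_pos h.one_le_chordSq_div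
  have hS1 : ∀ᶠ q in nearZero (Ray R), 1 ≤ S q := h.one_le_chordSq_div.mono fun q hq => by
    have := Real.sqrt_le_sqrt hq
    rwa [Real.sqrt_one] at this
  have hSS := (hS.mul hS).mul hS
  have hSS1 : ∀ᶠ q in nearZero (Ray R), 1 ≤ S q * S q * S q := hS1.mono fun q hq =>
    one_le_mul_of_one_le_of_one_le (one_le_mul_of_one_le_of_one_le hq hq) hq
  have hQ : HasExpansion 3 Q := (h.hasExpansion_numeratorRay_div.mul (hSS.inv one_pos hSS1)).mul
    (h.hasExpansion_chordDeriv_div.inv (by norm_num) h.half_le_chordDeriv_div)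
  obtain ⟨a, b, c, ⟨A, ha⟩, ⟨B, hb⟩, ⟨C, hc⟩, hO⟩ := hQ.reexpand hS one_pos hS1
  obtain ⟨K, ε, hK, hε, hO⟩ := isBigO_nearZero.1 hO
  obtain ⟨ε', hε', hD⟩ := eventually_nearZero.1 h.half_le_chordDeriv_div
  obtain ⟨M, hM0, hM⟩ := h.exists_abs_chordDeriv_le
  have hR := h.radius_pos
  have hNopp : ∀ (i : Ray R) r, N (i.opp, -r) = N (i, r) := fun i r => by
    simp only [N, numeratorRay, Ray.opp_point]
    rfl
  have hEopp : ∀ (i : Ray R) r, E (i.opp, -r) = E (i, r) := fun i r => by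
    simp only [E, chordSq, Ray.opp_point]
    rfl
  have hDopp : ∀ (i : Ray R) r, D (i.opp, -r) = -D (i, r) := fun i r => by
    simp only [D, chordDeriv, Ray.opp_point]
    simp [Ray.opp]
  have hSopp : ∀ (i : Ray R) r, S (i.opp, -r) = S (i, r) := fun i r => by
    simp only [S, hEopp, div_neg, neg_div, neg_neg]
  have hQopp : ∀ (i : Ray R) r, Q (i.opp, -r) = -Q (i, r) := fun i r => by
    simp only [Q, hNopp, hSopp, hDopp, div_neg, neg_div, neg_neg, neg_mul]
  -- The quotient `Q` is odd under reversing the ray together with `r`, while `S` is even. Averaging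
  -- the expansions at `(i, r)` and `(i.opp, -r)` with this sign makes the parity of the
  -- coefficients exact, without uniqueness of expansions.
  refine ⟨min (min ε ε') (R / 4), max (|A| + |B| + |C|) (M * K), fun i => (a i - a i.opp) / 2,
    fun i => (b i + b i.opp) / 2, fun i => (c i - c i.opp) / 2, by positivity, min_le_right _ _,
    by positivity, fun i => ?_, fun i => ?_, fun i r hr0 hr => ?_⟩
  · have hle := le_max_left (|A| + |B| + |C|) (M * K)
    have a1 := (ha i).trans (le_abs_self A)
    have a2 := (ha i.opp).trans (le_abs_self A)
    have b1 := (hb i).trans (le_abs_self B)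
    have b2 := (hb i.opp).trans (le_abs_self B)
    have c1 := (hc i).trans (le_abs_self C)
    have c2 := (hc i.opp).trans (le_abs_self C)
    rw [Real.norm_eq_abs, abs_le] at a1 a2 b1 b2 c1 c2
    have := abs_nonneg A
    have := abs_nonneg B
    have := abs_nonneg C
    refine ⟨?_, ?_, ?_⟩ <;> rw [abs_le] <;> constructor <;> linarith
  · simp only [Ray.opp_opp]
    constructor <;> ring
  · have hr1 : r < ε := hr.trans_le ((min_le_left _ _).trans (min_le_left _ _))
    have hr2 : r < ε' := hr.trans_le ((min_le_left _ _).trans (min_le_right _ _))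
    have hr3 : r < R / 4 := hr.trans_le (min_le_right _ _)
    have hrabs : |r| = r := abs_of_pos hr0
    set ρ := ‖G (i.point r) - G i.1.1‖
    have hρ : r ≤ ρ := by
      have := h.abs_le_norm_chord i (hrabs.trans_lt hr3)
      rwa [hrabs] at this
    have hρS : r * S (i, r) = ρ := by
      have hE : E (i, r) / r / r = (ρ / r) ^ 2 := by
        simp only [E, chordSq, ρ]
        field_simp
      simp only [S, hE]
      rw [Real.sqrt_sq (by positivity)]
      field_simp
    have e1 := hO i r hr0.ne' (hrabs.trans_lt hr1)
    -- Negative parameters enter here; for this reason the filter `nearZero` is two-sided.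
    have e2 := hO i.opp (-r) (neg_ne_zero.2 hr0.ne') (by rw [abs_neg]; exact hrabs.trans_lt hr1)
    simp only [hQopp, hSopp, abs_neg, hrabs, Real.norm_eq_abs, neg_mul, hρS] at e1 e2
    have e3 : |Q (i, r) - ((a i - a i.opp) / 2 + (b i + b i.opp) / 2 * ρ
        + (c i - c i.opp) / 2 * ρ ^ 2)| ≤ K * r ^ 3 := by
      rw [abs_le] at e1 e2 ⊢
      constructor <;> linarith
    have hD0 : D (i, r) ≠ 0 := by
      have := hD i r hr0.ne' (hrabs.trans_lt hr2)
      intro h0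
      change 1 / 2 ≤ D (i, r) / r at this
      rw [h0, zero_div] at this
      linarith
    have hQD : N (i, r) * r / ρ ^ 3 = D (i, r) * Q (i, r) := by
      have hS0 : S (i, r) ≠ 0 := by
        intro h0
        rw [h0, mul_zero] at hρS
        linarith
      simp only [Q, ← hρS]
      field_simp
    rw [hQD, ← mul_sub, abs_mul]
    have e4 := hM i r (hrabs.trans_lt hr3)
    rw [hrabs] at e4
    calc _ ≤ (M * r) * (K * r ^ 3) := mul_le_mul e4 e3 (abs_nonneg _) (by positivity)
      _ = M * K * r ^ 4 := by ring
      _ ≤ _ := by gcongr; exact le_max_right _ _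

end IsSurfacePatch

/-! ### Radial moments and cancellation between opposite rays. -/

/-- The moments of the defect. -/
def defectMoment (k : ℕ) : ℝ := ∫ r in Ioi (0 : ℝ), r ^ k * defect r

theorem defectMoment_two : defectMoment 2 = 0 := integral_sq_mul_defect

/-- Truncated moments of the rescaled defect agree with the full ones up to `O(δ⁵)`. -/
theorem exists_truncated_moment_bound {k j : ℕ} (hkj : k + j = 4) {d : ℝ} (hd : 0 < d) :
    ∃ C, 0 ≤ C ∧ ∀ δ : ℝ, 0 < δ → ∀ B : ℝ, d ≤ B →
      |(∫ u in (0 : ℝ)..B, u ^ k * defect (u / δ)) - δ ^ (k + 1) * defectMoment k| ≤ C * δ ^ 5 := by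
  have hint : IntegrableOn (fun r : ℝ => ‖r ^ 4 * defect r‖) (Ioi 0) :=
    (integrableOn_pow_mul_defect 4).norm
  set M := ∫ r in Ioi (0 : ℝ), ‖r ^ 4 * defect r‖
  have hM : 0 ≤ M := integral_nonneg fun r => norm_nonneg _
  refine ⟨M / d ^ j, by positivity, fun δ hδ B hB => ?_⟩
  have hB0 : 0 < B := hd.trans_le hB
  have hscale : ∫ u in (0 : ℝ)..B, u ^ k * defect (u / δ)
      = δ ^ (k + 1) * ∫ s in (0 : ℝ)..(B / δ), s ^ k * defect s := by
    have h1 := intervalIntegral.integral_comp_div (a := 0) (b := B)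
      (fun s => s ^ k * defect s) hδ.ne'
    rw [zero_div, smul_eq_mul] at h1
    rw [pow_succ, mul_assoc, ← h1, ← intervalIntegral.integral_const_mul]
    congr 1
    ext u
    rw [div_pow]
    field_simp
  have hBδ : 0 < B / δ := div_pos hB0 hδ
  have hsplit := intervalIntegral.integral_Ioi_sub_Ioi (integrableOn_pow_mul_defect k) hBδ.le
  have htail : |∫ s in Ioi (B / δ), s ^ k * defect s| ≤ (δ / B) ^ j * M := by
    have hsub : Ioi (B / δ) ⊆ Ioi 0 := Ioi_subset_Ioi hBδ.le
    calc |∫ s in Ioi (B / δ), s ^ k * defect s|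
        ≤ ∫ s in Ioi (B / δ), (δ / B) ^ j * ‖s ^ 4 * defect s‖ := by
          rw [← Real.norm_eq_abs]
          refine norm_integral_le_of_norm_le ((hint.mono_set hsub).const_mul _) ?_
          filter_upwards [self_mem_ae_restrict measurableSet_Ioi] with s hs
          have hs : B / δ < s := hs
          have hs0 : 0 < s := hBδ.trans hs
          -- On the tail `s > B / δ`, inserting this factor raises the weight to `s⁴` and gains `δ ^
          -- j`; with the prefactor `δ ^ (k + 1)` and `k + j = 4` the total is `δ⁵`.
          have h1 : 1 ≤ (δ / B * s) ^ j := by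
            refine one_le_pow₀ ?_
            rw [div_lt_iff₀ hδ] at hs
            rw [div_mul_eq_mul_div, le_div_iff₀ hB0]
            linarith
          rw [norm_mul, norm_mul, norm_pow, norm_pow, Real.norm_of_nonneg hs0.le, ← hkj, pow_add]
          calc s ^ k * ‖defect s‖ ≤ (δ / B * s) ^ j * (s ^ k * ‖defect s‖) :=
                le_mul_of_one_le_left (by positivity) h1
            _ = _ := by rw [mul_pow]; ring
      _ = (δ / B) ^ j * ∫ s in Ioi (B / δ), ‖s ^ 4 * defect s‖ := integral_const_mul _ _
      _ ≤ (δ / B) ^ j * M := by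
          refine mul_le_mul_of_nonneg_left ?_ (by positivity)
          exact setIntegral_mono_set hint (.of_forall fun s => norm_nonneg _)
            hsub.eventuallyLE
  rw [hscale, ← hsplit, defectMoment, ← mul_sub, sub_sub_cancel_left, mul_neg, abs_neg, abs_mul,
    abs_of_pos (by positivity)]
  calc δ ^ (k + 1) * |∫ s in Ioi (B / δ), s ^ k * defect s|
      ≤ δ ^ (k + 1) * ((δ / B) ^ j * M) := by gcongr
    _ = M / B ^ j * δ ^ 5 := by
        rw [div_pow, show δ ^ 5 = δ ^ (k + 1) * δ ^ j by rw [← pow_add]; congr 1; omega]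
        ring
    _ ≤ M / d ^ j * δ ^ 5 := by gcongr

/-- Substitution of the chord length for the parameter along a ray. -/
theorem integral_substitution {ρ D ψ : ℝ → ℝ} {ε : ℝ} (hε : 0 < ε)
    (hρ : ContinuousOn ρ (Icc 0 ε)) (hD : ContinuousOn D (Icc 0 ε)) (h0 : ρ 0 = 0)
    (hpos : ∀ r ∈ Ioo 0 ε, 0 < ρ r) (hder : ∀ r ∈ Ioo 0 ε, HasDerivAt ρ (D r / ρ r) r)
    (hψ : Continuous ψ) (k : ℕ) :
    ∫ r in (0 : ℝ)..ε, D r * ρ r ^ k * ψ (ρ r) = ∫ u in (0 : ℝ)..ρ ε, u ^ (k + 1) * ψ u := by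
  have hg : Continuous fun u : ℝ => u ^ (k + 1) * ψ u := by fun_prop
  set H : ℝ → ℝ := fun B => ∫ u in (0 : ℝ)..B, u ^ (k + 1) * ψ u
  have hH : ∀ B, HasDerivAt H (B ^ (k + 1) * ψ B) B := fun B =>
    intervalIntegral.integral_hasDerivAt_right (hg.intervalIntegrable _ _)
      (hg.stronglyMeasurableAtFilter _ _) hg.continuousAt
  have hHc : Continuous H := continuous_iff_continuousAt.2 fun B => (hH B).continuousAt
  have hint : IntervalIntegrable (fun r => D r * ρ r ^ k * ψ (ρ r)) volume 0 ε := by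
    refine ContinuousOn.intervalIntegrable ?_
    rw [uIcc_of_le hε.le]
    exact (hD.mul (hρ.pow k)).mul (hψ.comp_continuousOn hρ)
  -- The derivative is needed only in the open interval, so the quotient `D / ρ` at `r = 0` plays no
  -- role.
  rw [intervalIntegral.integral_eq_sub_of_hasDerivAt_of_le hε.le
    (hHc.comp_continuousOn hρ) (fun r hr => ?_) hint]
  · simp [h0, H]
  · refine ((hH (ρ r)).comp r (hder r hr)).congr_deriv ?_
    have := (hpos r hr).ne'
    field_simp
    ring

/-- Controls the expansion remainder: since `ρ ≥ r`, the Gaussian in `ρ / δ` is below the one in `r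
/ δ`, and part of it absorbs `(r / δ)⁴`. Integrating over `r` supplies the fifth power of `δ`. -/
theorem exists_pow_four_mul_defect_bound : ∃ C, 0 ≤ C ∧ ∀ δ : ℝ, 0 < δ → ∀ r ρ : ℝ, 0 ≤ r → r ≤ ρ →
    r ^ 4 * |defect (ρ / δ)| ≤ C * δ ^ 4 * Real.exp (-((r / δ) ^ 2 / 4)) := by
  obtain ⟨C, hC, h⟩ := exists_abs_defect_le
  obtain ⟨D, hD, h'⟩ := pow_le_mul_exp_sq 4
  refine ⟨D * C, by positivity, fun δ hδ r ρ hr hρ => ?_⟩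
  have h1 := h (ρ / δ) (by have := hr.trans hρ; positivity)
  have h2 : Real.exp (-((ρ / δ) ^ 2 / 2)) ≤ Real.exp (-((r / δ) ^ 2 / 2)) := by
    gcongr
  have h3 := h' (r / δ) (by positivity)
  have h4 : r ^ 4 = δ ^ 4 * (r / δ) ^ 4 := by field_simp
  rw [h4]
  calc δ ^ 4 * (r / δ) ^ 4 * |defect (ρ / δ)|
      ≤ δ ^ 4 * (D * Real.exp ((r / δ) ^ 2 / 4)) * (C * Real.exp (-((r / δ) ^ 2 / 2))) := by
        refine mul_le_mul (by gcongr) (h1.trans (by gcongr)) (abs_nonneg _) (by positivity)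
    _ = D * C * δ ^ 4 * (Real.exp ((r / δ) ^ 2 / 4) * Real.exp (-((r / δ) ^ 2 / 2))) := by ring
    _ = _ := by rw [← Real.exp_add]; ring_nf

theorem integrable_exp_scaled {δ : ℝ} (hδ : 0 < δ) :
    Integrable fun r : ℝ => Real.exp (-((r / δ) ^ 2 / 4)) :=
  integrable_exp_neg_sq_div_four.comp_div hδ.ne'

theorem setIntegral_exp_scaled_le {δ : ℝ} (hδ : 0 < δ) (s : Set ℝ) :
    ∫ r in s, Real.exp (-((r / δ) ^ 2 / 4)) ≤ δ * ∫ r : ℝ, Real.exp (-(r ^ 2 / 4)) := by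
  refine (setIntegral_le_integral (integrable_exp_scaled hδ)
    (.of_forall fun r => (Real.exp_pos _).le)).trans_eq ?_
  rw [Measure.integral_comp_div (fun r : ℝ => Real.exp (-(r ^ 2 / 4))) δ, abs_of_pos hδ,
    smul_eq_mul]

namespace IsSurfacePatch

variable {R : ℝ} {G ν : E2 → E3} {π : E3 → E2} {L : ℝ≥0} {g : E2 → ℝ}

/-- The chord length along a ray. -/
def chord (G : E2 → E3) (i : Ray R) (r : ℝ) : ℝ := ‖G (i.point r) - G i.1.1‖

theorem hasDerivAt_point (i : Ray R) (r : ℝ) : HasDerivAt i.point i.1.2 r := by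
  have : HasDerivAt (fun r : ℝ => i.1.1 + r • i.1.2) i.1.2 r := by
    simpa using ((hasDerivAt_id r).smul_const i.1.2).const_add i.1.1
  exact this

theorem continuous_point (i : Ray R) : Continuous i.point :=
  continuous_iff_continuousAt.2 fun r => (hasDerivAt_point i r).continuousAt

theorem mapsTo_point (h : IsSurfacePatch R G ν π L g) (i : Ray R) {ε : ℝ} (hε : ε < R / 4) :
    MapsTo i.point (Icc 0 ε) (Metric.ball 0 R) := fun r hr =>
  h.closedBall_subset (i.point_mem (by rw [abs_of_nonneg hr.1]; exact hr.2.trans_lt hε))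

theorem continuousOn_comp_point (h : IsSurfacePatch R G ν π L g) (i : Ray R) {ε : ℝ}
    (hε : ε < R / 4) {F : Type*} [TopologicalSpace F] {f : E2 → F}
    (hf : ContinuousOn f (Metric.ball 0 R)) :
    ContinuousOn (fun r => f (i.point r)) (Icc 0 ε) :=
  hf.comp (continuous_point i).continuousOn (h.mapsTo_point i hε)

theorem continuousOn_chord (h : IsSurfacePatch R G ν π L g) (i : Ray R) {ε : ℝ} (hε : ε < R / 4) :
    ContinuousOn (chord G i) (Icc 0 ε) :=
  ((h.continuousOn_comp_point i hε h.contDiffOn.continuousOn).sub continuousOn_const).norm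

theorem continuousOn_chordDeriv (h : IsSurfacePatch R G ν π L g) (i : Ray R) {ε : ℝ}
    (hε : ε < R / 4) : ContinuousOn (fun r => chordDeriv R G (i, r)) (Icc 0 ε) := by
  have h1 := (h.continuousOn_comp_point i hε h.contDiffOn.continuousOn).sub
    (continuousOn_const (c := G i.1.1))
  have h2 := (h.continuousOn_comp_point i hε h.contDiffOn_fderiv.continuousOn).clm_apply
    (continuousOn_const (c := i.1.2))
  exact h1.inner h2

theorem continuousOn_numerator (h : IsSurfacePatch R G ν π L g) {a : E2}
    (ha : a ∈ Metric.ball (0 : E2) R) :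
    ContinuousOn (fun b => numerator G ν g a b * areaDensity G b) (Metric.ball 0 R) :=
  ContinuousOn.comp (g := fun p : E2 × E2 => numerator G ν g p.1 p.2 * areaDensity G p.2)
    (f := fun b => (a, b)) h.contDiffOn_numerator.continuousOn
    (continuousOn_const.prodMk continuousOn_id) fun _ hb => ⟨ha, hb⟩

theorem continuousOn_numeratorRay (h : IsSurfacePatch R G ν π L g) (i : Ray R) {ε : ℝ}
    (hε : ε < R / 4) : ContinuousOn (fun r => numeratorRay R G ν g (i, r)) (Icc 0 ε) :=
  h.continuousOn_comp_point i hε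
    (h.continuousOn_numerator (h.closedBall_subset (h.base_mem i)))

theorem chord_pos (h : IsSurfacePatch R G ν π L g) (i : Ray R) {r : ℝ} (hr0 : 0 < r)
    (hr : r < R / 4) : r ≤ chord G i r := by
  have := h.abs_le_norm_chord i (r := r) (by rwa [abs_of_pos hr0])
  rwa [abs_of_pos hr0] at this

theorem hasDerivAt_chord (h : IsSurfacePatch R G ν π L g) (i : Ray R) {r : ℝ} (hr0 : 0 < r)
    (hr : r < R / 4) :
    HasDerivAt (chord G i) (chordDeriv R G (i, r) / chord G i r) r := by
  have hx := h.mapsTo_point i hr (right_mem_Icc.2 hr0.le)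
  have h1 : HasDerivAt (fun r => G (i.point r) - G i.1.1) (fderiv ℝ G (i.point r) i.1.2) r :=
    ((h.hasFDerivAt hx).comp_hasDerivAt r (hasDerivAt_point i r)).sub_const _
  have hpos := hr0.trans_le (h.chord_pos i hr0 hr)
  have h2 := h1.norm_sq.sqrt (pow_pos hpos 2).ne'
  have e : chord G i = fun r => Real.sqrt (‖G (i.point r) - G i.1.1‖ ^ 2) := by
    ext r
    rw [Real.sqrt_sq (norm_nonneg _), chord]
  rw [e]
  refine h2.congr_deriv ?_
  simp only
  rw [Real.sqrt_sq (norm_nonneg _), chordDeriv]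
  field_simp

/-- The kernel of the regularization error along a ray, with the polar Jacobian. -/
def rayKernel (R : ℝ) (G ν : E2 → E3) (g : E2 → ℝ) (δ : ℝ) (i : Ray R) (r : ℝ) : ℝ :=
  numeratorRay R G ν g (i, r) * r / chord G i r ^ 3 * defect (chord G i r / δ)

theorem integrableOn_rayKernel (h : IsSurfacePatch R G ν π L g) {δ : ℝ} (hδ : 0 < δ)
    (i : Ray R) {ε : ℝ} (hε : ε < R / 4) :
    IntegrableOn (rayKernel R G ν g δ i) (Ioo 0 ε) := by
  obtain ⟨C, hC0, hC⟩ := h.exists_numeratorRay_le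
  obtain ⟨A, hA0, hA⟩ := exists_abs_defect_le
  have hmono : Ioo 0 ε ⊆ Icc 0 ε := Ioo_subset_Icc_self
  have hch := (h.continuousOn_chord i hε).mono hmono
  have hcont : ContinuousOn (rayKernel R G ν g δ i) (Ioo 0 ε) := by
    refine ((((h.continuousOn_numeratorRay i hε).mono hmono).mul continuousOn_id).div
      (hch.pow 3) fun r hr => ?_).mul
      (continuous_defect.comp_continuousOn (hch.div_const δ))
    exact pow_ne_zero 3 (hr.1.trans_le (h.chord_pos i hr.1 (hr.2.trans hε))).ne'
  refine Integrable.mono' (integrableOn_const (C := C * ε * A) (by simp))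
    (hcont.aestronglyMeasurable measurableSet_Ioo) ?_
  filter_upwards [self_mem_ae_restrict measurableSet_Ioo] with r hr
  have hr4 := hr.2.trans hε
  have h1 := hC i r (by rwa [abs_of_pos hr.1])
  have h2 := h.chord_pos i hr.1 hr4
  have h0 : 0 < chord G i r := hr.1.trans_le h2
  rw [abs_of_pos hr.1] at h1
  have h3 : |defect (chord G i r / δ)| ≤ A :=
    (hA _ (by positivity)).trans (mul_le_of_le_one_right hA0 (Real.exp_le_one_iff.2 (by
      rw [Left.neg_nonpos_iff]; positivity)))
  have h4 : |numeratorRay R G ν g (i, r) * r / chord G i r ^ 3| ≤ C * ε := by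
    rw [abs_div, abs_mul, abs_of_pos hr.1, abs_of_pos (pow_pos h0 3), div_le_iff₀ (pow_pos h0 3)]
    calc _ ≤ (C * r ^ 3) * ε := by
          refine mul_le_mul h1 hr.2.le hr.1.le ?_
          have := hr.1
          positivity
      _ ≤ (C * chord G i r ^ 3) * ε := by
          have := hr.1
          have := hr.1.trans hr.2
          gcongr
      _ = _ := by ring
  rw [rayKernel, Real.norm_eq_abs, abs_mul]
  exact mul_le_mul h4 h3 (abs_nonneg _) ((abs_nonneg _).trans h4)

/-- Opposite rays together contribute `O(δ⁵)`. -/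
theorem exists_ray_bound (h : IsSurfacePatch R G ν π L g) :
    ∃ ε C : ℝ, 0 < ε ∧ ε < R / 4 ∧ 0 ≤ C ∧ ∀ δ : ℝ, 0 < δ → ∀ i : Ray R,
      |∫ r in Ioo 0 ε, (rayKernel R G ν g δ i r + rayKernel R G ν g δ i.opp r)| ≤ C * δ ^ 5 := by
  obtain ⟨ε0, C, a, b, c, hε0, hεR, hC0, habc, hopp, hexp⟩ := h.exists_radial_expansion
  -- Strictly smaller than `ε0`, hence than `R / 4`, so that the closed interval stays inside the
  -- patch.
  set ε := ε0 / 2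
  have hε : 0 < ε := by positivity
  have hε1 : ε < ε0 := by simp only [ε]; linarith
  have hεR' : ε < R / 4 := hε1.trans_le hεR
  obtain ⟨T1, hT1, t1⟩ := exists_truncated_moment_bound (k := 1) (j := 3) rfl hε
  obtain ⟨T2, hT2, t2⟩ := exists_truncated_moment_bound (k := 2) (j := 2) rfl hε
  obtain ⟨T3, hT3, t3⟩ := exists_truncated_moment_bound (k := 3) (j := 1) rfl hε
  obtain ⟨P, hP0, hP⟩ := exists_pow_four_mul_defect_bound
  set X := ∫ r : ℝ, Real.exp (-(r ^ 2 / 4))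
  have hX : 0 ≤ X := integral_nonneg fun r => (Real.exp_pos _).le
  have hmain : ∀ δ : ℝ, 0 < δ → ∀ i : Ray R,
      |(∫ r in Ioo 0 ε, rayKernel R G ν g δ i r)
        - (a i * (δ ^ 2 * defectMoment 1) + c i * (δ ^ 4 * defectMoment 3))|
        ≤ (C * (T1 + T2 + T3) + C * P * X) * δ ^ 5 := by
    intro δ hδ i
    set ρ := chord G i
    set D := fun r => chordDeriv R G (i, r)
    have hρc := h.continuousOn_chord i hεR'
    have hDc := h.continuousOn_chordDeriv i hεR'
    have hρε : ε ≤ ρ ε := h.chord_pos i hε hεR'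
    have hψ : Continuous fun u => defect (u / δ) := continuous_defect.comp (by fun_prop)
    have hρ0 : ρ 0 = 0 := by simp [ρ, chord, Ray.point]
    have hsub := fun k => integral_substitution hε hρc hDc hρ0
      (fun r hr => hr.1.trans_le (h.chord_pos i hr.1 (hr.2.trans hεR')))
      (fun r hr => h.hasDerivAt_chord i hr.1 (hr.2.trans hεR')) hψ k
    have hii : ∀ k, IntervalIntegrable (fun r => D r * ρ r ^ k * defect (ρ r / δ)) volume 0 ε := by
      intro k
      refine ContinuousOn.intervalIntegrable ?_
      rw [uIcc_of_le hε.le]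
      exact (hDc.mul (hρc.pow k)).mul (hψ.comp_continuousOn hρc)
    set poly : ℝ → ℝ := fun r => a i * (D r * ρ r ^ 0 * defect (ρ r / δ))
      + b i * (D r * ρ r ^ 1 * defect (ρ r / δ)) + c i * (D r * ρ r ^ 2 * defect (ρ r / δ))
    have hpolyi : IntervalIntegrable poly volume 0 ε :=
      (((hii 0).const_mul _).add ((hii 1).const_mul _)).add ((hii 2).const_mul _)
    have hpoly : ∫ r in (0 : ℝ)..ε, poly r
        = a i * (∫ u in (0 : ℝ)..ρ ε, u ^ 1 * defect (u / δ))
          + b i * (∫ u in (0 : ℝ)..ρ ε, u ^ 2 * defect (u / δ))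
          + c i * (∫ u in (0 : ℝ)..ρ ε, u ^ 3 * defect (u / δ)) := by
      rw [intervalIntegral.integral_add (((hii 0).const_mul _).add ((hii 1).const_mul _))
        ((hii 2).const_mul _), intervalIntegral.integral_add ((hii 0).const_mul _)
        ((hii 1).const_mul _), intervalIntegral.integral_const_mul,
        intervalIntegral.integral_const_mul, intervalIntegral.integral_const_mul,
        hsub 0, hsub 1, hsub 2]
    have hpoly' : ∫ r in Ioo 0 ε, poly r = ∫ r in (0 : ℝ)..ε, poly r := by
      rw [intervalIntegral.integral_of_le hε.le, integral_Ioc_eq_integral_Ioo]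
    have hpolyon : IntegrableOn poly (Ioo 0 ε) :=
      ((intervalIntegrable_iff_integrableOn_Ioo_of_le hε.le).1 hpolyi)
    have hrem : |(∫ r in Ioo 0 ε, rayKernel R G ν g δ i r) - ∫ r in Ioo 0 ε, poly r|
        ≤ C * P * X * δ ^ 5 := by
      rw [← integral_sub (h.integrableOn_rayKernel hδ i hεR') hpolyon, ← Real.norm_eq_abs]
      calc _ ≤ ∫ r in Ioo 0 ε, C * (P * δ ^ 4) * Real.exp (-((r / δ) ^ 2 / 4)) := by
            refine norm_integral_le_of_norm_le
              ((integrable_exp_scaled hδ).const_mul _).integrableOn ?_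
            filter_upwards [self_mem_ae_restrict measurableSet_Ioo] with r hr
            have h1 := hexp i r hr.1 (hr.2.trans hε1)
            have h2 := hP δ hδ r (ρ r) hr.1.le (h.chord_pos i hr.1 (hr.2.trans hεR'))
            have e : rayKernel R G ν g δ i r - poly r
                = (numeratorRay R G ν g (i, r) * r / ‖G (i.point r) - G i.1.1‖ ^ 3
                  - chordDeriv R G (i, r) * (a i + b i * ‖G (i.point r) - G i.1.1‖
                  + c i * ‖G (i.point r) - G i.1.1‖ ^ 2)) * defect (ρ r / δ) := by
              simp only [rayKernel, poly, ρ, D, chord]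
              ring
            rw [e, Real.norm_eq_abs, abs_mul]
            calc _ ≤ C * r ^ 4 * |defect (ρ r / δ)| := by gcongr
              _ = C * (r ^ 4 * |defect (ρ r / δ)|) := by ring
              _ ≤ C * (P * δ ^ 4 * Real.exp (-((r / δ) ^ 2 / 4))) := by gcongr
              _ = _ := by ring
        _ = C * (P * δ ^ 4) * ∫ r in Ioo 0 ε, Real.exp (-((r / δ) ^ 2 / 4)) :=
            integral_const_mul _ _
        _ ≤ C * (P * δ ^ 4) * (δ * X) := by
            gcongr
            exact setIntegral_exp_scaled_le hδ _
        _ = _ := by ring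
    have s1 := t1 δ hδ (ρ ε) hρε
    have s2 := t2 δ hδ (ρ ε) hρε
    have s3 := t3 δ hδ (ρ ε) hρε
    -- The `δ³` term disappears because the second moment is zero.
    rw [defectMoment_two, mul_zero, sub_zero] at s2
    obtain ⟨ha, hb, hc⟩ := habc i
    rw [hpoly', hpoly] at hrem
    set I1 := ∫ u in (0 : ℝ)..ρ ε, u ^ 1 * defect (u / δ)
    set I2 := ∫ u in (0 : ℝ)..ρ ε, u ^ 2 * defect (u / δ)
    set I3 := ∫ u in (0 : ℝ)..ρ ε, u ^ 3 * defect (u / δ)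
    have q1 : |a i * (I1 - δ ^ (1 + 1) * defectMoment 1)| ≤ C * (T1 * δ ^ 5) := by
      rw [abs_mul]; exact mul_le_mul ha s1 (abs_nonneg _) hC0
    have q2 : |b i * I2| ≤ C * (T2 * δ ^ 5) := by
      rw [abs_mul]; exact mul_le_mul hb s2 (abs_nonneg _) hC0
    have q3 : |c i * (I3 - δ ^ (3 + 1) * defectMoment 3)| ≤ C * (T3 * δ ^ 5) := by
      rw [abs_mul]; exact mul_le_mul hc s3 (abs_nonneg _) hC0
    norm_num only at q1 q3
    rw [abs_le] at q1 q2 q3 hrem ⊢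
    constructor <;> linarith
  refine ⟨ε, 2 * (C * (T1 + T2 + T3) + C * P * X), hε, hεR', by positivity, fun δ hδ i => ?_⟩
  rw [integral_add (h.integrableOn_rayKernel hδ i hεR') (h.integrableOn_rayKernel hδ i.opp hεR')]
  have h1 := hmain δ hδ i
  have h2 := hmain δ hδ i.opp
  -- The `δ²` and `δ⁴` terms are now opposite for the two rays and cancel in the sum.
  rw [(hopp i).1, (hopp i).2] at h2
  rw [abs_le] at h1 h2 ⊢
  constructor <;> linarith

end IsSurfacePatch

/-! ### From rays to the plane. -/

namespace IsSurfacePatch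

variable {R : ℝ} {G ν : E2 → E3} {π : E3 → E2} {L : ℝ≥0} {g : E2 → ℝ}

/-- The kernel of the regularization error in the parameter plane. -/
def planeKernel (G ν : E2 → E3) (g : E2 → ℝ) (δ : ℝ) (a b : E2) : ℝ :=
  numerator G ν g a b * areaDensity G b / ‖G b - G a‖ ^ 3 * defect (‖G b - G a‖ / δ)

theorem ball_subset {a : E2} (ha : ‖a‖ ≤ R / 4) {ε : ℝ}
    (hε : ε < R / 4) : Metric.ball a ε ⊆ Metric.closedBall (0 : E2) (R / 2) := by
  intro b hb
  rw [mem_ball_iff_norm] at hb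
  rw [mem_closedBall_zero_iff]
  have := norm_le_norm_add_norm_sub' b a
  linarith

theorem integrableOn_planeKernel (h : IsSurfacePatch R G ν π L g) {δ : ℝ} (hδ : 0 < δ) {a : E2}
    (ha : ‖a‖ ≤ R / 4) {ε : ℝ} (hε : ε < R / 4) :
    IntegrableOn (planeKernel G ν g δ a) (Metric.ball a ε) := by
  obtain ⟨C, hC0, hC⟩ := h.exists_numerator_bound
  obtain ⟨J, hJ0, hJ⟩ := h.exists_areaDensity_le
  obtain ⟨A, hA0, hA⟩ := exists_abs_defect_le
  have hsub := ball_subset ha hε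
  have hsub' := hsub.trans h.closedBall_subset
  have haR : a ∈ Metric.closedBall (0 : E2) (R / 2) := by
    rw [mem_closedBall_zero_iff]
    linarith [h.radius_pos]
  have hchord : ContinuousOn (fun b => ‖G b - G a‖) (Metric.ball a ε) :=
    ((h.contDiffOn.continuousOn.mono hsub').sub continuousOn_const).norm
  have hm1 := ((h.continuousOn_numerator (h.closedBall_subset haR)).mono hsub').aemeasurable
    (μ := volume) measurableSet_ball
  have hm2 := (hchord.pow 3).aemeasurable (μ := volume) measurableSet_ball
  have hm3 := (continuous_defect.comp_continuousOn (hchord.div_const δ)).aemeasurable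
    (μ := volume) measurableSet_ball
  refine Integrable.mono' (integrableOn_const (C := C * J * A) measure_ball_lt_top.ne)
    ((hm1.div hm2).mul hm3).aestronglyMeasurable ?_
  filter_upwards [self_mem_ae_restrict measurableSet_ball] with b hb
  have h1 := hC a haR b (hsub hb)
  have h2 := h.expanding b (hsub' hb) a (h.closedBall_subset haR)
  have h3 := hJ b (hsub hb)
  have h4 : |defect (‖G b - G a‖ / δ)| ≤ A :=
    (hA _ (by positivity)).trans (mul_le_of_le_one_right hA0 (Real.exp_le_one_iff.2 (by
      rw [Left.neg_nonpos_iff]; positivity)))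
  have h5 : |numerator G ν g a b * areaDensity G b / ‖G b - G a‖ ^ 3| ≤ C * J := by
    rw [abs_div, abs_mul, abs_of_nonneg (pow_nonneg (norm_nonneg (G b - G a)) 3)]
    refine div_le_of_le_mul₀ (by positivity) (by positivity) ?_
    calc _ ≤ (C * ‖b - a‖ ^ 3) * J := mul_le_mul h1 h3 (abs_nonneg _) (by positivity)
      _ ≤ (C * ‖G b - G a‖ ^ 3) * J := by gcongr
      _ = _ := by ring
  rw [planeKernel, Real.norm_eq_abs, abs_mul]
  exact mul_le_mul h5 h4 (abs_nonneg _) (by positivity)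

/-- Around each point of the parameter domain the error kernel integrates to `O(δ⁵)`. -/
theorem exists_planar_bound (h : IsSurfacePatch R G ν π L g) :
    ∃ ε C : ℝ, 0 < ε ∧ ε < R / 4 ∧ 0 ≤ C ∧ ∀ δ : ℝ, 0 < δ → ∀ a : E2, ‖a‖ ≤ R / 4 →
      |∫ b in Metric.ball a ε, planeKernel G ν g δ a b| ≤ C * δ ^ 5 := by
  obtain ⟨ε, C, hε, hεR, hC0, hC⟩ := h.exists_ray_bound
  set σ := (volume : Measure E2).toSphere.real univ
  refine ⟨ε, C * σ, hε, hεR, by positivity, fun δ hδ a ha => ?_⟩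
  set f : E2 → ℝ := (Metric.ball a ε).indicator (planeKernel G ν g δ a)
  have hf : Integrable f :=
    (integrable_indicator_iff measurableSet_ball).2 (h.integrableOn_planeKernel hδ ha hεR)
  set F : E2 → ℝ := fun ξ => f (a + ξ)
  have hF : Integrable F := hf.comp_add_left a
  have hFint : ∫ ξ, F ξ = ∫ b in Metric.ball a ε, planeKernel G ν g δ a b := by
    rw [integral_add_left_eq_self f a, integral_indicator measurableSet_ball]
  -- The disc about `a` is symmetric; replacing `F` by its symmetrization pairs each ray with its
  -- opposite before a bound is taken ray by ray.
  have hsum : ∫ ξ, (F ξ + F (-ξ)) = 2 * ∫ ξ, F ξ := by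
    rw [integral_add hF hF.comp_neg, integral_neg_eq_self F]
    ring
  have hray : ∀ (i : Ray R), i.1.1 = a → ∀ r : ℝ, 0 < r →
      r * F (r • i.1.2) = (Ioo 0 ε).indicator (rayKernel R G ν g δ i) r := by
    intro i hi r hr
    have hmem : a + r • i.1.2 ∈ Metric.ball a ε ↔ r ∈ Ioo 0 ε := by
      simp [norm_smul, i.2.2, abs_of_pos hr, hr]
    by_cases hrε : r ∈ Ioo 0 ε
    · simp only [F, f]
      rw [indicator_of_mem hrε, indicator_of_mem (hmem.2 hrε)]
      simp only [planeKernel, rayKernel, numeratorRay, chord, Ray.point, hi]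
      ring
    · simp only [F, f]
      rw [indicator_of_notMem hrε, indicator_of_notMem (fun h => hrε (hmem.1 h)), mul_zero]
  have hbound : |∫ ξ, (F ξ + F (-ξ))| ≤ C * δ ^ 5 * σ := by
    refine abs_integral_le_of_polar (hF.add hF.comp_neg) fun w hw => ?_
    set i : Ray R := ⟨(a, w), ha, hw⟩
    refine le_of_eq_of_le ?_ (hC δ hδ i)
    congr 1
    simp only [Pi.add_apply]
    have e : ∀ r ∈ Ioi (0 : ℝ), r * (F (r • w) + F (-(r • w)))
        = (Ioo 0 ε).indicator (fun r => rayKernel R G ν g δ i r + rayKernel R G ν g δ i.opp r)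
          r := by
      intro r hr
      have h1 := hray i rfl r hr
      have h2 := hray i.opp rfl r hr
      simp only [Ray.opp, i, smul_neg] at h1 h2
      rw [mul_add, h1, h2, indicator_add]
      rfl
    rw [setIntegral_congr_fun measurableSet_Ioi e, setIntegral_indicator measurableSet_Ioo]
    congr 2
    ext r
    simp
  rw [hsum, hFint, abs_mul, abs_of_pos (two_pos : (0 : ℝ) < 2)] at hbound
  have : 0 ≤ |∫ b in Metric.ball a ε, planeKernel G ν g δ a b| := abs_nonneg _
  calc _ ≤ C * δ ^ 5 * σ := by linarith
    _ = _ := by ring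

end IsSurfacePatch

/-! ### Surface integrals in parameters. -/

namespace IsParametrization

variable {U : Set E2} {G : E2 → E3} {π : E3 → E2} {L : ℝ≥0}

theorem measurable_areaDensity (G : E2 → E3) : Measurable (areaDensity G) := by
  have h0 := measurable_fderiv_apply_const ℝ G (EuclideanSpace.single 0 1)
  have h1 := measurable_fderiv_apply_const ℝ G (EuclideanSpace.single 1 1)
  exact (((h0.norm.pow_const 2).mul (h1.norm.pow_const 2)).sub ((h0.inner h1).pow_const 2)).sqrt

/-- Change of variables for integrals over a parametrized piece of a surface. -/
theorem setIntegral_image (h : IsParametrization U G π L) {s : Set E2} (hs : MeasurableSet s)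
    (hsU : s ⊆ U) {F : E3 → ℝ}
    (hF : AEStronglyMeasurable (fun b => F (G b)) (volume.restrict s)) :
    ∫ x in G '' s, F x ∂(Measure.euclideanHausdorffMeasure 2)
      = ∫ b in s, areaDensity G b * F (G b) := by
  have hsimg := h.measurableSet_image hs hsU
  have hpre : π ⁻¹' s ∩ G '' U = G '' s := by
    ext x
    constructor
    · rintro ⟨hx, ξ, hξ, rfl⟩
      exact ⟨ξ, by simpa [h.leftInv ξ hξ] using hx, rfl⟩
    · rintro ⟨ξ, hξ, rfl⟩
      exact ⟨by simpa [h.leftInv ξ (hsU hξ)] using hξ, ξ, hsU hξ, rfl⟩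
  have hmeas : (pullback U G π).restrict s
      = (volume.restrict s).withDensity fun ξ => ENNReal.ofReal (areaDensity G ξ) := by
    rw [h.pullback_eq, restrict_withDensity hs, Measure.restrict_restrict hs,
      inter_eq_left.2 hsU]
    rfl
  have hF' : AEStronglyMeasurable (fun b => F (G b)) ((pullback U G π).restrict s) := by
    rw [hmeas]
    exact hF.mono_ac (withDensity_absolutelyContinuous _ _)
  have hmap : (pullback U G π).restrict s
      = ((Measure.euclideanHausdorffMeasure 2).restrict (G '' s)).map π := by
    rw [pullback, Measure.restrict_map h.measurable hs,
      Measure.restrict_restrict (h.measurable hs), hpre]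
  -- On the image `G ∘ π` is the identity, so the integrand factors through `π` and the integral
  -- passes to the pushforward measure.
  have h1 : ∫ x in G '' s, F x ∂(Measure.euclideanHausdorffMeasure 2)
      = ∫ x in G '' s, F (G (π x)) ∂(Measure.euclideanHausdorffMeasure 2) := by
    refine setIntegral_congr_fun hsimg ?_
    rintro _ ⟨ξ, hξ, rfl⟩
    simp only [h.leftInv ξ (hsU hξ)]
  rw [h1]
  rw [hmap] at hF'
  rw [← integral_map (f := fun b => F (G b)) h.measurable.aemeasurable hF', ← hmap, hmeas,
    integral_withDensity_eq_integral_toReal_smul (measurable_areaDensity G).ennreal_ofReal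
      (.of_forall fun x => ENNReal.ofReal_lt_top)]
  refine integral_congr_ae (.of_forall fun b => ?_)
  simp only [smul_eq_mul]
  rw [ENNReal.toReal_ofReal (show 0 ≤ areaDensity G b from Real.sqrt_nonneg _)]

end IsParametrization

/-! ### The boundary of `Ω`: patches, near and far parts, uniformity. -/

section Boundary

variable {Ω : Set E3} {f : E3 → ℝ} {y : E3}

theorem norm_outwardNormal (hΩ : HasSmoothBoundary Ω) (hy : y ∈ frontier Ω) :
    ‖outwardNormal Ω y‖ = 1 := by
  obtain ⟨U, ρ, hyU, h⟩ := hΩ y hy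
  rw [h.outwardNormal_eq hΩ hyU hy]
  simp [norm_smul, h.gradient_ne_zero y hyU]

theorem continuousOn_outwardNormal (hΩ : HasSmoothBoundary Ω) :
    ContinuousOn (outwardNormal Ω) (frontier Ω) := by
  intro y hy
  obtain ⟨U, ρ, hyU, h⟩ := hΩ y hy
  have hUn := h.isOpen.mem_nhds hyU
  have h1 := ((h.contDiffOn_unitGradient 0).continuousOn.continuousAt hUn).continuousWithinAt
    (s := frontier Ω)
  refine h1.congr_of_eventuallyEq ?_ (h.outwardNormal_eq hΩ hyU hy)
  filter_upwards [self_mem_nhdsWithin, mem_nhdsWithin_of_mem_nhds hUn] with x hx hxU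
  exact h.outwardNormal_eq hΩ hxU hx

theorem isCompact_frontier (hb : Bornology.IsBounded Ω) : IsCompact (frontier Ω) :=
  Metric.isCompact_of_isClosed_isBounded isClosed_frontier
    (hb.closure.subset frontier_subset_closure)

theorem exists_surfacePatch (hΩ : HasSmoothBoundary Ω)
    (hf : ContDiffOn ℝ 7 f (frontier Ω)) (hy : y ∈ frontier Ω) :
    ∃ (R : ℝ) (G : E2 → E3) (π : E3 → E2) (L : ℝ≥0),
      IsSurfacePatch R G (fun ξ => outwardNormal Ω (G ξ)) π L (fun ξ => f (G ξ)) ∧ G 0 = y ∧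
      (∀ ξ ∈ Metric.ball (0 : E2) R, G ξ ∈ frontier Ω) ∧
      ∀ᶠ x in 𝓝 y, x ∈ frontier Ω → π x ∈ Metric.ball (0 : E2) R ∧ G (π x) = x := by
  obtain ⟨U, ρ, hyU, h⟩ := hΩ y hy
  obtain ⟨R, G, π, L, hR, hG, hG0, hmem, hev⟩ := h.exists_parametrization hy hyU
  have hG7 : ContDiffOn ℝ 7 G (Metric.ball 0 R) := hG.contDiffOn.of_le (by norm_num)
  refine ⟨R, G, π, L, { hG with
    radius_pos := hR
    normal := ?_
    density := hf.comp hG7 fun ξ hξ => (hmem ξ hξ).1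
    orthogonal := ?_ }, hG0, fun ξ hξ => (hmem ξ hξ).1, hev⟩
  · refine ((h.contDiffOn_unitGradient 7).comp hG7 fun ξ hξ => (hmem ξ hξ).2).congr ?_
    exact fun ξ hξ => h.outwardNormal_eq hΩ (hmem ξ hξ).2 (hmem ξ hξ).1
  · intro ξ hξ v
    have h1 : HasFDerivAt ρ (InnerProductSpace.toDual ℝ E3 (gradient ρ (G ξ))) (G ξ) :=
      (h.differentiableAt (hmem ξ hξ).2).hasGradientAt.hasFDerivAt
    have h2 := h1.comp ξ (hG.hasStrictFDerivAt hξ).hasFDerivAt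
    have h3 : HasFDerivAt (ρ ∘ G) (0 : E2 →L[ℝ] ℝ) ξ := by
      refine (hasFDerivAt_const (0 : ℝ) ξ).congr_of_eventuallyEq ?_
      filter_upwards [hG.isOpen.mem_nhds hξ] with η hη
      exact (h.mem_frontier_iff (hmem η hη).2).1 (hmem η hη).1
    have h4 := DFunLike.congr_fun (h2.unique h3) v
    simp only [ContinuousLinearMap.comp_apply, InnerProductSpace.toDual_apply_apply,
      zero_apply] at h4
    rw [h.outwardNormal_eq hΩ (hmem ξ hξ).2 (hmem ξ hξ).1, real_inner_smul_left, h4, mul_zero]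

theorem isFiniteMeasure_surfaceMeasure (hb : Bornology.IsBounded Ω)
    (hΩ : HasSmoothBoundary Ω) : IsFiniteMeasure (surfaceMeasure Ω) := by
  rw [surfaceMeasure, isFiniteMeasure_restrict]
  refine ((isCompact_frontier hb).measure_lt_top_of_nhdsWithin fun y hy => ?_).ne
  -- Only the chart is needed here, so the density is taken to be zero.
  obtain ⟨R, G, π, L, h, -, -, hev⟩ := exists_surfacePatch hΩ
    (contDiffOn_const (c := (0 : ℝ))) hy
  refine ⟨G '' Metric.ball 0 R, ?_, ?_⟩
  · filter_upwards [self_mem_nhdsWithin, mem_nhdsWithin_of_mem_nhds hev] with x hx hxe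
    exact ⟨π x, (hxe hx).1, (hxe hx).2⟩
  · refine (euclideanHausdorffMeasure_image_le h.lipschitz 2).trans_lt ?_
    rw [EuclideanSpace.euclideanHausdorffMeasure_eq_volume]
    exact ENNReal.mul_lt_top (ENNReal.pow_lt_top ENNReal.coe_lt_top) measure_ball_lt_top

theorem aestronglyMeasurable_integrand (hΩ : HasSmoothBoundary Ω)
    (hf : ContinuousOn f (frontier Ω)) (y : E3) :
    AEStronglyMeasurable (integrand Ω f y) (surfaceMeasure Ω) := by
  have h1 : ContinuousOn (fun x => inner ℝ (f x • outwardNormal Ω y + f y • outwardNormal Ω x)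
      (y - x)) (frontier Ω) :=
    ((hf.smul continuousOn_const).add ((continuousOn_outwardNormal hΩ).const_smul (f y))).inner
      (continuousOn_const.sub continuousOn_id)
  have h2 : Continuous fun x : E3 => 4 * Real.pi * ‖x - y‖ ^ 3 := by fun_prop
  exact ((h1.aemeasurable isClosed_frontier.measurableSet).div
    h2.measurable.aemeasurable).aestronglyMeasurable

theorem continuous_defect_comp (δ : ℝ) (y : E3) : Continuous fun x => defect (‖x - y‖ / δ) :=
  continuous_defect.comp (by fun_prop)

theorem exists_abs_integrand_le_of_le (hb : Bornology.IsBounded Ω) (hΩ : HasSmoothBoundary Ω)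
    (hf : ContinuousOn f (frontier Ω)) {τ : ℝ} (hτ : 0 < τ) :
    ∃ C, 0 ≤ C ∧ ∀ y ∈ frontier Ω, ∀ x ∈ frontier Ω, τ ≤ ‖x - y‖ → |integrand Ω f y x| ≤ C := by
  obtain ⟨M, hM⟩ := (isCompact_frontier hb).exists_bound_of_continuousOn hf
  refine ⟨2 * |M| / (4 * Real.pi * τ ^ 2), by positivity, fun y hy x hx hxy => ?_⟩
  have h1 : ‖f x • outwardNormal Ω y + f y • outwardNormal Ω x‖ ≤ 2 * |M| := by
    refine (norm_add_le _ _).trans ?_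
    rw [norm_smul, norm_smul, norm_outwardNormal hΩ hy, norm_outwardNormal hΩ hx]
    linarith [(hM x hx).trans (le_abs_self M), (hM y hy).trans (le_abs_self M)]
  have h2 := abs_real_inner_le_norm (f x • outwardNormal Ω y + f y • outwardNormal Ω x) (y - x)
  rw [norm_sub_rev y x] at h2
  have h0 : 0 < ‖x - y‖ := hτ.trans_le hxy
  have hpi := Real.pi_pos
  have hden : 0 < 4 * Real.pi * ‖x - y‖ ^ 3 := by positivity
  rw [integrand, abs_div, abs_of_pos hden, div_le_div_iff₀ hden (by positivity)]
  calc _ ≤ (2 * |M| * ‖x - y‖) * (4 * Real.pi * τ ^ 2) := by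
        gcongr
        exact h2.trans (by gcongr)
    _ ≤ (2 * |M| * ‖x - y‖) * (4 * Real.pi * ‖x - y‖ ^ 2) := by gcongr
    _ = _ := by ring

/-- Gaussian decay beats every power; the fifth power is the one that makes the far part of the
error `O(δ⁵)`. -/
theorem exists_abs_defect_div_le :
    ∃ A, 0 ≤ A ∧ (∀ r, 0 ≤ r → |defect r| ≤ A) ∧
      ∀ δ, 0 < δ → ∀ τ, 0 < τ → ∀ r, τ ≤ r → |defect (r / δ)| ≤ A * (δ / τ) ^ 5 := by
  obtain ⟨A, hA0, hA⟩ := exists_abs_defect_le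
  obtain ⟨B, hB0, hB⟩ := exists_pow_mul_abs_defect_le 5
  refine ⟨max A B, le_max_of_le_left hA0, fun r hr => ?_, fun δ hδ τ hτ r hr => ?_⟩
  · refine ((hA r hr).trans (mul_le_of_le_one_right hA0 ?_)).trans (le_max_left _ _)
    exact Real.exp_le_one_iff.2 (by rw [Left.neg_nonpos_iff]; positivity)
  · have hr0 : 0 < r := hτ.trans_le hr
    have h1 : (r / δ) ^ 5 * |defect (r / δ)| ≤ B :=
      (hB _ (by positivity)).trans (mul_le_of_le_one_right hB0
        (Real.exp_le_one_iff.2 (by rw [Left.neg_nonpos_iff]; positivity)))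
    have h2 : (τ / δ) ^ 5 * |defect (r / δ)| ≤ max A B :=
      (le_trans (by gcongr) h1).trans (le_max_right _ _)
    have h3 : (δ / τ) ^ 5 * (τ / δ) ^ 5 = 1 := by
      rw [← mul_pow]
      field_simp
    calc |defect (r / δ)| = (δ / τ) ^ 5 * ((τ / δ) ^ 5 * |defect (r / δ)|) := by
          rw [← mul_assoc, h3, one_mul]
      _ ≤ (δ / τ) ^ 5 * max A B := by gcongr
      _ = _ := mul_comm _ _

end Boundary

section Boundary

variable {Ω : Set E3} {f : E3 → ℝ} {y : E3}

theorem integrable_integrand_of_bound (hb : Bornology.IsBounded Ω) (hΩ : HasSmoothBoundary Ω)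
    (hf : ContinuousOn f (frontier Ω)) {C : ℝ}
    (hC : ∀ x ∈ frontier Ω, |integrand Ω f y x| ≤ C) :
    Integrable (integrand Ω f y) (surfaceMeasure Ω) := by
  have := isFiniteMeasure_surfaceMeasure hb hΩ
  exact Integrable.of_bound (aestronglyMeasurable_integrand hΩ hf y) C
    ((ae_restrict_mem isClosed_frontier.measurableSet).mono hC)

theorem integrable_integrand_mul_defect (hint : Integrable (integrand Ω f y) (surfaceMeasure Ω))
    {δ : ℝ} (hδ : 0 < δ) :
    Integrable (fun x => integrand Ω f y x * defect (‖x - y‖ / δ)) (surfaceMeasure Ω) := by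
  obtain ⟨A, -, hA, -⟩ := exists_abs_defect_div_le
  exact hint.mul_bdd (c := A) (continuous_defect_comp δ y).aestronglyMeasurable
    (.of_forall fun x => hA _ (by positivity))

/-- Near a boundary point the integrand is bounded and the regularization error is of fifth
order, uniformly. -/
theorem exists_local_bound (hb : Bornology.IsBounded Ω) (hΩ : HasSmoothBoundary Ω)
    (hf : ContDiffOn ℝ 7 f (frontier Ω)) (hy : y ∈ frontier Ω) :
    ∃ C, 0 ≤ C ∧ ∀ᶠ z in 𝓝 y, z ∈ frontier Ω →
      (∀ x ∈ frontier Ω, |integrand Ω f z x| ≤ C) ∧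
      ∀ δ, 0 < δ →
        |∫ x, integrand Ω f z x * defect (‖x - z‖ / δ) ∂(surfaceMeasure Ω)| ≤ C * δ ^ 5 := by
  have hfin := isFiniteMeasure_surfaceMeasure hb hΩ
  have hpi := Real.pi_pos
  obtain ⟨R, G, π, L, h, hG0, hGS, hev⟩ := exists_surfacePatch hΩ hf hy
  obtain ⟨ε, C1, hε, hεR, hC1, hplane⟩ := h.exists_planar_bound
  obtain ⟨C2, hC2, hnum⟩ := h.exists_numerator_bound
  obtain ⟨r, hr, hchart⟩ := Metric.eventually_nhds_iff_ball.1 hev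
  -- If `‖z - y‖ < τ`, every boundary point within `τ` of `z` is within `r` of `y`, hence in the
  -- chart. As `G` is expanding, its parameter is then within `ε` of `a`, and `a` itself lies in the
  -- disc of radius `R / 4`.
  set τ := min ε (r / 2)
  have hτ : 0 < τ := lt_min hε (by positivity)
  have hτε : τ ≤ ε := min_le_left _ _
  have hτr : τ ≤ r / 2 := min_le_right _ _
  obtain ⟨C3, hC3, hfar⟩ := exists_abs_integrand_le_of_le hb hΩ hf.continuousOn hτ
  obtain ⟨A, hA0, -, hA⟩ := exists_abs_defect_div_le
  set m := (surfaceMeasure Ω).real univ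
  have hm : 0 ≤ m := measureReal_nonneg
  have h1 : 0 ≤ C3 * (A / τ ^ 5) * m := by positivity
  refine ⟨C2 + C3 + C1 + C3 * (A / τ ^ 5) * m, by positivity, ?_⟩
  filter_upwards [Metric.ball_mem_nhds y hτ] with z hz hzS
  rw [mem_ball_iff_norm] at hz
  obtain ⟨hzR, hzG⟩ := hchart z (by rw [mem_ball_iff_norm]; linarith) hzS
  set a := π z
  have h0R : (0 : E2) ∈ Metric.ball 0 R := Metric.mem_ball_self h.radius_pos
  have ha : ‖a‖ ≤ R / 4 := by
    have := h.expanding a hzR 0 h0R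
    rw [hzG, hG0, sub_zero] at this
    linarith
  have haK : a ∈ Metric.closedBall (0 : E2) (R / 2) := by
    rw [mem_closedBall_zero_iff]
    linarith [h.radius_pos]
  have hsub := IsSurfacePatch.ball_subset ha hεR
  have hsub' := hsub.trans h.closedBall_subset
  set D := G '' Metric.ball a ε
  have hDS : D ⊆ frontier Ω := by
    rintro _ ⟨b, hb, rfl⟩
    exact hGS b (hsub' hb)
  have hD : MeasurableSet D := h.measurableSet_image measurableSet_ball hsub'
  have hnear : ∀ x ∈ frontier Ω, x ∉ D → τ ≤ ‖x - z‖ := by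
    intro x hx hxD
    by_contra! hlt
    refine hxD ?_
    obtain ⟨hxR, hxG⟩ := hchart x (by
      rw [mem_ball_iff_norm]
      have := norm_sub_le_norm_sub_add_norm_sub x z y
      linarith) hx
    refine ⟨π x, ?_, hxG⟩
    have := h.expanding (π x) hxR a hzR
    rw [hxG, hzG] at this
    rw [mem_ball_iff_norm]
    linarith
  have hbdd : ∀ x ∈ frontier Ω, |integrand Ω f z x| ≤ C2 + C3 := by
    intro x hx
    by_cases hxD : x ∈ D
    · refine le_trans ?_ (le_add_of_nonneg_right hC3)
      obtain ⟨b, hb, rfl⟩ := hxD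
      have e : integrand Ω f z (G b) = numerator G (fun ξ => outwardNormal Ω (G ξ))
          (fun ξ => f (G ξ)) a b / (4 * Real.pi * ‖G b - z‖ ^ 3) := by
        simp only [numerator, integrand, hzG]
      rw [e, abs_div, abs_of_nonneg (show 0 ≤ 4 * Real.pi * ‖G b - z‖ ^ 3 by positivity)]
      refine div_le_of_le_mul₀ (by positivity) hC2 ?_
      have h2 := h.expanding b (hsub' hb) a hzR
      rw [hzG] at h2
      calc _ ≤ C2 * ‖b - a‖ ^ 3 := hnum a haK b (hsub hb)
        _ ≤ C2 * (1 * ‖G b - z‖ ^ 3) := by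
            rw [one_mul]
            gcongr
        _ ≤ _ := by
            gcongr
            linarith [Real.pi_gt_three]
    · exact (hfar z hzS x hx (hnear x hx hxD)).trans (le_add_of_nonneg_left hC2)
  refine ⟨fun x hx => (hbdd x hx).trans (by linarith), fun δ hδ => ?_⟩
  have hint := integrable_integrand_mul_defect
    (integrable_integrand_of_bound hb hΩ hf.continuousOn hbdd) hδ
  have hchord : ContinuousOn (fun b => ‖G b - z‖) (Metric.ball a ε) :=
    ((h.contDiffOn.continuousOn.mono hsub').sub continuousOn_const).norm
  have hmeas : AEStronglyMeasurable
      (fun b => integrand Ω f z (G b) * defect (‖G b - z‖ / δ))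
      (volume.restrict (Metric.ball a ε)) := by
    have hm1 : AEMeasurable (fun b => inner ℝ
        (f (G b) • outwardNormal Ω z + f z • outwardNormal Ω (G b)) (z - G b))
        (volume.restrict (Metric.ball a ε)) :=
      ((((h.density.continuousOn.smul continuousOn_const).add
        (h.normal.continuousOn.const_smul (f z))).inner
        (continuousOn_const.sub h.contDiffOn.continuousOn)).mono hsub').aemeasurable
        measurableSet_ball
    have hm2 := ((hchord.pow 3).const_mul (4 * Real.pi)).aemeasurable (μ := volume)
      measurableSet_ball
    have hm3 := (continuous_defect.comp_continuousOn (hchord.div_const δ)).aemeasurable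
      (μ := volume) measurableSet_ball
    exact ((hm1.div hm2).mul hm3).aestronglyMeasurable
  have hin : ∫ x in D, integrand Ω f z x * defect (‖x - z‖ / δ) ∂(surfaceMeasure Ω)
      = (4 * Real.pi)⁻¹ * ∫ b in Metric.ball a ε, IsSurfacePatch.planeKernel G
        (fun ξ => outwardNormal Ω (G ξ)) (fun ξ => f (G ξ)) δ a b := by
    rw [surfaceMeasure, Measure.restrict_restrict hD, inter_eq_left.2 hDS,
      h.setIntegral_image (F := fun x => integrand Ω f z x * defect (‖x - z‖ / δ))
        measurableSet_ball hsub' hmeas, ← integral_const_mul]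
    congr 1
    ext b
    simp only [IsSurfacePatch.planeKernel, numerator, integrand, hzG, div_eq_mul_inv, mul_inv]
    ring
  have hout : |∫ x in Dᶜ, integrand Ω f z x * defect (‖x - z‖ / δ) ∂(surfaceMeasure Ω)|
      ≤ C3 * (A * (δ / τ) ^ 5) * m := by
    rw [← Real.norm_eq_abs]
    refine (norm_integral_le_of_norm_le_const (C := C3 * (A * (δ / τ) ^ 5)) ?_).trans ?_
    · filter_upwards [ae_restrict_mem hD.compl,
        ae_restrict_of_ae (ae_restrict_mem isClosed_frontier.measurableSet)] with x hxD hxS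
      have hfx := hnear x hxS hxD
      rw [Real.norm_eq_abs, abs_mul]
      exact mul_le_mul (hfar z hzS x hxS hfx) (hA δ hδ τ hτ _ hfx) (abs_nonneg _) hC3
    · gcongr
      rw [measureReal_restrict_apply MeasurableSet.univ]
      exact measureReal_mono (subset_univ _)
  have hin' : |∫ x in D, integrand Ω f z x * defect (‖x - z‖ / δ) ∂(surfaceMeasure Ω)|
      ≤ C1 * δ ^ 5 := by
    rw [hin, abs_mul, abs_of_pos (show 0 < (4 * Real.pi)⁻¹ by positivity)]
    refine (mul_le_of_le_one_left (abs_nonneg _) ?_).trans (hplane δ hδ a ha)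
    exact inv_le_one_of_one_le₀ (by linarith [Real.pi_gt_three])
  rw [← integral_add_compl hD hint]
  calc _ ≤ C1 * δ ^ 5 + C3 * (A * (δ / τ) ^ 5) * m := (abs_add_le _ _).trans (add_le_add hin' hout)
    _ = (C1 + C3 * (A / τ ^ 5) * m) * δ ^ 5 := by
        rw [div_pow]
        ring
    _ ≤ _ := by
        gcongr
        linarith

/-- The local bounds hold for all boundary points near a given one, so finitely many neighbourhoods
cover the compact boundary and their constants add up. -/
theorem exists_uniform_bound (hb : Bornology.IsBounded Ω) (hΩ : HasSmoothBoundary Ω)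
    (hf : ContDiffOn ℝ 7 f (frontier Ω)) :
    ∃ C, 0 ≤ C ∧ ∀ y ∈ frontier Ω, (∀ x ∈ frontier Ω, |integrand Ω f y x| ≤ C) ∧
      ∀ δ, 0 < δ →
        |∫ x, integrand Ω f y x * defect (‖x - y‖ / δ) ∂(surfaceMeasure Ω)| ≤ C * δ ^ 5 := by
  refine (isCompact_frontier hb).induction_on (p := fun K => ∃ C, 0 ≤ C ∧ ∀ y ∈ K,
    (∀ x ∈ frontier Ω, |integrand Ω f y x| ≤ C) ∧ ∀ δ, 0 < δ →
      |∫ x, integrand Ω f y x * defect (‖x - y‖ / δ) ∂(surfaceMeasure Ω)| ≤ C * δ ^ 5)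
    ⟨0, le_rfl, by simp⟩ ?_ ?_ ?_
  · rintro s t hst ⟨C, hC0, hC⟩
    exact ⟨C, hC0, fun y hy => hC y (hst hy)⟩
  · rintro s t ⟨C, hC0, hC⟩ ⟨D, hD0, hD⟩
    refine ⟨C + D, by positivity, ?_⟩
    rintro y (hy | hy)
    · exact ⟨fun x hx => ((hC y hy).1 x hx).trans (by linarith),
        fun δ hδ => ((hC y hy).2 δ hδ).trans (by gcongr; linarith)⟩
    · exact ⟨fun x hx => ((hD y hy).1 x hx).trans (by linarith),
        fun δ hδ => ((hD y hy).2 δ hδ).trans (by gcongr; linarith)⟩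
  · intro y hy
    obtain ⟨C, hC0, hC⟩ := exists_local_bound hb hΩ hf hy
    exact ⟨_, inter_mem self_mem_nhdsWithin (mem_nhdsWithin_of_mem_nhds hC), C, hC0,
      fun z hz => hz.2 hz.1⟩

theorem regIntegrand_shapeFive (δ : ℝ) (y x : E3) : regIntegrand shapeFive δ Ω f y x
    = integrand Ω f y x + integrand Ω f y x * defect (‖x - y‖ / δ) := by
  simp only [regIntegrand, integrand, defect]
  ring

theorem integrable_regIntegrand (hint : Integrable (integrand Ω f y) (surfaceMeasure Ω))
    {δ : ℝ} (hδ : 0 < δ) :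
    Integrable (regIntegrand shapeFive δ Ω f y) (surfaceMeasure Ω) :=
  (hint.add (integrable_integrand_mul_defect hint hδ)).congr
    (.of_forall fun x => (regIntegrand_shapeFive δ y x).symm)

theorem regPotential_sub_potential (hint : Integrable (integrand Ω f y) (surfaceMeasure Ω))
    {δ : ℝ} (hδ : 0 < δ) : regPotential shapeFive δ Ω f y - potential Ω f y
      = ∫ x, integrand Ω f y x * defect (‖x - y‖ / δ) ∂(surfaceMeasure Ω) := by
  simp only [regPotential, potential, regIntegrand_shapeFive]
  rw [integral_add hint (integrable_integrand_mul_defect hint hδ)]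
  ring

end Boundary

end AdjointDoubleLayer

end

theorem mainTheorem3 (Ω : Set AdjointDoubleLayer.E3) (hopen : IsOpen Ω)
    (hbdd : Bornology.IsBounded Ω) (hsmooth : AdjointDoubleLayer.HasSmoothBoundary Ω)
    (f : AdjointDoubleLayer.E3 → ℝ) (hf : ContDiffOn ℝ ∞ f (frontier Ω)) :
    (∀ y ∈ frontier Ω,
      Integrable (AdjointDoubleLayer.integrand Ω f y) (AdjointDoubleLayer.surfaceMeasure Ω)) ∧
    (∀ δ : ℝ, 0 < δ → ∀ y ∈ frontier Ω,
      Integrable (AdjointDoubleLayer.regIntegrand AdjointDoubleLayer.shapeFive δ Ω f y)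
        (AdjointDoubleLayer.surfaceMeasure Ω)) ∧
    (∃ C : ℝ, ∀ δ : ℝ, 0 < δ → ∀ y ∈ frontier Ω,
      |AdjointDoubleLayer.regPotential AdjointDoubleLayer.shapeFive δ Ω f y
        - AdjointDoubleLayer.potential Ω f y| ≤ C * δ ^ 5) ∧
    (∀ δ : ℝ, 0 < δ → ∀ P : EuclideanSpace ℝ (Fin 2) → ℝ, Continuous P →
      (∀ t : ℝ, 0 < t → ∀ ξ, P (t • ξ) = t ^ 4 * P ξ) →
      Integrable (AdjointDoubleLayer.errorIntegrand AdjointDoubleLayer.shapeFive δ P) ∧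
      ∫ ξ, AdjointDoubleLayer.errorIntegrand AdjointDoubleLayer.shapeFive δ P ξ = 0) := by
  have hf7 : ContDiffOn ℝ 7 f (frontier Ω) := contDiffOn_infty.1 hf 7
  obtain ⟨C, -, hC⟩ := AdjointDoubleLayer.exists_uniform_bound hbdd hsmooth hf7
  have hint : ∀ y ∈ frontier Ω, Integrable (AdjointDoubleLayer.integrand Ω f y)
      (AdjointDoubleLayer.surfaceMeasure Ω) := fun y hy =>
    AdjointDoubleLayer.integrable_integrand_of_bound hbdd hsmooth hf7.continuousOn (hC y hy).1
  refine ⟨hint, fun δ hδ y hy => AdjointDoubleLayer.integrable_regIntegrand (hint y hy) hδ,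
    ⟨C, fun δ hδ y hy => ?_⟩, fun δ hδ P hP hhom =>
      AdjointDoubleLayer.integrable_and_integral_errorIntegrand hδ hP hhom⟩
  rw [AdjointDoubleLayer.regPotential_sub_potential (hint y hy) hδ]
  exact (hC y hy).2 δ hδ
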